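/- Let $k$ be an algebraically closed field of characteristic zero and let $C$ be an algebraic curve over $k$, i.e. an integral separated scheme of finite type over $k$ of dimension $1$. For an integral scheme $X$ of finite type over $k$, let $r$ be the rank of the $\mathcal{O}_X$-module $\mathrm{Der}_k(\mathcal{O}_X)$. The blow-up of $X$ at $\mathrm{Der}_k(\mathcal{O}_X)$ is the morphism $f\colon \mathrm{Bl}_{\mathrm{Der}}(X)\to X$ characterized, up to unique isomorphism over $X$, by: (1) $f^*\mathrm{Der}_k(\mathcal{O}_X)/\mathrm{tor}$ is locally free of rank $r$; (2) for every morphism of schemes $\sigma\colon Z\to X$ such that $\sigma^*\mathrm{Der}_k(\mathcal{O}_X)/\mathrm{tor}$ is locally free of rank $r$ there is a unique morphism $\beta\colon Z\to \mathrm{Bl}_{\mathrm{Der}}(X)$ with $f\circ\beta=\sigma$. (Here $\mathrm{tor}$ denotes the torsion: sections that are locally killed by a non-zero-divisor.) Then there are $n\ge 0$ and a chain of morphisms $$C_n\to C_{n-1}\to\cdots\to C_1\to C_0=C,$$ where each $C_{i+1}\to C_i$ is the blow-up of $C_i$ at $\mathrm{Der}_k(\mathcal{O}_{C_i})$, such that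 the composite $C_n\to C$ is a resolution of singularities: $C_n$ is integral and nonsingular (all its local rings are regular), and $C_n\to C$ is proper, birational, and an isomorphism over every open subset of $C$ consisting of nonsingular points. -/

import Mathlib

open CategoryTheory AlgebraicGeometry TopologicalSpace
open scoped TensorProduct

universe u

namespace DerivationBlowup

/-- For a ring homomorphism `A → B` and an `A`-module `M` of rank `r`: the base change `B ⊗ M`
modulo its torsion (the elements killed by a non-zero-divisor of `B`) is a free `B`-module of
rank `r`. For a domain `A` with fraction field `K`, `Module.finrank A M` is the usual rank
`dim_K (K ⊗ M)`. -/
def FreeModTorsion (A B M : Type*) [CommRing A] [CommRing B] [Algebra A B]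
    [AddCommGroup M] [Module A M] : Prop :=
  Nonempty (((B ⊗[A] M) ⧸ Submodule.torsion B (B ⊗[A] M)) ≃ₗ[B] (Fin (Module.finrank A M) → B))

variable {k : Type u} [Field k]

/-- The `k`-algebra structure on the sections of a scheme `X` over `Spec k`. -/
@[reducible] noncomputable def sectionsAlgebra {X : Scheme.{u}} (s : X ⟶ Spec (.of k)) (U : X.Opens) :
    Algebra k Γ(X, U) :=
  ((Scheme.ΓSpecIso (.of k)).inv ≫ s.appLE ⊤ U le_top).hom.toAlgebra

/-- For a scheme `X` over `k` and `σ : Z ⟶ X`, the sheaf `σ^* Der_k(𝒪_X) / tor` is locally free,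
of rank the rank of `Der_k(𝒪_X)`. On an affine open `U` of `X` the sheaf `Der_k(𝒪_X)` is given by
the module `Der_k(Γ(X, U))`, so on an affine open `V` of `Z` that maps into `U` the pullback is
given by the module `Γ(Z, V) ⊗ Der_k(Γ(X, U))`. -/
def DerLocallyFreeModTorsion {X Z : Scheme.{u}} (s : X ⟶ Spec (.of k)) (σ : Z ⟶ X) : Prop :=
  ∀ z : Z, ∃ (U : X.affineOpens) (V : Z.affineOpens) (e : V.1 ≤ σ ⁻¹ᵁ U.1), z ∈ V.1 ∧
    letI : Algebra k Γ(X, U.1) := sectionsAlgebra s U.1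
    letI : Algebra Γ(X, U.1) Γ(Z, V.1) := (σ.appLE U.1 V.1 e).hom.toAlgebra
    FreeModTorsion Γ(X, U.1) Γ(Z, V.1) (Derivation k Γ(X, U.1) Γ(X, U.1))

/-- `f : Y ⟶ X` is the blow-up of the integral `k`-scheme `X` at the module `Der_k(𝒪_X)`: it is the
universal morphism to `X` for which the pullback of `Der_k(𝒪_X)`, modulo torsion, is locally free
of rank the rank of `Der_k(𝒪_X)`. This determines `f` up to a unique isomorphism over `X`. -/
structure IsDerBlowup {X Y : Scheme.{u}} (s : X ⟶ Spec (.of k)) (f : Y ⟶ X) : Prop where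
  locallyFree : DerLocallyFreeModTorsion s f
  existsUnique_lift : ∀ (Z : Scheme.{u}) (σ : Z ⟶ X), DerLocallyFreeModTorsion s σ →
    ∃! β : Z ⟶ Y, β ≫ f = σ

/-- `g : Y ⟶ X` is a composite `Xₙ ⟶ ⋯ ⟶ X₁ ⟶ X₀ = X` of `n` morphisms, each `Xᵢ₊₁ ⟶ Xᵢ` being the
blow-up of `Xᵢ` at `Der_k(𝒪_{Xᵢ})`. -/
inductive IsIteratedDerBlowup {X : Scheme.{u}} (s : X ⟶ Spec (.of k)) :
    ℕ → ∀ {Y : Scheme.{u}}, (Y ⟶ X) → Prop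
  | zero : IsIteratedDerBlowup s 0 (𝟙 X)
  | succ {n : ℕ} {Y Y' : Scheme.{u}} (g : Y ⟶ X) (f : Y' ⟶ Y) :
      IsIteratedDerBlowup s n g → IsDerBlowup (g ≫ s) f → IsIteratedDerBlowup s (n + 1) (f ≫ g)

/-- `X` is nonsingular at the point `x`. -/
def NonsingularAt (X : Scheme.{u}) (x : X) : Prop :=
  IsRegularLocalRing (X.presheaf.stalk x)

/-- `π : Y ⟶ X` is a resolution of singularities of the integral scheme `X`: `Y` is integral and
nonsingular, and `π` is proper, birational, and an isomorphism over the nonsingular points. -/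
structure IsResolutionOfSingularities {X Y : Scheme.{u}} (π : Y ⟶ X) : Prop where
  integral : AlgebraicGeometry.IsIntegral Y
  nonsingular : ∀ y : Y, NonsingularAt Y y
  proper : IsProper π
  birational : ∃ U : X.Opens, Dense (U : Set X) ∧ Dense ((π ⁻¹ᵁ U : Y.Opens) : Set Y) ∧
    IsIso (π ∣_ U)
  isIso_over_nonsingular : ∀ U : X.Opens, (∀ x ∈ U, NonsingularAt X x) → IsIso (π ∣_ U)

end DerivationBlowup

set_option linter.unusedSectionVars false

namespace DerivationBlowup

/-! ### The blow-up algebra of a fractional ideal -/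

section BlowupAlgebra

variable {A K : Type*} [CommRing A] [Field K] [Algebra A K]

/-! Let K be the function field of the curve. It has transcendence degree one, so in characteristic
zero all k-derivations of K are proportional; fix one, D ≠ 0. On an affine open set with ring A,
every derivation of A is f·D for a unique f in K. Thus Der_k(A) becomes a nonzero finitely generated
fractional ideal I = `derIdeal A D`, and the question is about blowing up a fractional ideal of a
one-dimensional domain.

The blow-up is Spec of R = ⋃ₙ (Iⁿ : Iⁿ), a ring between A and its integral closure, which is finite
over A. Locally, I extends to a principal ideal of the integral closure with a generator x in I
itself, because k is infinite (`exists_local_generator`); Noetherianity then puts all quotients f/x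
in R (`div_mem_blowupAlgebra`), so I becomes free modulo torsion over R. The universal property must
be tested on arbitrary rings B, not only domains. Elements of B are determined at the primes that
consist of zero-divisors. Torsion of B ⊗ I vanishes at such a prime, so I becomes principal at the
prime of A below it and every element of R lies in the local ring there. This gives uniqueness of R
→ B; a partition of unity assembles the local values into elements of B, which gives existence
(`exists_isImage`).

Now iterate. Over a member of a finite affine cover, the rings of the successive blow-ups increase
inside a finite module, so they cannot grow forever. If a blow-up changes nothing, then R = A, and
locally I = xA, i.e. the derivations are free of rank one. Lipman's theorem for curves
(`isIntegrallyClosed_of_derIdeal_eq_span`) then says that A is normal. To see this, replace D by xD,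
so that I = A, and let B be the normalization. At each prime of B, D lowers nonzero orders by a
fixed amount e + 1 with e ≥ 0; since D preserves A, all orders of elements of A are multiples of e +
1, while the conductor contains elements of two consecutive orders. Hence e = 0, D preserves B and
therefore the conductor, and a proper conductor would contain elements of ever smaller positive
order. So A = B.

Finally, normal and one-dimensional means regular. Over nonsingular points A is already normal,
hence R = A and each blow-up is an isomorphism there. All schemes in the chain carry a compatible
K-valued generic point (`IsModel`), so their rings can be compared as subrings of K. -/

theorem mul_mem_pow_succ {I : Submodule A K} {b : K} {n : ℕ} (h : ∀ y ∈ I ^ n, b * y ∈ I ^ n) :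
    ∀ y ∈ I ^ (n + 1), b * y ∈ I ^ (n + 1) := by
  intro y hy
  rw [pow_succ] at hy ⊢
  induction hy using Submodule.mul_induction_on' with
  | mem_mul_mem m hm x hx =>
    rw [← mul_assoc]
    exact Submodule.mul_mem_mul (h m hm) hx
  | add x _ y _ hx hy => rw [mul_add]; exact add_mem hx hy

theorem mul_mem_pow_of_le {I : Submodule A K} {b : K} {n m : ℕ} (hnm : n ≤ m)
    (h : ∀ y ∈ I ^ n, b * y ∈ I ^ n) : ∀ y ∈ I ^ m, b * y ∈ I ^ m := by
  induction hnm with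
  | refl => exact h
  | step _ ih => exact mul_mem_pow_succ ih

/-- The union of the rings `(Iⁿ : Iⁿ)` for an `A`-submodule `I` of the field `K`. -/
def blowupAlgebra (I : Submodule A K) : Subalgebra A K where
  carrier := {b | ∃ n : ℕ, ∀ y ∈ I ^ n, b * y ∈ I ^ n}
  mul_mem' := by
    rintro a b ⟨n, hn⟩ ⟨m, hm⟩
    refine ⟨max n m, fun y hy ↦ ?_⟩
    rw [mul_assoc]
    exact mul_mem_pow_of_le (le_max_left n m) hn _ (mul_mem_pow_of_le (le_max_right n m) hm y hy)
  add_mem' := by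
    rintro a b ⟨n, hn⟩ ⟨m, hm⟩
    refine ⟨max n m, fun y hy ↦ ?_⟩
    rw [add_mul]
    exact add_mem (mul_mem_pow_of_le (le_max_left n m) hn y hy)
      (mul_mem_pow_of_le (le_max_right n m) hm y hy)
  algebraMap_mem' := fun a ↦ ⟨0, fun y hy ↦ by
    rw [← Algebra.smul_def]
    exact Submodule.smul_mem _ _ hy⟩

theorem mem_blowupAlgebra {I : Submodule A K} {b : K} :
    b ∈ blowupAlgebra I ↔ ∃ n : ℕ, ∀ y ∈ I ^ n, b * y ∈ I ^ n := Iff.rfl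

/-- Determinant trick: multiplication by b preserves the nonzero finitely generated module Iⁿ inside
a field. -/
theorem isIntegral_of_mem_blowupAlgebra {I : Submodule A K} (hI : I.FG) (hI0 : I ≠ ⊥) {b : K}
    (hb : b ∈ blowupAlgebra I) : IsIntegral A b := by
  obtain ⟨n, hn⟩ := hb
  obtain ⟨z, hz, hz0⟩ := Submodule.exists_mem_ne_zero_of_ne_bot hI0
  refine isIntegral_of_smul_mem_submodule (M := K) (I ^ n) (fun h ↦ ?_) (hI.pow n) b hn
  have := Submodule.pow_mem_pow I hz n
  rw [h, Submodule.mem_bot] at this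
  exact pow_ne_zero n hz0 this

variable {A' : Type*} [CommRing A'] [Algebra A A'] [Algebra A' K] [IsScalarTower A A' K]

theorem exists_pow_mul_mem_of_mem_span (g : A) [IsLocalization.Away g A'] {J : Submodule A K} {x : K}
    (hx : x ∈ Submodule.span A' (J : Set K)) : ∃ m : ℕ, algebraMap A K g ^ m * x ∈ J := by
  induction hx using Submodule.span_induction with
  | mem x hx => exact ⟨0, by simpa using hx⟩
  | zero => exact ⟨0, by simp⟩
  | add x y _ _ hx hy =>
    obtain ⟨m, hm⟩ := hx
    obtain ⟨n, hn⟩ := hy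
    refine ⟨m + n, ?_⟩
    rw [mul_add]
    refine add_mem ?_ ?_
    · have := J.smul_mem (g ^ n) hm
      rwa [Algebra.smul_def, map_pow, ← mul_assoc, ← pow_add, add_comm n] at this
    · have := J.smul_mem (g ^ m) hn
      rwa [Algebra.smul_def, map_pow, ← mul_assoc, ← pow_add] at this
  | smul a x _ hx =>
    obtain ⟨m, hm⟩ := hx
    obtain ⟨n, c, hc⟩ := IsLocalization.Away.surj g a
    refine ⟨n + m, ?_⟩
    have := J.smul_mem c hm
    convert this using 1
    have hc' := congr_arg (algebraMap A' K) hc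
    simp only [map_mul, map_pow, ← IsScalarTower.algebraMap_apply] at hc'
    rw [Algebra.smul_def, Algebra.smul_def, ← hc']
    ring

theorem mem_span_of_pow_mul_mem (g : A) [IsLocalization.Away g A'] {J : Submodule A K} {x : K} {m : ℕ}
    (hx : algebraMap A K g ^ m * x ∈ J) : x ∈ Submodule.span A' (J : Set K) := by
  obtain ⟨u, hu⟩ := (IsLocalization.Away.algebraMap_isUnit (S := A') g).pow m
  have h := Submodule.smul_mem _ ((u⁻¹ : A'ˣ) : A') (Submodule.subset_span (R := A') hx)
  convert h using 1
  rw [Algebra.smul_def, IsScalarTower.algebraMap_apply A A' K, ← map_pow, ← hu, ← mul_assoc,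
    ← map_mul]
  simp

theorem mem_span_iff_exists_pow_mul_mem (g : A) [IsLocalization.Away g A'] {J : Submodule A K} {x : K} :
    x ∈ Submodule.span A' (J : Set K) ↔ ∃ m : ℕ, algebraMap A K g ^ m * x ∈ J :=
  ⟨exists_pow_mul_mem_of_mem_span g, fun ⟨_, h⟩ ↦ mem_span_of_pow_mul_mem g h⟩

theorem span_pow_eq (I : Submodule A K) (n : ℕ) :
    Submodule.span A' (I : Set K) ^ n = Submodule.span A' ((I ^ n : Submodule A K) : Set K) := by
  rw [Submodule.span_pow]
  apply le_antisymm
  · exact Submodule.span_mono (Submodule.pow_subset_pow I)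
  · rw [Submodule.span_le, Submodule.pow_eq_span_pow_set]
    exact Submodule.span_subset_span A A' _

/-- Formation of the blow-up algebra commutes with inverting g. Since Iⁿ is finitely generated, the
largest of the exponents needed for its generators clears all denominators at once. -/
theorem mem_blowupAlgebra_span_iff (g : A) [IsLocalization.Away g A'] {I : Submodule A K}
    (hI : I.FG) {b : K} :
    b ∈ blowupAlgebra (Submodule.span A' (I : Set K)) ↔
      ∃ m : ℕ, algebraMap A K g ^ m * b ∈ blowupAlgebra I := by
  constructor
  · rintro ⟨n, hn⟩
    obtain ⟨T, hT⟩ := hI.pow n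
    have h1 : ∀ y ∈ I ^ n, ∃ m : ℕ, algebraMap A K g ^ m * (b * y) ∈ I ^ n := by
      intro y hy
      apply exists_pow_mul_mem_of_mem_span (A' := A') g
      rw [← span_pow_eq]
      apply hn
      rw [span_pow_eq]
      exact Submodule.subset_span hy
    choose! m hm using h1
    refine ⟨T.sup m, n, fun y hy ↦ ?_⟩
    rw [← hT] at hy
    induction hy using Submodule.span_induction with
    | mem y hy =>
      have hy' : y ∈ I ^ n := hT ▸ Submodule.subset_span hy
      have h2 := (I ^ n).smul_mem (g ^ (T.sup m - m y)) (hm y hy')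
      rw [Algebra.smul_def, map_pow, ← mul_assoc, ← pow_add,
        Nat.sub_add_cancel (Finset.le_sup (f := m) hy)] at h2
      rwa [mul_assoc]
    | zero => simp
    | add x y _ _ hx hy => rw [mul_add]; exact add_mem hx hy
    | smul a x _ hx => rw [mul_smul_comm]; exact Submodule.smul_mem _ _ hx
  · rintro ⟨m, n, hn⟩
    refine ⟨n, fun y hy ↦ ?_⟩
    rw [span_pow_eq, mem_span_iff_exists_pow_mul_mem g] at hy ⊢
    obtain ⟨l, hl⟩ := hy
    refine ⟨m + l, ?_⟩
    have := hn _ hl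
    convert this using 1
    ring

theorem blowupAlgebra_eq_bot_iff {I : Submodule A K} :
    blowupAlgebra I = ⊥ ↔ ∀ b ∈ blowupAlgebra I, b ∈ (algebraMap A K).range := by
  rw [← le_bot_iff, SetLike.le_def]
  simp [Algebra.mem_bot]

end BlowupAlgebra

end DerivationBlowup

namespace DerivationBlowup

/-! ### Rank-one freeness modulo torsion -/

section Liftable

/-- `B ⊗ M` modulo torsion is locally free of rank one, witnessed by a surjection onto `B` that
exhibits all relations modulo torsion. -/
def IsLiftable (A B M : Type*) [CommRing A] [CommRing B] [Algebra A B]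
    [AddCommGroup M] [Module A M] : Prop :=
  ∃ φ : M →ₗ[A] B, Ideal.span (Set.range φ) = ⊤ ∧
    ∀ m m' : M, ∃ c ∈ nonZeroDivisors B, c • (φ m ⊗ₜ[A] m' - φ m' ⊗ₜ[A] m) = (0 : B ⊗[A] M)

variable {A B M : Type*} [CommRing A] [CommRing B] [Algebra A B] [AddCommGroup M] [Module A M]

/-- The map φ sends m to the class of 1 ⊗ m under B ⊗ M → B. Both φ(m) ⊗ m' and φ(m') ⊗ m are sent
to φ(m) φ(m'), so their difference is torsion. -/
theorem FreeModTorsion.isLiftable (h : FreeModTorsion A B M) (hr : Module.finrank A M = 1) :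
    IsLiftable A B M := by
  obtain ⟨e⟩ := h
  rw [hr] at e
  let e' := e.trans (LinearEquiv.funUnique (Fin 1) B B)
  let ψ : B ⊗[A] M →ₗ[B] B := e'.toLinearMap ∘ₗ Submodule.mkQ _
  have hψ : Function.Surjective ψ := e'.surjective.comp (Submodule.mkQ_surjective _)
  let φ : M →ₗ[A] B := ψ.restrictScalars A ∘ₗ TensorProduct.mk A B M 1
  have key : ∀ b m, ψ (b ⊗ₜ m) = b * φ m := fun b m ↦ by
    have : (b ⊗ₜ m : B ⊗[A] M) = b • (1 ⊗ₜ m) := by rw [TensorProduct.smul_tmul', smul_eq_mul, mul_one]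
    rw [this, map_smul, smul_eq_mul]
    rfl
  refine ⟨φ, ?_, fun m m' ↦ ?_⟩
  · rw [Ideal.eq_top_iff_one]
    obtain ⟨z, hz⟩ := hψ 1
    rw [← hz]
    clear hz
    induction z with
    | zero => simp
    | tmul b m =>
      rw [key]
      exact Ideal.mul_mem_left _ _ (Ideal.subset_span ⟨m, rfl⟩)
    | add x y hx hy => rw [map_add]; exact add_mem hx hy
  · have h0 : ψ (φ m ⊗ₜ[A] m' - φ m' ⊗ₜ[A] m) = 0 := by
      rw [map_sub, key, key, mul_comm, sub_self]
    have h1 : φ m ⊗ₜ[A] m' - φ m' ⊗ₜ[A] m ∈ Submodule.torsion B (B ⊗[A] M) := by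
      rw [← Submodule.Quotient.mk_eq_zero]
      exact e'.map_eq_zero_iff.mp h0
    obtain ⟨c, hc⟩ := (Submodule.mem_torsion_iff _).mp h1
    exact ⟨c, c.2, hc⟩

/-- Annihilators of torsion elements have to stay non-zero-divisors. Localizations have this
property, and they suffice for shrinking the test scheme. -/
theorem IsLiftable.baseChange {B' : Type*} [CommRing B'] [Algebra A B'] (f : B →ₐ[A] B')
    (hf : ∀ c ∈ nonZeroDivisors B, f c ∈ nonZeroDivisors B') (h : IsLiftable A B M) :
    IsLiftable A B' M := by
  obtain ⟨φ, h1, h2⟩ := h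
  refine ⟨f.toLinearMap ∘ₗ φ, ?_, fun m m' ↦ ?_⟩
  · have := congr_arg (Ideal.map f) h1
    rw [Ideal.map_span, Ideal.map_top, ← Set.range_comp] at this
    exact this
  · obtain ⟨c, hc, h⟩ := h2 m m'
    refine ⟨f c, hf c hc, ?_⟩
    have := congr_arg (f.toLinearMap.rTensor M) h
    simpa [TensorProduct.smul_tmul', smul_sub, TensorProduct.sub_tmul] using this

theorem IsLiftable.congr {M' : Type*} [AddCommGroup M'] [Module A M'] (e : M ≃ₗ[A] M')
    (h : IsLiftable A B M) : IsLiftable A B M' := by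
  obtain ⟨φ, h1, h2⟩ := h
  refine ⟨φ ∘ₗ e.symm.toLinearMap, ?_, fun m m' ↦ ?_⟩
  · rw [← h1, LinearMap.coe_comp, LinearEquiv.coe_coe, e.symm.surjective.range_comp]
  · obtain ⟨c, hc, h⟩ := h2 (e.symm m) (e.symm m')
    refine ⟨c, hc, ?_⟩
    have := congr_arg (e.toLinearMap.lTensor B) h
    simpa [TensorProduct.smul_tmul', smul_sub] using this

end Liftable

/-! ### Detecting elements at primes of zero-divisors -/

section GoodPrimes

variable {B : Type*} [CommRing B]

/-- A prime q minimal over the annihilator of a nonzero w consists of zero-divisors, and w survives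
in the localization at q. No Noetherian hypothesis is needed, which matters because the test scheme
is arbitrary. -/
theorem eq_zero_of_forall_prime {w : B}
    (h : ∀ q : Ideal B, q.IsPrime → (∀ c ∈ nonZeroDivisors B, c ∉ q) → ∃ s ∉ q, s * w = 0) :
    w = 0 := by
  by_contra hw
  have hI : Ideal.span {w} ≠ ⊥ := by simpa using hw
  let J : Ideal B := Module.annihilator B (Ideal.span {w})
  have hJm : ∀ {x}, x ∈ J ↔ x * w = 0 := fun {x} ↦ by
    rw [Submodule.mem_annihilator_span_singleton]; rfl
  have hJ : J ≠ ⊤ := by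
    rw [Ideal.ne_top_iff_one, hJm]
    simpa using hw
  obtain ⟨m, hm, hJm'⟩ := Ideal.exists_le_maximal J hJ
  have := hm.isPrime
  obtain ⟨q, hq, -⟩ := Ideal.exists_minimalPrimes_le hJm'
  have hqp : q.IsPrime := hq.1.1
  obtain ⟨s, hs, hsw⟩ := h q hqp fun c hc hcq ↦ by
    obtain ⟨y, hy, hcy⟩ := Ideal.exists_mul_mem_of_mem_minimalPrimes hq hcq
    rw [hJm] at hy hcy
    rw [mul_assoc, mul_comm] at hcy
    exact hy ((mem_nonZeroDivisors_iff.mp hc).2 _ hcy)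
  exact hs (hq.1.2 (hJm.mpr hsw))

theorem eq_of_forall_prime {w w' : B}
    (h : ∀ (q : Ideal B) [q.IsPrime], (∀ c ∈ nonZeroDivisors B, c ∉ q) →
      algebraMap B (Localization.AtPrime q) w = algebraMap B (Localization.AtPrime q) w') :
    w = w' := by
  rw [← sub_eq_zero]
  refine eq_zero_of_forall_prime fun q hq hc ↦ ?_
  obtain ⟨s, hs⟩ := (IsLocalization.eq_iff_exists q.primeCompl _).mp (h q hc)
  exact ⟨s, s.2, by rw [mul_sub, hs, sub_self]⟩

end GoodPrimes

/-! ### Nakayama along a ring homomorphism -/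

section Cyclic

variable {A B N : Type*} [CommRing A] [CommRing B] [Algebra A B] [AddCommGroup N] [Module A N]

/-- The hypothesis makes N ⊗ κ(q) vanish. The extension of residue fields κ(p) → κ(q) is faithfully
flat, so N ⊗ κ(p) vanishes too, and Nakayama shows that the finite module N is zero at p, the prime
of A below q. -/
theorem exists_smul_eq_zero_of_tmul [Module.Finite A N] (q : Ideal B) [q.IsPrime]
    (h : ∀ n : N, ∃ c ∉ q, c ⊗ₜ[A] n = (0 : B ⊗[A] N)) (n : N) :
    ∃ s : A, algebraMap A B s ∉ q ∧ s • n = 0 := by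
  let p : Ideal A := q.comap (algebraMap A B)
  have hp : p.IsPrime := inferInstance
  suffices (⟨p, hp⟩ : PrimeSpectrum A) ∉ Module.support A N from
    Module.notMem_support_iff'.mp this n
  rw [Module.mem_support_iff_nontrivial_residueField_tensorProduct, not_nontrivial_iff_subsingleton]
  change Subsingleton (p.ResidueField ⊗[A] N)
  let F : B →ₐ[A] q.ResidueField := IsScalarTower.toAlgHom A B q.ResidueField
  have h1 : Subsingleton (q.ResidueField ⊗[A] N) := by
    refine subsingleton_of_forall_eq 0 fun z ↦ ?_
    induction z with
    | zero => rfl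
    | add x y hx hy => rw [hx, hy, add_zero]
    | tmul x n =>
      obtain ⟨c, hc, h⟩ := h n
      have hc0 : F c ≠ 0 := by
        simpa [F, Ideal.algebraMap_residueField_eq_zero] using hc
      have h2 := congr_arg (F.toLinearMap.rTensor N) h
      simp only [LinearMap.rTensor_tmul, map_zero, AlgHom.toLinearMap_apply] at h2
      have h3 := congr_arg ((x * (F c)⁻¹) • ·) h2
      simpa [TensorProduct.smul_tmul', hc0] using h3
  let i : p.ResidueField →+* q.ResidueField := Ideal.ResidueField.map p q (algebraMap A B) rfl
  algebraize [i]
  have : IsScalarTower A p.ResidueField q.ResidueField := .of_algebraMap_eq' (by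
    ext a
    simp [RingHom.algebraMap_toAlgebra, i, IsScalarTower.algebraMap_apply A B q.ResidueField])
  by_contra hn
  rw [not_subsingleton_iff_nontrivial] at hn
  have h2 := Module.FaithfullyFlat.lTensor_nontrivial p.ResidueField q.ResidueField
    (p.ResidueField ⊗[A] N)
  have e := TensorProduct.AlgebraTensorModule.cancelBaseChange A p.ResidueField q.ResidueField
    q.ResidueField N
  exact not_subsingleton_iff_nontrivial.mpr h2 e.toEquiv.subsingleton

end Cyclic

end DerivationBlowup

namespace DerivationBlowup

/-! ### The universal property of the blow-up algebra -/

section UniversalProperty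

variable {A B K : Type*} [CommRing A] [CommRing B] [Algebra A B] [Field K] [Algebra A K]

/-- Some φ(z) avoids q because the values of φ generate the unit ideal. In B ⊗ (I / Az) the relation
c·(φ(z) ⊗ m − φ(m) ⊗ z) = 0 becomes cφ(z) ⊗ m = 0 with cφ(z) outside q, so I / Az is zero at the
prime below q. -/
theorem exists_generator_at_prime {I : Submodule A K} (hI : I.FG) (φ : I →ₗ[A] B)
    (h : Ideal.span (Set.range φ) = ⊤)
    (h' : ∀ m m' : I, ∃ c ∈ nonZeroDivisors B, c • (φ m ⊗ₜ[A] m' - φ m' ⊗ₜ[A] m) = (0 : B ⊗[A] I))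
    (q : Ideal B) [q.IsPrime] (hq : ∀ c ∈ nonZeroDivisors B, c ∉ q) :
    ∃ z : I, φ z ∉ q ∧ ∀ f : I, ∃ u s : A, algebraMap A B s ∉ q ∧ s • f = u • z := by
  obtain ⟨z, hz⟩ : ∃ z : I, φ z ∉ q := by
    by_contra! hz
    refine (inferInstance : q.IsPrime).ne_top (top_le_iff.mp ?_)
    rw [← h, Ideal.span_le]
    rintro _ ⟨z, rfl⟩
    exact hz z
  refine ⟨z, hz, fun f ↦ ?_⟩
  have : Module.Finite A I := Module.Finite.iff_fg.mpr hI
  obtain ⟨s, hs, hsf⟩ := exists_smul_eq_zero_of_tmul (N := I ⧸ Submodule.span A {z}) q (fun n ↦ by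
    obtain ⟨m, rfl⟩ := Submodule.Quotient.mk_surjective _ n
    obtain ⟨c, hc, h0⟩ := h' z m
    refine ⟨c * φ z, fun hcz ↦ ((inferInstance : q.IsPrime).mem_or_mem hcz).elim (hq c hc) hz, ?_⟩
    have h1 := congr_arg ((Submodule.span A {z}).mkQ.lTensor B) h0
    have hz0 : (Submodule.Quotient.mk z : I ⧸ Submodule.span A {z}) = 0 :=
      (Submodule.Quotient.mk_eq_zero _).mpr (Submodule.mem_span_singleton_self z)
    simpa [TensorProduct.smul_tmul', smul_sub, hz0] using h1) (Submodule.Quotient.mk f)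
  rw [← Submodule.Quotient.mk_smul, Submodule.Quotient.mk_eq_zero,
    Submodule.mem_span_singleton] at hsf
  obtain ⟨u, hu⟩ := hsf
  exact ⟨u, s, hs, hu.symm⟩

/-- The element `w` of `B` is the value of `x / y`, at each prime that consists of
zero-divisors and each local generator `z` of `I`, after replacing `z` by `φ z`. -/
def IsValue {I : Submodule A K} (φ : I →ₗ[A] B) (n : ℕ) (x : K) (w : B) : Prop :=
  ∀ (q : Ideal B) [q.IsPrime], (∀ c ∈ nonZeroDivisors B, c ∉ q) → ∀ z : I, φ z ∉ q →
    (∀ f : I, ∃ u s : A, algebraMap A B s ∉ q ∧ s • f = u • z) →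
    ∃ u s : A, algebraMap A B s ∉ q ∧ s • x = u • (z : K) ^ n ∧
      algebraMap B (Localization.AtPrime q) (algebraMap A B s * w) =
        algebraMap B (Localization.AtPrime q) (algebraMap A B u * φ z ^ n)

/-- The element w plays the role of φⁿ(x). A map φⁿ on Iⁿ need not be shown to be well defined, as
only the values at the primes of zero-divisors matter. -/
theorem exists_isValue {I : Submodule A K} (φ : I →ₗ[A] B) {n : ℕ} {x : K} (hx : x ∈ I ^ n) :
    ∃ w, IsValue φ n x w := by
  induction hx using Submodule.pow_induction_on_left' with
  | algebraMap r =>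
    refine ⟨algebraMap A B r, fun q _ _ z _ _ ↦ ⟨r, 1, ?_, ?_, ?_⟩⟩
    · simpa using (inferInstance : q.IsPrime).one_notMem
    · simp [Algebra.smul_def]
    · simp
  | add x y n _ _ hx hy =>
    obtain ⟨w, hw⟩ := hx
    obtain ⟨v, hv⟩ := hy
    refine ⟨w + v, fun q _ hc z hz hz' ↦ ?_⟩
    obtain ⟨u, s, hs, h1, h2⟩ := hw q hc z hz hz'
    obtain ⟨u', s', hs', h1', h2'⟩ := hv q hc z hz hz'
    refine ⟨s' * u + s * u', s * s', ?_, ?_, ?_⟩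
    · rw [map_mul]
      exact fun h ↦ ((inferInstance : q.IsPrime).mem_or_mem h).elim hs hs'
    · rw [smul_add, add_smul, mul_smul s' u, ← h1, mul_smul s u', ← h1', smul_smul, smul_smul,
        mul_comm s']
    · simp only [map_mul, map_add, map_pow] at h2 h2' ⊢
      linear_combination (algebraMap B (Localization.AtPrime q) (algebraMap A B s')) * h2 +
        (algebraMap B (Localization.AtPrime q) (algebraMap A B s)) * h2'
  | mem_mul m hm n x _ hx =>
    obtain ⟨w, hw⟩ := hx
    refine ⟨φ ⟨m, hm⟩ * w, fun q _ hc z hz hz' ↦ ?_⟩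
    obtain ⟨u, s, hs, h1, h2⟩ := hw q hc z hz hz'
    obtain ⟨u', s', hs', h1'⟩ := hz' ⟨m, hm⟩
    have h2' := congr_arg φ h1'
    rw [map_smul, map_smul, Algebra.smul_def, Algebra.smul_def] at h2'
    have h3 := congr_arg (Subtype.val) h1'
    simp only [Submodule.coe_smul, Algebra.smul_def] at h3 h1
    rw [Nat.succ_eq_add_one]
    refine ⟨u' * u, s' * s, ?_, ?_, ?_⟩
    · rw [map_mul]
      exact fun h ↦ ((inferInstance : q.IsPrime).mem_or_mem h).elim hs' hs
    · simp only [Algebra.smul_def, map_mul]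
      linear_combination (algebraMap A K s * x) * h3 + (algebraMap A K u' * z) * h1
    · have h2'' := congr_arg (algebraMap B (Localization.AtPrime q)) h2'
      simp only [map_mul, map_pow] at h2 h2'' ⊢
      linear_combination (algebraMap B (Localization.AtPrime q) (algebraMap A B s) *
        algebraMap B (Localization.AtPrime q) w) * h2'' +
        (algebraMap B (Localization.AtPrime q) (algebraMap A B u') *
        algebraMap B (Localization.AtPrime q) (φ z)) * h2

theorem isValue_pow {I : Submodule A K} (φ : I →ₗ[A] B) (f : I) (n : ℕ) :
    IsValue φ n ((f : K) ^ n) (φ f ^ n) := by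
  intro q _ hc z hz hz'
  obtain ⟨u, s, hs, h⟩ := hz' f
  have h1 := congr_arg φ h
  have h2 := congr_arg (Subtype.val) h
  simp only [map_smul, Submodule.coe_smul, Algebra.smul_def] at h1 h2
  refine ⟨u ^ n, s ^ n, ?_, ?_, ?_⟩
  · rw [map_pow]
    exact fun h ↦ hs ((inferInstance : q.IsPrime).mem_of_pow_mem n h)
  · simp only [Algebra.smul_def, map_pow, ← mul_pow, h2]
  · rw [map_pow, map_pow, ← mul_pow, ← mul_pow, h1]

/-- At each prime of `B` that consists of zero-divisors, the element `x` of `K` lies in the local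
ring of `A`, and its image is that of `w`. -/
def IsImage (B : Type*) [CommRing B] [Algebra A B] (x : K) (w : B) : Prop :=
  ∀ (q : Ideal B) [q.IsPrime], (∀ c ∈ nonZeroDivisors B, c ∉ q) →
    ∃ u s : A, algebraMap A B s ∉ q ∧ s • x = algebraMap A K u ∧
      algebraMap B (Localization.AtPrime q) (algebraMap A B s * w) =
        algebraMap B (Localization.AtPrime q) (algebraMap A B u)

/-- At q the image of x has to be u/s. Two such presentations agree already in A, because A embeds
in K; primes of zero-divisors then detect equality in B. -/
theorem IsImage.unique (hinj : Function.Injective (algebraMap A K)) {x : K} {w w' : B}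
    (h : IsImage (A := A) B x w) (h' : IsImage (A := A) B x w') : w = w' := by
  refine eq_of_forall_prime fun q _ hc ↦ ?_
  obtain ⟨u, s, hs, h1, h2⟩ := h q hc
  obtain ⟨u', s', hs', h1', h2'⟩ := h' q hc
  have h3 : s' * u = s * u' := hinj (by
    rw [Algebra.smul_def] at h1 h1'
    rw [map_mul, map_mul, ← h1, ← h1']; ring)
  have hu : IsUnit (algebraMap B (Localization.AtPrime q) (algebraMap A B (s * s'))) := by
    refine IsLocalization.map_units (M := q.primeCompl) _ ⟨_, ?_⟩
    rw [map_mul]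
    exact fun h ↦ ((inferInstance : q.IsPrime).mem_or_mem h).elim hs hs'
  refine hu.mul_left_cancel ?_
  have h4 := congr_arg (fun a ↦ algebraMap B (Localization.AtPrime q) (algebraMap A B a)) h3
  simp only [map_mul] at h2 h2' h4 ⊢
  linear_combination (algebraMap B (Localization.AtPrime q) (algebraMap A B s')) * h2 -
    (algebraMap B (Localization.AtPrime q) (algebraMap A B s)) * h2' + h4

theorem isImage_algebraMap (a : A) : IsImage (A := A) B (algebraMap A K a) (algebraMap A B a) :=
  fun q _ _ ↦ ⟨a, 1, by simpa using (inferInstance : q.IsPrime).one_notMem, by simp, by simp⟩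

theorem IsImage.add {x y : K} {w v : B} (hx : IsImage (A := A) B x w)
    (hy : IsImage (A := A) B y v) : IsImage (A := A) B (x + y) (w + v) := by
  intro q _ hc
  obtain ⟨u, s, hs, h1, h2⟩ := hx q hc
  obtain ⟨u', s', hs', h1', h2'⟩ := hy q hc
  refine ⟨s' * u + s * u', s * s', ?_, ?_, ?_⟩
  · rw [map_mul]
    exact fun h ↦ ((inferInstance : q.IsPrime).mem_or_mem h).elim hs hs'
  · simp only [Algebra.smul_def, map_mul, map_add] at h1 h1' ⊢
    rw [← h1, ← h1']; ring
  · simp only [map_mul, map_add] at h2 h2' ⊢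
    linear_combination (algebraMap B (Localization.AtPrime q) (algebraMap A B s')) * h2 +
      (algebraMap B (Localization.AtPrime q) (algebraMap A B s)) * h2'

theorem IsImage.mul {x y : K} {w v : B} (hx : IsImage (A := A) B x w)
    (hy : IsImage (A := A) B y v) : IsImage (A := A) B (x * y) (w * v) := by
  intro q _ hc
  obtain ⟨u, s, hs, h1, h2⟩ := hx q hc
  obtain ⟨u', s', hs', h1', h2'⟩ := hy q hc
  refine ⟨u * u', s * s', ?_, ?_, ?_⟩
  · rw [map_mul]
    exact fun h ↦ ((inferInstance : q.IsPrime).mem_or_mem h).elim hs hs'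
  · simp only [Algebra.smul_def, map_mul] at h1 h1' ⊢
    rw [← h1, ← h1']; ring
  · simp only [map_mul] at h2 h2' ⊢
    linear_combination (algebraMap B (Localization.AtPrime q) (algebraMap A B s') *
      algebraMap B (Localization.AtPrime q) v) * h2 +
      (algebraMap B (Localization.AtPrime q) (algebraMap A B u)) * h2'

/-- Morally w is "φⁿ(b fⁿ) / φ(f)ⁿ" wherever φ(f) is invertible. Choosing Σ c_f φ(f)ⁿ = 1 and values
w_f of b fⁿ, the global candidate is Σ c_f w_f. At a prime q with local generator z, b zⁿ ∈ Iⁿ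
yields s b = u with s outside q, and then s w_f = u φ(f)ⁿ locally for every f. -/
theorem exists_isImage (hinj : Function.Injective (algebraMap A K)) {I : Submodule A K}
    (hI : I.FG) (hI0 : I ≠ ⊥) (h : IsLiftable A B I) {b : K} (hb : b ∈ blowupAlgebra I) :
    ∃ w, IsImage (A := A) B b w := by
  obtain ⟨φ, hφ, hφ'⟩ := h
  obtain ⟨n, hn⟩ := hb
  have h1 : (1 : B) ∈ Ideal.span ((fun f : I ↦ φ f ^ n) '' Set.univ) := by
    have := Ideal.span_pow_eq_top _ hφ n
    rw [← Set.range_comp] at this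
    rw [Set.image_univ]
    exact (Ideal.eq_top_iff_one _).mp this
  obtain ⟨T, -, c, hc⟩ := (Submodule.mem_span_image_iff_exists_fun B).mp h1
  have h2 : ∀ f : I, ∃ w, IsValue φ n (b * (f : K) ^ n) w := fun f ↦
    exists_isValue φ (hn _ (Submodule.pow_mem_pow I f.2 n))
  choose w hw using h2
  refine ⟨∑ f : T, c f * w f, fun q _ hgood ↦ ?_⟩
  obtain ⟨z, hz, hz'⟩ := exists_generator_at_prime hI φ hφ hφ' q hgood
  -- If z were zero, then s would kill a nonzero element of I, forcing s = 0, which lies in q.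
  have hz0 : (z : K) ≠ 0 := by
    intro hz0
    obtain ⟨f, hf, hf0⟩ := Submodule.exists_mem_ne_zero_of_ne_bot hI0
    obtain ⟨u, s, hs, h⟩ := hz' ⟨f, hf⟩
    have h := congr_arg Subtype.val h
    simp only [Submodule.coe_smul, hz0, Algebra.smul_def, mul_zero, mul_eq_zero, hf0, or_false] at h
    rw [map_eq_zero_iff _ hinj] at h
    rw [h, map_zero] at hs
    exact hs q.zero_mem
  obtain ⟨u, s, hs, h3, -⟩ := hw z q hgood z hz hz'
  have h3' : algebraMap A K s * b = algebraMap A K u := by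
    rw [Algebra.smul_def, Algebra.smul_def, ← mul_assoc] at h3
    exact mul_right_cancel₀ (pow_ne_zero n hz0) h3
  refine ⟨u, s, hs, by rw [Algebra.smul_def, h3'], ?_⟩
  have h4 : ∀ f : I, algebraMap B (Localization.AtPrime q) (algebraMap A B s * w f) =
      algebraMap B (Localization.AtPrime q) (algebraMap A B u * φ f ^ n) := by
    intro f
    obtain ⟨u₁, s₁, hs₁, e₁, d₁⟩ := hw f q hgood z hz hz'
    obtain ⟨u₂, s₂, hs₂, e₂, d₂⟩ := isValue_pow φ f n q hgood z hz hz'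
    have h5 : s * s₂ * u₁ = s₁ * u * u₂ := hinj (by
      simp only [Algebra.smul_def, map_mul] at e₁ e₂ ⊢
      refine mul_right_cancel₀ (pow_ne_zero n hz0) ?_
      linear_combination (-(algebraMap A K s * algebraMap A K s₂)) * e₁ +
        (algebraMap A K s₁ * algebraMap A K u) * e₂ +
        (algebraMap A K s₁ * algebraMap A K s₂ * f ^ n) * h3')
    have hu : IsUnit (algebraMap B (Localization.AtPrime q) (algebraMap A B (s₁ * s₂))) := by
      refine IsLocalization.map_units (M := q.primeCompl) _ ⟨_, ?_⟩
      rw [map_mul]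
      exact fun h ↦ ((inferInstance : q.IsPrime).mem_or_mem h).elim hs₁ hs₂
    refine hu.mul_left_cancel ?_
    have h6 := congr_arg (fun a ↦ algebraMap B (Localization.AtPrime q) (algebraMap A B a)) h5
    simp only [map_mul, map_pow] at d₁ d₂ h6 ⊢
    linear_combination (algebraMap B (Localization.AtPrime q) (algebraMap A B s) *
      algebraMap B (Localization.AtPrime q) (algebraMap A B s₂)) * d₁ -
      (algebraMap B (Localization.AtPrime q) (algebraMap A B s₁) *
        algebraMap B (Localization.AtPrime q) (algebraMap A B u)) * d₂ +
      (algebraMap B (Localization.AtPrime q) (φ z)) ^ n * h6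
  rw [Finset.mul_sum, map_sum]
  have h7 := congr_arg (fun a ↦ algebraMap B (Localization.AtPrime q) (algebraMap A B u * a)) hc
  simp only [mul_one, smul_eq_mul, Finset.mul_sum, map_sum] at h7
  rw [← h7]
  refine Finset.sum_congr rfl fun f _ ↦ ?_
  have h8 := h4 f
  simp only [map_mul, map_pow] at h8 ⊢
  linear_combination (algebraMap B (Localization.AtPrime q) (c f)) * h8

theorem nonempty_unique_blowupAlgebra_algHom (hinj : Function.Injective (algebraMap A K))
    {I : Submodule A K} (hI : I.FG) (hI0 : I ≠ ⊥) (h : IsLiftable A B I) :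
    Nonempty (Unique (blowupAlgebra I →ₐ[A] B)) := by
  have hex : ∀ b : blowupAlgebra I, ∃ w, IsImage (A := A) B (b : K) w := fun b ↦
    exists_isImage hinj hI hI0 h b.2
  choose w hw using hex
  refine ⟨⟨⟨{ toFun := w, map_one' := ?_, map_mul' := ?_, map_zero' := ?_, map_add' := ?_,
              commutes' := ?_ }⟩, fun β ↦ ?_⟩⟩
  · refine (hw 1).unique hinj ?_
    simpa using isImage_algebraMap (A := A) (B := B) (K := K) 1
  · exact fun x y ↦ (hw (x * y)).unique hinj ((hw x).mul (hw y))
  · refine (hw 0).unique hinj ?_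
    simpa using isImage_algebraMap (A := A) (B := B) (K := K) 0
  · exact fun x y ↦ (hw (x + y)).unique hinj ((hw x).add (hw y))
  · exact fun a ↦ (hw (algebraMap A _ a)).unique hinj (isImage_algebraMap a)
  · ext b
    -- The relation s b = u holds in the blow-up algebra, so any algebra homomorphism transports it
    -- to B.
    refine IsImage.unique hinj (x := (b : K)) (fun q _ hc ↦ ?_) (hw b)
    obtain ⟨u, s, hs, h1, -⟩ := hw b q hc
    refine ⟨u, s, hs, h1, ?_⟩
    have h2 : s • b = algebraMap A (blowupAlgebra I) u := Subtype.ext h1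
    have h3 := congr_arg β h2
    rw [map_smul, AlgHom.commutes, Algebra.smul_def] at h3
    rw [h3]

end UniversalProperty

end DerivationBlowup

namespace DerivationBlowup

/-! ### Derivations of a curve as a fractional ideal -/

section Derivations

-- D kills k[x], so p(a) = 0 gives p'(a) D(a) = 0. If p'(a) = 0, continue with p', which is again
-- nonzero in characteristic zero unless p is constant.
open Polynomial in
theorem derivation_eq_zero_of_isAlgebraic {k A L : Type*} [Field k] [CharZero k] [CommRing A]
    [IsDomain A] [Algebra k A] [AddCommGroup L] [Module k L] [Module A L]
    [Module.IsTorsionFree A L]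
    (D : Derivation k A L) {x a : A} (hx : D x = 0)
    (ha : IsAlgebraic (Algebra.adjoin k {x}) a) : D a = 0 := by
  let R := Algebra.adjoin k {x}
  have hR : ∀ r : R, D r = 0 := fun r ↦ by
    have := Derivation.eqOn_adjoin (D1 := D) (D2 := 0) (s := {x}) (by simpa using hx) r.2
    simpa using this
  have hD : ∀ p : R[X], D (aeval a p) = aeval a (derivative p) • D a := by
    intro p
    induction p using Polynomial.induction_on' with
    | add p q hp hq => simp only [map_add, hp, hq, add_smul]
    | monomial n r =>
      rw [aeval_monomial, derivative_monomial, aeval_monomial, D.leibniz]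
      have : D (algebraMap R A r) = 0 := hR r
      rw [this, smul_zero, add_zero, D.leibniz_pow, map_mul, map_natCast, mul_smul, mul_smul,
        Nat.cast_smul_eq_nsmul]
  have hchar : CharZero R := charZero_of_injective_algebraMap (algebraMap k R).injective
  have key : ∀ n : ℕ, ∀ p : R[X], p.natDegree ≤ n → p ≠ 0 → aeval a p = 0 → D a = 0 := by
    intro n
    induction n with
    | zero =>
      intro p hp h0 h1
      rw [eq_C_of_natDegree_le_zero hp] at h0 h1
      rw [aeval_C] at h1
      refine absurd ?_ h0
      rw [(Subtype.ext h1 : p.coeff 0 = 0), C_0]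
    | succ n ih =>
      intro p hp h0 h1
      by_cases hd : p.natDegree = 0
      · exact ih p (by omega) h0 h1
      by_cases h2 : aeval a (derivative p) = 0
      · refine ih (derivative p) ?_ ?_ h2
        · have := natDegree_derivative_lt hd
          omega
        · intro h3
          exact hd (derivative_eq_zero.mp h3)
      · have h3 := hD p
        rw [h1, map_zero, eq_comm, smul_eq_zero] at h3
        exact h3.resolve_left h2
  obtain ⟨p, h0, h1⟩ := ha
  exact key _ p le_rfl h0 h1

theorem isAlgebraic_adjoin_of_trdeg_eq_one {k A : Type u} [Field k] [CommRing A] [IsDomain A]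
    [Algebra k A] (h : Algebra.trdeg k A = 1) {t : A} (ht : Transcendental k t) :
    Algebra.IsAlgebraic (Algebra.adjoin k {t}) A := by
  have h1 : AlgebraicIndependent k (fun _ : Unit ↦ t) := by
    rwa [algebraicIndependent_unique_type_iff]
  have h2 := h1.isTranscendenceBasis_of_lift_trdeg_le_of_finite (by simp [h])
  have h3 := h2.isAlgebraic
  rwa [Set.range_const] at h3

theorem trdeg_eq_of_isFractionRing (k A K : Type u) [Field k] [CommRing A] [IsDomain A] [Field K]
    [Algebra k A] [Algebra k K] [Algebra A K] [IsScalarTower k A K] [IsFractionRing A K] :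
    Algebra.trdeg k A = Algebra.trdeg k K := by
  have : FaithfulSMul A K := (faithfulSMul_iff_algebraMap_injective A K).mpr
    (IsFractionRing.injective A K)
  have := trdeg_add_eq k (S := A) (A := K)
  have h2 : Algebra.IsAlgebraic A K := IsLocalization.isAlgebraic _ (nonZeroDivisors A)
  rwa [trdeg_eq_zero (R := A), add_zero] at this

/-- The combination D(t)·D' − D'(t)·D kills t, and A is algebraic over k[t]. -/
theorem derivation_proportional {k A K : Type u} [Field k] [CharZero k] [CommRing A] [IsDomain A]
    [Field K] [Algebra k A] [Algebra k K] [Algebra A K] [IsScalarTower k A K] [FaithfulSMul A K]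
    (h : Algebra.trdeg k A = 1) {t : A} (ht : Transcendental k t) (D D' : Derivation k A K) (a : A) :
    D t * D' a = D' t * D a := by
  have := isAlgebraic_adjoin_of_trdeg_eq_one h ht
  have h1 := derivation_eq_zero_of_isAlgebraic (D t • D' - D' t • D) (x := t) (a := a)
    (by simp [mul_comm]) (Algebra.IsAlgebraic.isAlgebraic a)
  simpa [sub_eq_zero] using h1

/-- Without derivations, Ω vanishes because it is a vector space with zero dual. Then K is formally
unramified over k, hence algebraic, contradicting transcendence degree one. -/
theorem exists_derivation_ne_zero {k A K : Type u} [Field k] [CharZero k] [CommRing A] [IsDomain A]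
    [Field K] [Algebra k A] [Algebra k K] [Algebra A K] [IsScalarTower k A K] [IsFractionRing A K]
    [Algebra.FiniteType k A] (h : Algebra.trdeg k A = 1) : ∃ D : Derivation k K K, D ≠ 0 := by
  by_contra! hD
  have : Algebra.EssFiniteType A K := .of_isLocalization _ (nonZeroDivisors A)
  have : Algebra.EssFiniteType k K := .comp k A K
  have hΩ : Subsingleton (Ω[K⁄k]) := by
    rw [← not_nontrivial_iff_subsingleton]
    intro hn
    obtain ⟨w, hw⟩ := exists_ne (0 : Ω[K⁄k])
    obtain ⟨l, hl⟩ := Module.Projective.exists_dual_ne_zero K hw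
    have h0 : l.compDer (KaehlerDifferential.D k K) = 0 := hD _
    have h1 : l = 0 := by
      apply Derivation.liftKaehlerDifferential_unique
      rw [h0]
      ext; simp
    exact hl (by rw [h1, LinearMap.zero_apply])
  have : Algebra.FormallyUnramified k K := ⟨hΩ⟩
  have := Algebra.FormallyUnramified.isSeparable k K
  have h2 : Algebra.IsAlgebraic k K := inferInstance
  rw [trdeg_eq_of_isFractionRing k A K, trdeg_eq_zero] at h
  exact zero_ne_one h

/-- The `A`-module of all `f` in `K` such that the derivation `f ∂` preserves `A`. -/
def derIdeal {k K : Type*} (A : Type*) [Field k] [CommRing A] [Field K] [Algebra k K] [Algebra A K]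
    (D : Derivation k K K) : Submodule A K where
  carrier := {f | ∀ a : A, f * D (algebraMap A K a) ∈ (algebraMap A K).range}
  add_mem' hf hg a := by rw [add_mul]; exact add_mem (hf a) (hg a)
  zero_mem' a := by rw [zero_mul]; exact zero_mem _
  smul_mem' c f hf a := by
    rw [Algebra.smul_def, mul_assoc]
    exact mul_mem ⟨c, rfl⟩ (hf a)

section

variable {k A K : Type u} [Field k] [CommRing A] [IsDomain A]
    [Field K] [Algebra k A] [Algebra k K] [Algebra A K] [IsScalarTower k A K] [IsFractionRing A K]

variable (A) in
theorem exists_apply_algebraMap_ne_zero {D : Derivation k K K} (hD : D ≠ 0) : ∃ a : A, D (algebraMap A K a) ≠ 0 := by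
  by_contra! h
  refine hD (Derivation.ext fun x ↦ ?_)
  obtain ⟨a, b, -, rfl⟩ := IsFractionRing.div_surjective (A := A) x
  rw [D.leibniz_div, h, h]
  simp

theorem derivation_transcendental_ne_zero [CharZero k] (htr : Algebra.trdeg k K = 1) {D : Derivation k K K}
    (hD : D ≠ 0) {t : K} (ht : Transcendental k t) : D t ≠ 0 := by
  intro h0
  refine hD (Derivation.ext fun x ↦ ?_)
  have := isAlgebraic_adjoin_of_trdeg_eq_one htr ht
  exact derivation_eq_zero_of_isAlgebraic D h0 (Algebra.IsAlgebraic.isAlgebraic x)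

theorem transcendental_of_derivation_ne_zero [CharZero k] {D : Derivation k K K} {t : K} (ht : D t ≠ 0) :
    Transcendental k t := by
  intro h
  refine ht (derivation_eq_zero_of_isAlgebraic D (x := 0) (a := t) (map_zero _) ?_)
  exact h.extendScalars (algebraMap k (Algebra.adjoin k {(0 : K)})).injective

/-- Derivations of `A` are the multiples `f ∂` that preserve `A`. -/
theorem nonempty_derivation_equiv_derIdeal [CharZero k] (htr : Algebra.trdeg k A = 1) {D : Derivation k K K}
    (hD : D ≠ 0) : Nonempty (Derivation k A A ≃ₗ[A] derIdeal A D) := by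
  have hinj : Function.Injective (algebraMap A K) := IsFractionRing.injective A K
  have : FaithfulSMul A K := (faithfulSMul_iff_algebraMap_injective A K).mpr hinj
  obtain ⟨t, ht⟩ := exists_apply_algebraMap_ne_zero A hD
  have httr : Transcendental k t := fun h ↦
    transcendental_of_derivation_ne_zero ht (h.algebraMap)
  have key : ∀ (E : Derivation k A A) (a : A),
      -- The factor f with E = f·D can be read off at a single t with D(t) ≠ 0.
      algebraMap A K (E t) / D (algebraMap A K t) * D (algebraMap A K a) = algebraMap A K (E a) := by
    intro E a
    have := derivation_proportional htr httr ((Algebra.linearMap A K).compDer E)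
      (D.compAlgebraMap A) a
    change algebraMap A K (E t) * D (algebraMap A K a) =
      D (algebraMap A K t) * algebraMap A K (E a) at this
    rw [div_mul_eq_mul_div, this, mul_div_cancel_left₀ _ ht]
  let F : Derivation k A A →ₗ[A] derIdeal A D :=
    { toFun E := ⟨algebraMap A K (E t) / D (algebraMap A K t), fun a ↦ ⟨E a, (key E a).symm⟩⟩
      map_add' E E' := by
        ext; simp [add_div]
      map_smul' c E := by
        ext; simp [Algebra.smul_def, mul_div_assoc] }
  refine ⟨LinearEquiv.ofBijective F ⟨?_, fun f ↦ ?_⟩⟩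
  · rw [← LinearMap.ker_eq_bot, LinearMap.ker_eq_bot']
    intro E hE
    have h0 : algebraMap A K (E t) / D (algebraMap A K t) = 0 := congr_arg Subtype.val hE
    ext a
    apply hinj
    rw [← key, h0, zero_mul, Derivation.zero_apply, map_zero]
  · choose E hE using f.2
    refine ⟨Derivation.mk' { toFun := E, map_add' := ?_, map_smul' := ?_ } ?_, ?_⟩
    · intro a b
      apply hinj
      rw [map_add, hE, hE, hE, map_add, map_add, mul_add]
    · intro c a
      apply hinj
      rw [hE, Algebra.algebraMap_eq_smul_one, smul_assoc, D.map_smul, RingHom.id_apply,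
        Algebra.algebraMap_eq_smul_one, smul_assoc, ← Algebra.algebraMap_eq_smul_one,
        ← Algebra.algebraMap_eq_smul_one, hE, mul_smul_comm]
    · intro a b
      apply hinj
      simp only [LinearMap.coe_mk, AddHom.coe_mk, smul_eq_mul]
      rw [hE, (algebraMap A K).map_add, (algebraMap A K).map_mul, (algebraMap A K).map_mul,
        (algebraMap A K).map_mul, hE, hE, D.leibniz, smul_eq_mul, smul_eq_mul]
      ring
    · ext
      change algebraMap A K (E t) / D (algebraMap A K t) = f
      rw [hE, mul_div_cancel_right₀ _ ht]

/-- For t with D(t) ≠ 0, multiplication by D(t) embeds the module of multipliers into the Noetherian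
ring A. -/
theorem derIdeal_fg [IsNoetherianRing A] {D : Derivation k K K} (hD : D ≠ 0) :
    (derIdeal A D).FG := by
  have hinj : Function.Injective (algebraMap A K) := IsFractionRing.injective A K
  obtain ⟨t, ht⟩ := exists_apply_algebraMap_ne_zero A hD
  rw [← Module.Finite.iff_fg]
  have hex : ∀ f : derIdeal A D, ∃ b : A, algebraMap A K b = f * D (algebraMap A K t) :=
    fun f ↦ f.2 t
  choose b hb using hex
  let F : derIdeal A D →ₗ[A] A :=
    { toFun := b
      map_add' f g := by
        apply hinj
        rw [map_add, hb, hb, hb, Submodule.coe_add, add_mul]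
      map_smul' c f := by
        apply hinj
        rw [hb, smul_eq_mul, map_mul, hb, RingHom.id_apply, Submodule.coe_smul, Algebra.smul_def,
          mul_assoc] }
  refine Module.Finite.of_injective F fun f g hfg ↦ ?_
  have := congr_arg (algebraMap A K) hfg
  change algebraMap A K (b f) = algebraMap A K (b g) at this
  rw [hb, hb] at this
  exact Subtype.ext (mul_right_cancel₀ ht this)

/-- Denominators are cleared on finitely many algebra generators, and the Leibniz rule does the
rest. The predicate P restricts the allowed denominators: nonzero elements in `derIdeal_ne_bot`,
units at a given prime in `exists_mul_mem_derIdeal`. -/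
theorem exists_mul_apply_mem [Algebra.FiniteType k A] (D : Derivation k K K) (S : Subalgebra A K)
    (P : K → Prop) (hP : ∀ x y, P x → P y → P (x * y)) (h1 : P 1)
    (hS : ∀ a : A, ∃ c, P c ∧ c * D (algebraMap A K a) ∈ S) (hc : ∀ c, P c → c ∈ S) :
    ∃ c, P c ∧ ∀ a : A, c * D (algebraMap A K a) ∈ S := by
  obtain ⟨T, hT⟩ := (inferInstance : Algebra.FiniteType k A).out
  have h2 : ∀ T' : Finset A, ∃ c, P c ∧ ∀ a ∈ T', c * D (algebraMap A K a) ∈ S := by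
    classical
    intro T'
    induction T' using Finset.induction_on with
    | empty => exact ⟨1, h1, by simp⟩
    | insert a T' _ ih =>
      obtain ⟨c, hc0, hc'⟩ := ih
      obtain ⟨d, hd0, hd⟩ := hS a
      refine ⟨c * d, hP _ _ hc0 hd0, fun b hb ↦ ?_⟩
      rw [Finset.mem_insert] at hb
      obtain rfl | hb := hb
      · rw [mul_assoc]
        exact mul_mem (hc c hc0) hd
      · rw [mul_comm c, mul_assoc]
        exact mul_mem (hc d hd0) (hc' b hb)
  obtain ⟨c, hc0, hcT⟩ := h2 T
  refine ⟨c, hc0, fun a ↦ ?_⟩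
  have ha : a ∈ Algebra.adjoin k (T : Set A) := hT ▸ Algebra.mem_top
  induction ha using Algebra.adjoin_induction with
  | mem a ha => exact hcT a ha
  | algebraMap r =>
    rw [← IsScalarTower.algebraMap_apply, D.map_algebraMap, mul_zero]
    exact zero_mem _
  | add x y _ _ hx hy => rw [map_add, map_add, mul_add]; exact add_mem hx hy
  | mul x y _ _ hx hy =>
    rw [map_mul, D.leibniz, mul_add, mul_smul_comm, mul_smul_comm, algebraMap_smul, algebraMap_smul]
    exact add_mem (S.smul_mem hy x) (S.smul_mem hx y)

theorem derIdeal_ne_bot [Algebra.FiniteType k A] (D : Derivation k K K) : derIdeal A D ≠ ⊥ := by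
  obtain ⟨c, ⟨hc0, -⟩, hc⟩ := exists_mul_apply_mem (A := A) D (⊥ : Subalgebra A K)
    (fun x ↦ x ≠ 0 ∧ x ∈ (⊥ : Subalgebra A K)) (fun x y hx hy ↦ ⟨mul_ne_zero hx.1 hy.1, mul_mem hx.2 hy.2⟩)
    ⟨one_ne_zero, one_mem _⟩ (fun a ↦ by
      generalize D (algebraMap A K a) = x
      obtain ⟨a, b, hb, rfl⟩ := IsFractionRing.div_surjective (A := A) x
      have hb0 : algebraMap A K b ≠ 0 := IsFractionRing.to_map_ne_zero_of_mem_nonZeroDivisors hb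
      refine ⟨algebraMap A K b, ⟨hb0, algebraMap_mem _ _⟩, ?_⟩
      rw [mul_div_cancel₀ _ hb0]
      exact algebraMap_mem _ _) (fun c hc ↦ hc.2)
  exact (Submodule.ne_bot_iff _).mpr ⟨c, fun a ↦ Algebra.mem_bot.mp (hc a), hc0⟩

theorem finrank_submodule_eq_one {I : Submodule A K} (hI : I ≠ ⊥) : Module.finrank A I = 1 := by
  have h1 : Module.rank A K = 1 := by
    rw [← IsLocalization.rank_eq K (nonZeroDivisors A) le_rfl, Module.rank_self]
  have h2 : Module.rank A I = 1 := by
    apply le_antisymm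
    · rw [← h1]
      exact Submodule.rank_le I
    · rw [Cardinal.one_le_iff_pos]
      have : Nontrivial I := Submodule.nontrivial_iff_ne_bot.mpr hI
      exact rank_pos
  rw [Module.finrank, h2, Cardinal.one_toNat]

theorem finrank_derivation_eq_one [CharZero k] [Algebra.FiniteType k A] (htr : Algebra.trdeg k A = 1)
    {D : Derivation k K K} (hD : D ≠ 0) : Module.finrank A (Derivation k A A) = 1 := by
  obtain ⟨e⟩ := nonempty_derivation_equiv_derIdeal htr hD
  rw [e.finrank_eq, finrank_submodule_eq_one (derIdeal_ne_bot D)]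

/-- A multiplier for the localization becomes one for A after multiplication by a power of g that
works for the finitely many generators of A. Conversely, a multiplier for A is one for the
localization by the quotient rule. -/
theorem derIdeal_localization [Algebra.FiniteType k A] {A' : Type u} [CommRing A'] [Algebra A A']
    [Algebra A' K] [IsScalarTower A A' K] (g : A) [IsLocalization.Away g A']
    (hg : algebraMap A K g ≠ 0) (D : Derivation k K K) :
    derIdeal A' D = Submodule.span A' (derIdeal A D : Set K) := by
  have hmem : ∀ y ∈ (algebraMap A' K).range, ∃ m : ℕ,
      algebraMap A K g ^ m * y ∈ (algebraMap A K).range := by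
    rintro _ ⟨y, rfl⟩
    obtain ⟨n, c, hc⟩ := IsLocalization.Away.surj g y
    refine ⟨n, c, ?_⟩
    have := congr_arg (algebraMap A' K) hc
    rw [← IsScalarTower.algebraMap_apply, map_mul, map_pow, ← IsScalarTower.algebraMap_apply] at this
    rw [← this, mul_comm]
  have hle : ∀ y ∈ (algebraMap A K).range, y ∈ (algebraMap A' K).range := by
    rintro _ ⟨y, rfl⟩
    exact ⟨algebraMap A A' y, (IsScalarTower.algebraMap_apply A A' K y).symm⟩
  have hginv : (algebraMap A K g)⁻¹ ∈ (algebraMap A' K).range := by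
    obtain ⟨u, hu⟩ := IsLocalization.Away.algebraMap_isUnit (S := A') g
    refine ⟨(u⁻¹ : A'ˣ), ?_⟩
    rw [IsScalarTower.algebraMap_apply A A' K, ← hu]
    exact eq_inv_of_mul_eq_one_left (by rw [← map_mul]; simp)
  apply le_antisymm
  · intro f hf
    rw [mem_span_iff_exists_pow_mul_mem g]
    let S : Subalgebra A K := (Algebra.ofId A K).range
    obtain ⟨T, hT⟩ := (inferInstance : Algebra.FiniteType k A).out
    have h1 : ∀ a : A, ∃ m : ℕ, algebraMap A K g ^ m * (f * D (algebraMap A K a)) ∈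
        (algebraMap A K).range := fun a ↦ by
      have := hmem _ (hf (algebraMap A A' a))
      rwa [← IsScalarTower.algebraMap_apply] at this
    choose m hm using h1
    refine ⟨T.sup m, fun a ↦ ?_⟩
    have ha : a ∈ Algebra.adjoin k (T : Set A) := hT ▸ Algebra.mem_top
    induction ha using Algebra.adjoin_induction with
    | mem a ha =>
      have h2 : algebraMap A K g ^ (T.sup m) * f * D (algebraMap A K a) =
          algebraMap A K g ^ (T.sup m - m a) *
            (algebraMap A K g ^ m a * (f * D (algebraMap A K a))) := by
        rw [← mul_assoc, ← pow_add, Nat.sub_add_cancel (Finset.le_sup (f := m) ha), mul_assoc]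
      rw [h2]
      exact mul_mem (pow_mem (RingHom.mem_range_self _ g) _) (hm a)
    | algebraMap r =>
      rw [← IsScalarTower.algebraMap_apply, D.map_algebraMap, mul_zero]
      exact zero_mem _
    | add x y _ _ hx hy => rw [map_add, map_add, mul_add]; exact add_mem hx hy
    | mul x y _ _ hx hy =>
      rw [map_mul, D.leibniz, mul_add, mul_smul_comm, mul_smul_comm]
      exact add_mem (mul_mem ⟨x, rfl⟩ hy) (mul_mem ⟨y, rfl⟩ hx)
  · rw [Submodule.span_le]
    intro f hf a
    obtain ⟨n, c, hc⟩ := IsLocalization.Away.surj g a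
    have h0 := congr_arg (algebraMap A' K) hc
    rw [← IsScalarTower.algebraMap_apply, map_mul, map_pow, ← IsScalarTower.algebraMap_apply] at h0
    have hgn : algebraMap A K g ^ n ≠ 0 := pow_ne_zero n hg
    have h3 : algebraMap A' K a = algebraMap A K c / algebraMap A K (g ^ n) := by
      rw [eq_div_iff (by rwa [map_pow]), map_pow, h0]
    have h4 : f * D (algebraMap A' K a) = ((algebraMap A K g)⁻¹ ^ n) ^ 2 *
        (algebraMap A K g ^ n * (f * D (algebraMap A K c)) -
          algebraMap A K c * (f * D (algebraMap A K (g ^ n)))) := by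
      rw [h3, D.leibniz_div, map_pow, smul_eq_mul, smul_eq_mul, smul_eq_mul, inv_pow]
      ring
    rw [h4]
    exact mul_mem (pow_mem (pow_mem hginv _) _) (sub_mem
      (mul_mem (hle _ (pow_mem (RingHom.mem_range_self _ g) _)) (hle _ (hf c)))
      (mul_mem (hle _ ⟨c, rfl⟩) (hle _ (hf _))))

end

end Derivations
end DerivationBlowup

namespace DerivationBlowup

/-! ### Finiteness of the normalization -/

section Normalization

-- Noether normalization; the transcendence degree forces exactly one variable.
open Polynomial in
theorem exists_finite_inj_polynomial (k A : Type u) [Field k] [CommRing A] [IsDomain A] [Algebra k A]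
    [Algebra.FiniteType k A] (htr : Algebra.trdeg k A = 1) :
    ∃ g : k[X] →ₐ[k] A, Function.Injective g ∧ g.Finite := by
  obtain ⟨s, g, hg, hfin⟩ := exists_finite_inj_algHom_of_fg k A
  have hs : s = 1 := by
    let : Algebra (MvPolynomial (Fin s) k) A := g.toRingHom.toAlgebra
    have : IsScalarTower k (MvPolynomial (Fin s) k) A := .of_algebraMap_eq' g.comp_algebraMap.symm
    have : FaithfulSMul (MvPolynomial (Fin s) k) A :=
      (faithfulSMul_iff_algebraMap_injective _ _).mpr hg
    have : Module.Finite (MvPolynomial (Fin s) k) A := hfin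
    have h1 := lift_trdeg_add_eq k (MvPolynomial (Fin s) k) A
    rw [MvPolynomial.trdeg_of_isDomain, htr, trdeg_eq_zero (R := MvPolynomial (Fin s) k)] at h1
    simpa using h1
  subst hs
  let e : k[X] ≃ₐ[k] MvPolynomial (Fin 1) k := (MvPolynomial.uniqueAlgEquiv k (Fin 1)).symm
  refine ⟨g.comp e.toAlgHom, hg.comp e.injective, ?_⟩
  exact RingHom.Finite.comp hfin (RingHom.Finite.of_surjective _ e.surjective)

variable {k A K : Type u} [Field k] [CommRing A] [IsDomain A]
    [Field K] [Algebra k A] [Algebra k K] [Algebra A K] [IsScalarTower k A K] [IsFractionRing A K]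

theorem dimensionLEOne_of_trdeg_eq_one (k : Type u) [Field k] [Algebra k A]
    [Algebra.FiniteType k A] (htr : Algebra.trdeg k A = 1) :
    Ring.DimensionLEOne A := by
  obtain ⟨g, hg, hfin⟩ := exists_finite_inj_polynomial k A htr
  let : Algebra (Polynomial k) A := g.toRingHom.toAlgebra
  have : Module.Finite (Polynomial k) A := hfin
  exact Ring.DimensionLEOne.of_isIntegral (Polynomial k) A

/-- Since A is finite over k[X], B is also the integral closure of k[X] in K. The extension of k(X)
by K is finite, and separable in characteristic zero, so the standard results over the Dedekind
domain k[X] apply. -/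
theorem isDedekindDomain_and_finite_of_isIntegralClosure [CharZero k] [Algebra.FiniteType k A]
    (htr : Algebra.trdeg k A = 1) (B : Type u) [CommRing B] [Algebra A B] [Algebra B K]
    [IsScalarTower A B K] [IsIntegralClosure B A K] :
    IsDedekindDomain B ∧ Module.Finite A B := by
  obtain ⟨g, hg, hfin⟩ := exists_finite_inj_polynomial k A htr
  let R := Polynomial k
  let : Algebra R A := g.toRingHom.toAlgebra
  let : Algebra R K := ((algebraMap A K).comp g.toRingHom).toAlgebra
  have : IsScalarTower R A K := .of_algebraMap_eq' rfl
  have : Module.Finite R A := hfin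
  have : FaithfulSMul R A := (faithfulSMul_iff_algebraMap_injective _ _).mpr hg
  have : FaithfulSMul R K := (faithfulSMul_iff_algebraMap_injective _ _).mpr
    ((IsFractionRing.injective A K).comp hg)
  let : Algebra R B := ((algebraMap A B).comp g.toRingHom).toAlgebra
  have : IsScalarTower R A B := .of_algebraMap_eq' rfl
  have : IsScalarTower R B K := .of_algebraMap_eq' (by
    rw [IsScalarTower.algebraMap_eq R A K, IsScalarTower.algebraMap_eq A B K]; rfl)
  have : IsIntegralClosure B R K :=
    ⟨IsIntegralClosure.algebraMap_injective B A K, fun {x} ↦ by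
      rw [← IsIntegralClosure.isIntegral_iff (A := B) (R := A) (B := K)]
      exact ⟨fun h ↦ h.tower_top, fun h ↦ isIntegral_trans (R := R) _ h⟩⟩
  let F := FractionRing R
  let : Algebra F K := FractionRing.liftAlgebra R K
  have : IsScalarTower R F K := inferInstance
  have : Algebra.EssFiniteType A K := .of_isLocalization _ (nonZeroDivisors A)
  have : Algebra.EssFiniteType R K := .comp R A K
  have : Algebra.EssFiniteType F K := .of_comp R F K
  have : Algebra.IsAlgebraic A K := IsLocalization.isAlgebraic _ (nonZeroDivisors A)
  have : Algebra.IsAlgebraic R K := Algebra.IsAlgebraic.trans R A K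
  have : Algebra.IsAlgebraic F K := Algebra.IsAlgebraic.extendScalars (IsFractionRing.injective R F)
  have : FiniteDimensional F K := Algebra.finite_of_essFiniteType_of_isAlgebraic
  have : CharZero R := charZero_of_injective_algebraMap (algebraMap k R).injective
  have : CharZero F := charZero_of_injective_algebraMap (IsFractionRing.injective R F)
  have : IsDomain B := (IsIntegralClosure.algebraMap_injective B A K).isDomain
  have := IsIntegralClosure.finite R F K B
  exact ⟨IsIntegralClosure.isDedekindDomain R F K B, .of_restrictScalars_finite R A B⟩

theorem isDedekindDomain_of_isIntegrallyClosed [CharZero k] [Algebra.FiniteType k A]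
    (htr : Algebra.trdeg k A = 1) [IsIntegrallyClosed A] : IsDedekindDomain A :=
  (isDedekindDomain_and_finite_of_isIntegralClosure (k := k) (K := FractionRing A) htr A).1

end Normalization
end DerivationBlowup

namespace DerivationBlowup

/-! ### Local generators of the extended ideal -/

section LocalGenerator

variable {A B K : Type*} [CommRing A] [CommRing B] [Field K] [Algebra A K] [Algebra A B] [Algebra B K]
  [IsScalarTower A B K]

/-- The hypothesis says that I ⊆ xB. Hence the modules Iⁿ/xⁿ form an increasing chain in the
Noetherian module B and stabilize. Multiplication by f/x sends Iⁿ/xⁿ into the next one, so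
eventually into itself. -/
theorem div_mem_blowupAlgebra [IsNoetherianRing A] [Module.Finite A B] {I : Submodule A K} {x : K}
    (hx : x ∈ I) (hx0 : x ≠ 0) (h : ∀ f ∈ I, ∃ b : B, algebraMap B K b * x = f) {f : K} (hf : f ∈ I) :
    f / x ∈ blowupAlgebra I := by
  let T (n : ℕ) : B →ₗ[A] K :=
    LinearMap.mulLeft A (x ^ n) ∘ₗ (IsScalarTower.toAlgHom A B K).toLinearMap
  have hT (n : ℕ) (b : B) : T n b = x ^ n * algebraMap B K b := rfl
  -- N(n) is Iⁿ/xⁿ, pulled back to B.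
  let N : ℕ →o Submodule A B :=
    { toFun n := (I ^ n).comap (T n)
      monotone' := monotone_nat_of_le_succ fun n b hb ↦ by
        rw [Submodule.mem_comap, hT] at hb ⊢
        rw [pow_succ, pow_succ, mul_right_comm]
        exact Submodule.mul_mem_mul hb hx }
  obtain ⟨n, hn⟩ := monotone_stabilizes_iff_noetherian.mpr (inferInstanceAs (IsNoetherian A B)) N
  have hpow (m : ℕ) : ∀ y ∈ I ^ m, ∃ b : B, algebraMap B K b * x ^ m = y := by
    induction m with
    | zero =>
      intro y hy
      rw [pow_zero, Submodule.mem_one] at hy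
      obtain ⟨a, rfl⟩ := hy
      exact ⟨algebraMap A B a, by rw [pow_zero, mul_one, ← IsScalarTower.algebraMap_apply]⟩
    | succ m ih =>
      intro y hy
      rw [pow_succ] at hy
      induction hy using Submodule.mul_induction_on' with
      | mem_mul_mem u hu v hv =>
        obtain ⟨b, rfl⟩ := ih u hu
        obtain ⟨c, rfl⟩ := h v hv
        exact ⟨b * c, by rw [map_mul]; ring⟩
      | add u _ v _ hu hv =>
        obtain ⟨b, rfl⟩ := hu
        obtain ⟨c, rfl⟩ := hv
        exact ⟨b + c, by rw [map_add]; ring⟩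
  rw [mem_blowupAlgebra]
  refine ⟨n, fun y hy ↦ ?_⟩
  obtain ⟨b, hb⟩ := hpow n y hy
  obtain ⟨c, hc⟩ := h f hf
  have h1 : c * b ∈ N (n + 1) := by
    change T (n + 1) (c * b) ∈ I ^ (n + 1)
    have : T (n + 1) (c * b) = y * f := by rw [hT, ← hb, ← hc, map_mul]; ring
    rw [this, pow_succ]
    exact Submodule.mul_mem_mul hy hf
  rw [← hn (n + 1) n.le_succ] at h1
  have h2 : T n (c * b) = f / x * y := by
    rw [hT, ← hb, ← hc, map_mul]
    field_simp
  rw [← h2]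
  exact h1

-- Put L = IB. For each of the finitely many primes P of B over m, invertibility of L makes I ∩ PL a
-- proper k-subspace of I. As k is infinite, some x in I avoids them all, and this x generates L
-- near m.
open scoped nonZeroDivisors in
theorem exists_local_generator {k : Type*} [Field k] [Infinite k] [Algebra k A] [Algebra k K]
    [IsScalarTower k A K] [IsDedekindDomain B] [IsFractionRing B K]
    [IsNoetherianRing A] [Module.Finite A B]
    {I : Submodule A K} (hI : I.FG) (hI0 : I ≠ ⊥) (m : Ideal A) [m.IsPrime] :
    ∃ x ∈ I, x ≠ 0 ∧ ∃ g ∉ m, ∀ f ∈ I, ∃ b : B, algebraMap B K b * x = algebraMap A K g * f := by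
  let L : FractionalIdeal B⁰ K :=
    ⟨Submodule.span B (I : Set K), by
      obtain ⟨s, hs⟩ := hI
      apply FractionalIdeal.isFractional_of_fg
      refine ⟨s, ?_⟩
      rw [← hs, Submodule.span_span_of_tower]⟩
  have hIL : ∀ f ∈ I, f ∈ L := fun f hf ↦ Submodule.subset_span (R := B) hf
  have hL0 : L ≠ 0 := by
    obtain ⟨f, hf, hf0⟩ := Submodule.exists_mem_ne_zero_of_ne_bot hI0
    intro h0
    have := hIL f hf
    rw [h0, FractionalIdeal.mem_zero_iff] at this
    exact hf0 this
  have hfin : (m.primesOver B).Finite := by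
    exact Algebra.QuasiFinite.finite_primesOver m
  have hPL : ∀ P ∈ m.primesOver B, ∃ f ∈ I, f ∉ (P : FractionalIdeal B⁰ K) * L := by
    intro P hP
    by_contra! h
    have h1 : L ≤ (P : FractionalIdeal B⁰ K) * L := Submodule.span_le.mpr h
    have h2 : (1 : FractionalIdeal B⁰ K) ≤ P := by
      have := mul_le_mul_left h1 L⁻¹
      rwa [mul_assoc, mul_inv_cancel₀ hL0, mul_one] at this
    rw [FractionalIdeal.one_le] at h2
    rw [FractionalIdeal.mem_coeIdeal] at h2
    obtain ⟨y, hy, hy1⟩ := h2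
    have : y = 1 := IsFractionRing.injective B K (by rw [hy1, map_one])
    exact hP.1.ne_top ((Ideal.eq_top_iff_one _).mpr (this ▸ hy))
  -- The additional subspace, at `none`, is zero; avoiding it makes x nonzero.
  let p : Option (m.primesOver B) → Subspace k (I.restrictScalars k)
    | none => ⊥
    | some P => (((((P : Ideal B) : FractionalIdeal B⁰ K) * L : FractionalIdeal B⁰ K) :
        Submodule B K).restrictScalars A |>.restrictScalars k).comap (I.restrictScalars k).subtype
  have : Finite (m.primesOver B) := hfin
  have hp (i) : p i ≠ ⊤ := by
    intro h
    match i with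
    | none =>
      obtain ⟨f, hf, hf0⟩ := Submodule.exists_mem_ne_zero_of_ne_bot hI0
      have : (⟨f, hf⟩ : I.restrictScalars k) ∈ p none := h ▸ Submodule.mem_top
      exact hf0 (congr_arg Subtype.val ((Submodule.mem_bot k).mp this))
    | some P =>
      obtain ⟨f, hf, hf0⟩ := hPL P P.2
      have : (⟨f, hf⟩ : I.restrictScalars k) ∈ p (some P) := h ▸ Submodule.mem_top
      exact hf0 this
  obtain ⟨⟨x, hx⟩, hxp⟩ : ∃ x, ∀ i, x ∉ p i := by
    by_contra! h
    obtain ⟨i, hi⟩ := Subspace.exists_eq_top_of_iUnion_eq_univ (p := p)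
      (Set.eq_univ_of_forall fun x ↦ Set.mem_iUnion.mpr (h x))
    exact hp i hi
  have hx0 : x ≠ 0 := fun h ↦ hxp none ((Submodule.mem_bot k).mpr (Subtype.ext h))
  refine ⟨x, hx, hx0, ?_⟩
  by_contra! hg
  -- J = {b : bI ⊆ xB}. If no g outside m lay in J, some prime Q over m would contain J, which
  -- contains xL⁻¹; then x would lie in QL.
  let J : Ideal B :=
    { carrier := {b | ∀ f ∈ I, ∃ c : B, algebraMap B K c * x = algebraMap B K b * f}
      zero_mem' f _ := ⟨0, by simp⟩
      add_mem' {b b'} hb hb' f hf := by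
        obtain ⟨c, hc⟩ := hb f hf
        obtain ⟨c', hc'⟩ := hb' f hf
        exact ⟨c + c', by rw [map_add, map_add, add_mul, hc, hc', add_mul]⟩
      smul_mem' a b hb f hf := by
        obtain ⟨c, hc⟩ := hb f hf
        exact ⟨a * c, by rw [smul_eq_mul, map_mul, map_mul, mul_assoc, hc, mul_assoc]⟩ }
  have hJ : J.comap (algebraMap A B) ≤ m := by
    intro g hgJ
    by_contra hgm
    obtain ⟨f, hf, h⟩ := hg g hgm
    obtain ⟨c, hc⟩ := hgJ f hf
    exact h c (by rw [hc, ← IsScalarTower.algebraMap_apply])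
  obtain ⟨Q, hQJ, hQ, hQm⟩ := Ideal.exists_ideal_over_prime_of_isIntegral m J hJ
  have hle : FractionalIdeal.spanSingleton B⁰ x * L⁻¹ ≤ (Q : FractionalIdeal B⁰ K) := by
    rw [FractionalIdeal.spanSingleton_mul_le_iff]
    intro z hz
    rw [FractionalIdeal.mem_inv_iff hL0] at hz
    have hz' : ∀ f ∈ I, ∃ b : B, algebraMap B K b = z * f := fun f hf ↦
      (FractionalIdeal.mem_one_iff _).mp (hz f (hIL f hf))
    obtain ⟨b, hb⟩ := hz' x hx
    refine (FractionalIdeal.mem_coeIdeal _).mpr ⟨b, hQJ fun f hf ↦ ?_, by rw [hb, mul_comm]⟩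
    obtain ⟨c, hc⟩ := hz' f hf
    exact ⟨c, by rw [hc, hb]; ring⟩
  have h1 := mul_le_mul_left hle L
  rw [mul_assoc, inv_mul_cancel₀ hL0, mul_one, FractionalIdeal.spanSingleton_le_iff_mem] at h1
  exact hxp (some ⟨Q, hQ, ⟨hQm.symm⟩⟩) h1

end LocalGenerator

/-! ### Freeness from a generator -/

section Free

variable {A B K : Type*} [CommRing A] [CommRing B] [Field K] [Algebra A K] [Algebra A B] [Algebra B K]
  [IsScalarTower A B K] [IsDomain A] [IsFractionRing A K]

/-- The map b ⊗ m ↦ b·e(m)/x is onto B, since m₀ = e⁻¹(x) has value 1. Some nonzero multiple of any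
tensor is of the form b ⊗ m₀, so its kernel is exactly the torsion. -/
theorem freeModTorsion_of_generator {M : Type*} [AddCommGroup M] [Module A M]
    (hM : Module.finrank A M = 1) {I : Submodule A K} (e : M ≃ₗ[A] I) {x : K} (hx : x ∈ I)
    (hx0 : x ≠ 0) (hinj : Function.Injective (algebraMap B K))
    (h : ∀ f ∈ I, ∃ b : B, algebraMap B K b = f / x) : FreeModTorsion A B M := by
  have : IsDomain B := hinj.isDomain (algebraMap B K)
  choose θ hθ using fun m : M ↦ h (e m) (e m).2
  let T : M →ₗ[A] B :=
    { toFun := θ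
      map_add' m m' := hinj (by
        rw [map_add, hθ, hθ, hθ, map_add, Submodule.coe_add, add_div])
      map_smul' a m := hinj (by
        rw [RingHom.id_apply, Algebra.smul_def, map_mul, hθ, hθ, map_smul, Submodule.coe_smul,
          Algebra.smul_def, mul_div_assoc, ← IsScalarTower.algebraMap_apply]) }
  obtain ⟨m₀, hm₀⟩ := e.surjective ⟨x, hx⟩
  have hT : T m₀ = 1 := hinj (by
    rw [map_one]
    exact (hθ m₀).trans (by rw [hm₀]; exact div_self hx0))
  let ψ : B ⊗[A] M →ₗ[B] B := LinearMap.liftBaseChange B T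
  have hψ (b : B) (m : M) : ψ (b ⊗ₜ m) = b * T m := by simp [ψ]
  have hsurj : Function.Surjective ψ := fun b ↦ ⟨b ⊗ₜ m₀, by rw [hψ, hT, mul_one]⟩
  have key (z : B ⊗[A] M) : ∃ c : B, c ≠ 0 ∧ ∃ b : B, c • z = b ⊗ₜ m₀ := by
    induction z with
    | zero => exact ⟨1, one_ne_zero, 0, by simp⟩
    | add y z hy hz =>
      obtain ⟨c, hc, b, hb⟩ := hy
      obtain ⟨c', hc', b', hb'⟩ := hz
      refine ⟨c * c', mul_ne_zero hc hc', c' * b + c * b', ?_⟩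
      rw [smul_add, mul_comm c, mul_smul, hb, mul_comm c', mul_smul, hb', TensorProduct.add_tmul]
      rfl
    | tmul b m =>
      obtain ⟨a, d, hd, had⟩ := IsFractionRing.div_surjective (A := A) ((e m : K) / x)
      have hd0 : algebraMap A K d ≠ 0 := by
        simpa using nonZeroDivisors.ne_zero hd
      refine ⟨algebraMap A B d, fun h0 ↦ hd0 ?_, a • b, ?_⟩
      · rw [IsScalarTower.algebraMap_apply A B K, h0, map_zero]
      · have : d • m = a • m₀ := e.injective (Subtype.ext (by
          rw [map_smul, map_smul, hm₀, Submodule.coe_smul, Submodule.coe_smul, Algebra.smul_def,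
            Algebra.smul_def]
          field_simp at had
          rw [← had, mul_comm]))
        rw [algebraMap_smul, TensorProduct.smul_tmul', TensorProduct.smul_tmul, this,
          TensorProduct.smul_tmul]
  have hker : LinearMap.ker ψ = Submodule.torsion B (B ⊗[A] M) := by
    ext z
    rw [LinearMap.mem_ker, Submodule.mem_torsion_iff]
    constructor
    · intro hz
      obtain ⟨c, hc, b, hb⟩ := key z
      refine ⟨⟨c, mem_nonZeroDivisors_of_ne_zero hc⟩, ?_⟩
      have := congr_arg ψ hb
      rw [map_smul, hz, smul_zero, hψ, hT, mul_one] at this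
      change c • z = 0
      rw [hb, ← this, TensorProduct.zero_tmul]
    · rintro ⟨c, hc⟩
      have := congr_arg ψ hc
      rw [map_zero, Submonoid.smul_def, map_smul, smul_eq_mul] at this
      exact (mul_eq_zero.mp this).resolve_left (nonZeroDivisors.ne_zero c.2)
  rw [FreeModTorsion, hM]
  exact ⟨(Submodule.quotEquivOfEq _ _ hker.symm).trans ((ψ.quotKerEquivOfSurjective hsurj).trans
    (LinearEquiv.funUnique (Fin 1) B B).symm)⟩

theorem eq_span_singleton_of_blowupAlgebra_eq_bot {I : Submodule A K} {x : K} (hx : x ∈ I) (hx0 : x ≠ 0)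
    (h : ∀ f ∈ I, f / x ∈ blowupAlgebra I) (hbot : blowupAlgebra I = ⊥) :
    I = Submodule.span A {x} := by
  refine le_antisymm (fun f hf ↦ ?_) ((Submodule.span_singleton_le_iff_mem _ _).mpr hx)
  have := h f hf
  rw [hbot, Algebra.mem_bot] at this
  obtain ⟨a, ha⟩ := this
  refine Submodule.mem_span_singleton.mpr ⟨a, ?_⟩
  rw [Algebra.smul_def, ha, div_mul_cancel₀ _ hx0]

end Free

end DerivationBlowup

namespace DerivationBlowup

/-! ### Derivations and discrete valuations -/

section Valuation
open WithZero

variable {k K : Type*} [Field k] [Field K] [Algebra k K]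

/-- An a priori bound on the poles of D on the valuation ring improves step by step. With residue
field k, write x = c + t y with y integral; then D(x) = y + t D(y), and the factor t gains one
order. -/
theorem valuation_derivation_le_one (V : Valuation K ℤᵐ⁰)
    (hres : ∀ x, V x ≤ 1 → ∃ c : k, V (x - algebraMap k K c) < 1) (D : Derivation k K K)
    {t : K} (ht : V t = exp (-1)) (hDt : D t = 1) {n : ℕ} (hn : ∀ x, V x ≤ 1 → V (D x) ≤ exp (n : ℤ)) (x : K)
    (hx : V x ≤ 1) : V (D x) ≤ 1 := by
  induction n with
  | zero => exact hn x hx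
  | succ n ih =>
    refine ih fun x hx ↦ ?_
    have ht0 : t ≠ 0 := V.ne_zero_iff.mp (ht ▸ exp_ne_zero)
    obtain ⟨c, hc⟩ := hres x hx
    let y := (x - algebraMap k K c) / t
    have hxy : x = algebraMap k K c + t * y := by
      simp only [y]; field_simp; ring
    have hy : V y ≤ 1 := by
      rw [map_div₀, ht, div_le_one₀ (by simp)]
      generalize V (x - algebraMap k K c) = z at hc ⊢
      obtain rfl | hz := eq_or_ne z 0
      · simp
      · lift z to ℤ using hz
        rw [← exp_zero, exp_lt_exp] at hc
        rw [exp_le_exp]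
        lia
    have hDx : D x = y + t * D y := by
      rw [hxy, map_add, D.map_algebraMap, D.leibniz, hDt, smul_eq_mul, smul_eq_mul]
      ring
    rw [hDx]
    refine V.map_add_le (hy.trans ?_) ?_
    · rw [← exp_zero, exp_le_exp]; lia
    · rw [map_mul, ht]
      refine (mul_le_mul_right (hn y hy) _).trans ?_
      rw [← exp_add, exp_le_exp]; push_cast; lia

/-- Write x = y t⁻ⁿ with y a unit. The term −n y t⁻ⁿ⁻¹ of D(x) dominates the other one, t⁻ⁿ D(y),
because the nonzero integer n is a unit of k in characteristic zero. -/
theorem valuation_derivation_eq [CharZero k] (V : Valuation K ℤᵐ⁰)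
    (hk : ∀ c : k, V (algebraMap k K c) ≤ 1) (D : Derivation k K K)
    {t : K} (ht : V t = exp (-1)) (hDt : D t = 1) (hD : ∀ x, V x ≤ 1 → V (D x) ≤ 1) {x : K} {n : ℤ}
    (hx : V x = exp n) (hn : n ≠ 0) : V (D x) = exp (n + 1) := by
  have ht0 : t ≠ 0 := V.ne_zero_iff.mp (ht ▸ exp_ne_zero)
  obtain ⟨y, hydef⟩ : ∃ y, y = x * t ^ n := ⟨_, rfl⟩
  have hy : V y = 1 := by
    rw [hydef, map_mul, map_zpow₀, hx, ht, ← exp_zsmul, ← exp_add, ← exp_zero]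
    congr 1
    rw [smul_eq_mul]; ring
  have hxy : x = y * t ^ (-n) := by
    rw [hydef, mul_assoc, ← zpow_add₀ ht0]; simp
  have hc (c : k) (hc0 : c ≠ 0) : V (algebraMap k K c) = 1 := by
    refine le_antisymm (hk c) ?_
    have h1 := hk c⁻¹
    rw [map_inv₀, map_inv₀] at h1
    have : V (algebraMap k K c) ≠ 0 := by simpa using hc0
    exact (inv_le_one₀ (zero_lt_iff.mpr this)).mp h1
  have hDx : D x = y * (((-n : ℤ) : K) * t ^ (-n - 1)) + t ^ (-n) * D y := by
    rw [hxy, D.leibniz, Derivation.leibniz_zpow, hDt]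
    simp only [smul_eq_mul, zsmul_eq_mul, mul_one]
  have h1 : V (y * (((-n : ℤ) : K) * t ^ (-n - 1))) = exp (n + 1) := by
    have := hc ((-n : ℤ) : k) (by exact_mod_cast neg_ne_zero.mpr hn)
    rw [map_intCast] at this
    rw [V.map_mul y, V.map_mul, this, hy, one_mul, one_mul, map_zpow₀, ht, ← exp_zsmul]
    congr 1
    rw [smul_eq_mul]; ring
  have h2 : V (t ^ (-n) * D y) ≤ exp n := by
    rw [map_mul, map_zpow₀, ht, ← exp_zsmul]
    refine (mul_le_mul_right (hD y hy.le) _).trans ?_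
    rw [mul_one, exp_le_exp, smul_eq_mul]; lia
  rw [hDx, V.map_add_eq_of_lt_left (h2.trans_lt ?_), h1]
  rw [h1, exp_lt_exp]; lia

end Valuation

/-! ### Lipman's theorem for curves -/

section Lipman
open WithZero IsDedekindDomain

variable {k B K : Type u} [Field k] [IsAlgClosed k] [CommRing B] [IsDedekindDomain B]
    [Field K] [Algebra k B] [Algebra k K] [Algebra B K] [IsScalarTower k B K] [IsFractionRing B K]
    [Algebra.FiniteType k B] (P : HeightOneSpectrum B)

theorem exists_sub_algebraMap_mem (m : Ideal B) [m.IsMaximal] (b : B) : ∃ c : k, b - algebraMap k B c ∈ m := by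
  let := Ideal.Quotient.field m
  have : Module.Finite k (B ⧸ m) := finite_of_finite_type_of_isJacobsonRing k (B ⧸ m)
  obtain ⟨c, hc⟩ := (IsAlgClosed.algebraMap_bijective_of_isIntegral (k := k) (K := B ⧸ m)).2
    (Ideal.Quotient.mk m b)
  refine ⟨c, ?_⟩
  rw [← Ideal.Quotient.eq, ← hc]
  rfl

theorem valuation_algebraMap_le_one (c : k) : P.valuation K (algebraMap k K c) ≤ 1 := by
  rw [IsScalarTower.algebraMap_apply k B K]
  exact P.valuation_le_one _

theorem exists_valuation_sub_algebraMap_lt_one {x : K} (hx : P.valuation K x ≤ 1) :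
    ∃ c : k, P.valuation K (x - algebraMap k K c) < 1 := by
  obtain ⟨b, hb⟩ := P.exists_valuation_sub_lt_of_integer hx (γ := 1)
  have := P.isMaximal
  obtain ⟨c, hc⟩ := exists_sub_algebraMap_mem (k := k) P.asIdeal b
  refine ⟨c, ?_⟩
  have h1 : x - algebraMap k K c = algebraMap B K (b - algebraMap k B c) - (algebraMap B K b - x) := by
    rw [map_sub, ← IsScalarTower.algebraMap_apply k B K]; ring
  rw [h1]
  exact (P.valuation K).map_sub_lt ((P.valuation_lt_one_iff_mem _).mpr hc) (by exact_mod_cast hb)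

/-- A nonzero c with c·D(B) ⊆ B bounds the poles of D on B; elements of the valuation ring are
fractions of B whose denominator is a unit at P. -/
theorem exists_valuation_derivation_le (D : Derivation k K K) :
    ∃ n : ℕ, ∀ x, P.valuation K x ≤ 1 → P.valuation K (D x) ≤ exp (n : ℤ) := by
  obtain ⟨c, hc0, hc⟩ := Submodule.exists_mem_ne_zero_of_ne_bot (derIdeal_ne_bot (A := B) D)
  have hV0 : P.valuation K c ≠ 0 := by simpa using hc
  have hb (b : B) : P.valuation K (D (algebraMap B K b)) ≤ exp (-log (P.valuation K c)) := by
    obtain ⟨d, hd⟩ := hc0 b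
    have : D (algebraMap B K b) = algebraMap B K d / c := by rw [hd]; field_simp
    rw [this, map_div₀, exp_neg, exp_log hV0, div_eq_mul_inv]
    exact mul_le_of_le_one_left' (P.valuation_le_one d)
  refine ⟨(-log (P.valuation K c)).toNat, fun x hx ↦ ?_⟩
  obtain ⟨b, ⟨s, hs⟩, hsb⟩ := P.exists_primeCompl_mul_eq_of_integer x hx
  have hVs : P.valuation K (algebraMap B K s) = 1 := P.valuation_eq_one_iff_notMem.mpr hs
  have h1 : algebraMap B K s * D x = D (algebraMap B K b) - x * D (algebraMap B K s) := by
    rw [← hsb, D.leibniz, smul_eq_mul, smul_eq_mul]; ring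
  have h2 := congr_arg (P.valuation K) h1
  rw [map_mul, hVs, one_mul] at h2
  rw [h2]
  have h3 : exp (-log (P.valuation K c)) ≤ exp ((-log (P.valuation K c)).toNat : ℤ) := by
    rw [exp_le_exp]; exact Int.self_le_toNat _
  refine (P.valuation K).map_sub_le ((hb b).trans h3) ?_
  rw [map_mul]
  exact (mul_le_of_le_one_left' hx).trans ((hb s).trans h3)

theorem exists_mul_mem_derIdeal (D : Derivation k K K) {f : K}
    (hf : ∀ b : B, P.valuation K (f * D (algebraMap B K b)) ≤ 1) :
    ∃ s : K, P.valuation K s = 1 ∧ s * f ∈ derIdeal B D := by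
  obtain ⟨s, ⟨hs1, -⟩, hs⟩ := exists_mul_apply_mem (A := B) (f • D) (⊥ : Subalgebra B K)
    (fun x ↦ P.valuation K x = 1 ∧ x ∈ (⊥ : Subalgebra B K))
    (fun x y hx hy ↦ ⟨by rw [map_mul, hx.1, hy.1, one_mul], mul_mem hx.2 hy.2⟩)
    ⟨map_one _, one_mem _⟩ (fun b ↦ by
      obtain ⟨c, ⟨s, hs⟩, hsc⟩ := P.exists_primeCompl_mul_eq_of_integer _ (hf b)
      refine ⟨algebraMap B K s, ⟨P.valuation_eq_one_iff_notMem.mpr hs, algebraMap_mem _ _⟩, ?_⟩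
      rw [mul_comm]
      exact Algebra.mem_bot.mpr ⟨c, hsc.symm⟩) (fun c hc ↦ hc.2)
  refine ⟨s, hs1, fun b ↦ ?_⟩
  rw [mul_assoc]
  exact Algebra.mem_bot.mp (hs b)

/-- At P, D behaves like D(t) times differentiation with respect to a uniformizer t: the preceding
valuation lemmas are applied to D / D(t). -/
theorem exists_uniformizer_valuation_derivation [CharZero k] (htr : Algebra.trdeg k K = 1)
    {D : Derivation k K K} (hD : D ≠ 0) :
    ∃ t : B, P.valuation K (algebraMap B K t) = exp (-1) ∧ D (algebraMap B K t) ≠ 0 ∧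
      (∀ x, P.valuation K x ≤ 1 → P.valuation K (D x) ≤ P.valuation K (D (algebraMap B K t))) ∧
      ∀ (n : ℤ) x, n ≠ 0 → P.valuation K x = exp n →
        P.valuation K (D x) = P.valuation K (D (algebraMap B K t)) * exp (n + 1) := by
  obtain ⟨t, ht⟩ := P.intValuation_exists_uniformizer
  replace ht : P.valuation K (algebraMap B K t) = exp (-1) := by rw [P.valuation_of_algebraMap, ht]
  have hDt : D (algebraMap B K t) ≠ 0 := by
    -- A uniformizer is transcendental: otherwise it would come from k, whose nonzero elements are
    -- units at P.
    refine derivation_transcendental_ne_zero htr hD fun hint ↦ ?_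
    obtain ⟨c, hc⟩ := minpoly.mem_range_of_degree_eq_one k _
      (IsAlgClosed.degree_eq_one_of_irreducible k (minpoly.irreducible hint.isIntegral))
    have hc0 : c ≠ 0 := fun h ↦ by
      rw [← hc, h, map_zero, map_zero] at ht
      exact exp_ne_zero ht.symm
    have h2 : P.valuation K (algebraMap k K (c * c⁻¹)) < 1 := by
      rw [map_mul, map_mul, hc, ht]
      refine (mul_le_of_le_one_right' (valuation_algebraMap_le_one P c⁻¹)).trans_lt ?_
      rw [← exp_zero, exp_lt_exp]; lia
    rw [mul_inv_cancel₀ hc0, map_one, map_one] at h2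
    exact lt_irrefl _ h2
  let δ : Derivation k K K := (D (algebraMap B K t))⁻¹ • D
  have hδ (x) : D x = D (algebraMap B K t) * δ x := (mul_inv_cancel_left₀ hDt _).symm
  have hδt : δ (algebraMap B K t) = 1 := inv_mul_cancel₀ hDt
  obtain ⟨n, hn⟩ := exists_valuation_derivation_le P δ
  have h1 := valuation_derivation_le_one (P.valuation K)
    (fun x hx ↦ exists_valuation_sub_algebraMap_lt_one (k := k) P hx) δ ht hδt hn
  refine ⟨t, ht, hDt, fun x hx ↦ ?_, fun n x hn hx ↦ ?_⟩
  · rw [hδ x, map_mul]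
    exact mul_le_of_le_one_right' (h1 x hx)
  · rw [hδ x, map_mul, valuation_derivation_eq (P.valuation K) (valuation_algebraMap_le_one (k := k) P)
      δ ht hδt h1 hx hn]

variable {A : Type u} [CommRing A] [IsNoetherianRing A] [Algebra A B] [Algebra A K] [IsScalarTower A B K]
  [IsIntegralClosure B A K]

/-- The conductor of `B` in `A`, inside a field `K` containing both. -/
def conductorIn (A B K : Type*) [CommRing A] [CommRing B] [Field K] [Algebra A B] [Algebra B K] [Algebra A K] [IsScalarTower A B K] : 
    Submodule A K where
  carrier := {a | ∀ b : B, a * algebraMap B K b ∈ (algebraMap A K).range}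
  add_mem' ha hb b := by rw [add_mul]; exact add_mem (ha b) (hb b)
  zero_mem' b := by rw [zero_mul]; exact zero_mem _
  smul_mem' c a ha b := by
    rw [Algebra.smul_def, mul_assoc]
    exact mul_mem ⟨c, rfl⟩ (ha b)

theorem mul_algebraMap_mem_conductorIn {a : K} (ha : a ∈ conductorIn A B K) (b : B) :
    a * algebraMap B K b ∈ conductorIn A B K := fun b' ↦ by
  rw [mul_assoc, ← map_mul]
  exact ha _

theorem mem_range_of_mem_conductorIn {a : K} (ha : a ∈ conductorIn A B K) :
    a ∈ (algebraMap A K).range := by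
  simpa using ha 1

/-- If fD preserves B and a lies in the conductor, then (fab)D(A) ⊆ aB ⊆ A for all b in B, so fab
lies in A by `hI`. Thus f stabilizes the conductor, a nonzero finitely generated A-module, and is
integral. -/
theorem mem_range_of_mem_derIdeal {D : Derivation k K K} (hC : conductorIn A B K ≠ ⊥)
    (hI : ∀ f ∈ derIdeal A D, f ∈ (algebraMap A K).range)
    {f : K} (hf : f ∈ derIdeal B D) : f ∈ (algebraMap B K).range := by
  have h1 : ∀ a ∈ conductorIn A B K, f • a ∈ conductorIn A B K := by
    intro a ha b
    refine hI _ fun a' ↦ ?_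
    obtain ⟨c, hc⟩ := hf (algebraMap A B a')
    have h2 := ha (b * c)
    rw [map_mul, hc, ← IsScalarTower.algebraMap_apply] at h2
    convert h2 using 1
    rw [smul_eq_mul]; ring
  have hfg : (conductorIn A B K).FG := by
    have : IsNoetherian A (1 : Submodule A K) :=
      isNoetherian_of_fg_of_noetherian _ (by rw [Submodule.one_eq_span]; exact Submodule.fg_span_singleton 1)
    exact Submodule.FG.of_le_of_isNoetherian (T := 1) fun a ha ↦
      Submodule.mem_one.mpr (mem_range_of_mem_conductorIn ha)
  have h3 : IsIntegral A f := isIntegral_of_smul_mem_submodule _ hC hfg f h1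
  exact (IsIntegralClosure.isIntegral_iff (A := B)).mp h3

/-- By maximality of the valuation of D(x), the derivation D/D(x) is integral at P. Up to a factor
that is a unit at P, 1/D(x) therefore lies in `derIdeal B D`, hence in B. -/
theorem one_le_valuation_derivation {D : Derivation k K K} (hC : conductorIn A B K ≠ ⊥)
    (hI : ∀ f ∈ derIdeal A D, f ∈ (algebraMap A K).range) {x : K} (hx : D x ≠ 0)
    (h : ∀ y, P.valuation K y ≤ 1 → P.valuation K (D y) ≤ P.valuation K (D x)) :
    1 ≤ P.valuation K (D x) := by
  have hV : P.valuation K (D x) ≠ 0 := by simpa using hx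
  obtain ⟨s, hs, hsf⟩ := exists_mul_mem_derIdeal P D (f := (D x)⁻¹) fun b ↦ by
    rw [map_mul, map_inv₀]
    exact inv_mul_le_one_of_le₀ (h _ (P.valuation_le_one b)) zero_le
  obtain ⟨b, hb⟩ := mem_range_of_mem_derIdeal hC hI hsf
  have h2 : P.valuation K (algebraMap B K b) ≤ 1 := P.valuation_le_one (K := K) b
  rw [hb, map_mul, hs, one_mul, map_inv₀] at h2
  exact (inv_le_one₀ (zero_lt_iff.mpr hV)).mp h2

/-- D maps A to A and lowers every nonzero order by e + 1. Orders of elements of A cannot become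
negative, so repeated application of D must end at order zero. -/
theorem not_dvd_of_valuation_eq {D : Derivation k K K} 
    (hDA : ∀ a : A, D (algebraMap A K a) ∈ (algebraMap A K).range) {e : ℕ} 
    (h : ∀ (n : ℤ) x, n ≠ 0 → P.valuation K x = exp n → P.valuation K (D x) = exp (e + (n + 1))) (n : ℕ) :
    ∀ a : A, P.valuation K (algebraMap A K a) = exp (-(n : ℤ)) → e + 1 ∣ n := by
  have hA (a : A) : P.valuation K (algebraMap A K a) ≤ 1 := by
    rw [IsScalarTower.algebraMap_apply A B K]
    exact P.valuation_le_one _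
  induction n using Nat.strong_induction_on with
  | _ n ih =>
    intro a ha
    obtain rfl | hn := eq_or_ne n 0
    · exact dvd_zero _
    have h1 := h _ _ (by simpa using hn) ha
    obtain ⟨a', ha'⟩ := hDA a
    rw [← ha'] at h1
    have h2 := hA a'
    rw [h1, ← exp_zero, exp_le_exp] at h2
    obtain ⟨m, rfl⟩ : ∃ m, n = m + (e + 1) := ⟨n - (e + 1), by lia⟩
    have h3 := ih m (by lia) a' (by rw [h1]; congr 1; push_cast; ring)
    exact (Nat.dvd_add_self_right).mpr h3

/-- For c ≠ 0 in the conductor, both c and ct lie in A, and their orders are consecutive. As e + 1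
divides both, e = 0. -/
theorem valuation_derivation_eq_one [CharZero k] {D : Derivation k K K} (hC : conductorIn A B K ≠ ⊥)
    (hI : ∀ f ∈ derIdeal A D, f ∈ (algebraMap A K).range)
    (hDA : ∀ a : A, D (algebraMap A K a) ∈ (algebraMap A K).range) {t : B}
    (ht : P.valuation K (algebraMap B K t) = exp (-1)) (hDt : D (algebraMap B K t) ≠ 0)
    (h1 : ∀ x, P.valuation K x ≤ 1 → P.valuation K (D x) ≤ P.valuation K (D (algebraMap B K t)))
    (h2 : ∀ (n : ℤ) x, n ≠ 0 → P.valuation K x = exp n →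
        P.valuation K (D x) = P.valuation K (D (algebraMap B K t)) * exp (n + 1)) :
    P.valuation K (D (algebraMap B K t)) = 1 := by
  have hle := one_le_valuation_derivation P hC hI hDt h1
  obtain ⟨e, he⟩ : ∃ e : ℕ, P.valuation K (D (algebraMap B K t)) = exp (e : ℤ) := by
    generalize P.valuation K (D (algebraMap B K t)) = z at hle
    lift z to ℤ using (zero_lt_one.trans_le hle).ne'
    rw [← exp_zero, exp_le_exp] at hle
    exact ⟨z.toNat, by rw [Int.toNat_of_nonneg hle]⟩
  rw [he, ← exp_zero]
  congr 1
  have key := not_dvd_of_valuation_eq P hDA (e := e) fun n x hn hx ↦ by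
    rw [h2 n x hn hx, he, ← exp_add]
  obtain ⟨c, hc, hc0⟩ := Submodule.exists_mem_ne_zero_of_ne_bot hC
  obtain ⟨a, rfl⟩ := mem_range_of_mem_conductorIn hc
  obtain ⟨a', ha'⟩ := mem_range_of_mem_conductorIn (mul_algebraMap_mem_conductorIn hc t)
  obtain ⟨n, hn⟩ : ∃ n : ℕ, P.valuation K (algebraMap A K a) = exp (-(n : ℤ)) := by
    have h3 : P.valuation K (algebraMap A K a) ≤ 1 := by
      rw [IsScalarTower.algebraMap_apply A B K]
      exact P.valuation_le_one _
    have h4 : P.valuation K (algebraMap A K a) ≠ 0 := by simpa using hc0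
    generalize P.valuation K (algebraMap A K a) = z at h3 h4
    lift z to ℤ using h4
    rw [← exp_zero, exp_le_exp] at h3
    exact ⟨(-z).toNat, by rw [Int.toNat_of_nonneg (by lia), neg_neg]⟩
  have h5 := key n a hn
  have h6 := key (n + 1) a' (by
    rw [ha', map_mul, hn, ht, ← exp_add]; congr 1; push_cast; ring)
  have h7 := (Nat.dvd_add_right h5).mp h6
  have := Nat.dvd_one.mp h7
  lia

/-- D now preserves B, hence also the conductor. If the conductor lay in a maximal ideal of B, an
element of least order n > 0 there would have a derivative in the conductor of order n − 1. So 1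
lies in the conductor and B = A. -/
theorem mem_range_of_derIdeal_eq_one [CharZero k] (htr : Algebra.trdeg k K = 1)
    {D : Derivation k K K} (hD : D ≠ 0)
    (hC : conductorIn A B K ≠ ⊥) (hI : ∀ f ∈ derIdeal A D, f ∈ (algebraMap A K).range)
    (hDA : ∀ a : A, D (algebraMap A K a) ∈ (algebraMap A K).range) (b : B) :
    algebraMap B K b ∈ (algebraMap A K).range := by
  have hval (P : HeightOneSpectrum B) : (∀ x, P.valuation K x ≤ 1 → P.valuation K (D x) ≤ 1) ∧
      ∀ (n : ℤ) x, n ≠ 0 → P.valuation K x = exp n → P.valuation K (D x) = exp (n + 1) := by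
    obtain ⟨t, ht, hDt, h1, h2⟩ := exists_uniformizer_valuation_derivation P htr hD
    have h3 := valuation_derivation_eq_one P hC hI hDA ht hDt h1 h2
    simp only [h3] at h1 h2
    simp only [one_mul] at h2
    exact ⟨h1, h2⟩
  have hDB (b : B) : D (algebraMap B K b) ∈ (algebraMap B K).range :=
    HeightOneSpectrum.mem_integers_of_valuation_le_one K _ fun P ↦ (hval P).1 _ (P.valuation_le_one b)
  have hDC : ∀ a ∈ conductorIn A B K, D a ∈ conductorIn A B K := by
    intro a ha b
    obtain ⟨a', ha'⟩ := ha b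
    obtain ⟨b', hb'⟩ := hDB b
    have h1 : D a * algebraMap B K b = D (algebraMap A K a') - a * algebraMap B K b' := by
      rw [ha', hb', D.leibniz, smul_eq_mul, smul_eq_mul]; ring
    rw [h1]
    exact sub_mem (hDA a') (ha b')
  let J : Ideal B :=
    { carrier := {b | algebraMap B K b ∈ conductorIn A B K}
      zero_mem' := by simp
      add_mem' ha hb := by rw [Set.mem_ofPred_eq, map_add]; exact add_mem ha hb
      smul_mem' c b hb := by
        rw [Set.mem_ofPred_eq, smul_eq_mul, mul_comm, map_mul]
        exact mul_algebraMap_mem_conductorIn hb c }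
  have hCJ : ∀ a ∈ conductorIn A B K, ∃ b ∈ J, algebraMap B K b = a := by
    intro a ha
    obtain ⟨a', rfl⟩ := mem_range_of_mem_conductorIn ha
    rw [IsScalarTower.algebraMap_apply A B K] at ha ⊢
    exact ⟨_, ha, rfl⟩
  suffices J = ⊤ by
    have h1 : (1 : B) ∈ J := this ▸ Submodule.mem_top
    have := h1 b
    rwa [map_one, one_mul] at this
  by_contra hJ
  obtain ⟨m, hm, hJm⟩ := Ideal.exists_le_maximal J hJ
  obtain ⟨c, hc, hc0⟩ := Submodule.exists_mem_ne_zero_of_ne_bot hC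
  obtain ⟨c, hcJ, rfl⟩ := hCJ c hc
  have hm0 : m ≠ ⊥ := fun h ↦ hc0 (by
    have := hJm hcJ
    rw [h, Ideal.mem_bot] at this
    rw [this, map_zero])
  let P : HeightOneSpectrum B := ⟨m, hm.isPrime, hm0⟩
  have hex : ∃ n : ℕ, ∃ c ∈ J, P.valuation K (algebraMap B K c) = exp (-(n : ℤ)) := by
    have h3 := P.valuation_le_one (K := K) c
    have h4 : P.valuation K (algebraMap B K c) ≠ 0 := by simpa using hc0
    generalize hz : P.valuation K (algebraMap B K c) = z at h3 h4
    lift z to ℤ using h4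
    rw [← exp_zero, exp_le_exp] at h3
    exact ⟨(-z).toNat, c, hcJ, by rw [Int.toNat_of_nonneg (by lia), neg_neg, hz]⟩
  classical
  obtain ⟨b, hbJ, hb⟩ := Nat.find_spec hex
  set n := Nat.find hex with hn
  have hlt := (P.valuation_lt_one_iff_mem (K := K) b).mpr (hJm hbJ)
  rw [hb, ← exp_zero, exp_lt_exp] at hlt
  have h5 := (hval P).2 _ _ hlt.ne hb
  obtain ⟨d, hdJ, hd⟩ := hCJ _ (hDC _ hbJ)
  refine Nat.find_min hex (m := n - 1) (by lia) ⟨d, hdJ, ?_⟩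
  rw [hd, h5]
  congr 1
  lia

theorem conductorIn_ne_bot (A B K : Type*) [CommRing A] [IsDomain A] [CommRing B] [Field K]
    [Algebra A B] [Algebra B K] [Algebra A K] [IsScalarTower A B K] [IsFractionRing A K]
    [Module.Finite A B] : conductorIn A B K ≠ ⊥ := by
  obtain ⟨c, hc, h⟩ := FractionalIdeal.isFractional_of_fg (R := A) (S := nonZeroDivisors A)
    (I := (IsScalarTower.toAlgHom A B K).toLinearMap.range) (by
      rw [LinearMap.range_eq_map]
      exact Module.Finite.fg_top.map _)
  refine (Submodule.ne_bot_iff _).mpr ⟨algebraMap A K c, fun b ↦ ?_,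
    IsFractionRing.to_map_ne_zero_of_mem_nonZeroDivisors hc⟩
  rw [← Algebra.smul_def]
  exact h _ ⟨b, rfl⟩

end Lipman

/-- An affine curve whose module of derivations is free is normal. -/
theorem isIntegrallyClosed_of_derIdeal_eq_span {k A K : Type u} [Field k] [IsAlgClosed k] [CharZero k]
    [CommRing A] [IsDomain A] [Field K] [Algebra k A] [Algebra k K] [Algebra A K] [IsScalarTower k A K]
    [IsFractionRing A K] [Algebra.FiniteType k A] (htr : Algebra.trdeg k A = 1)
    {D : Derivation k K K} (hD : D ≠ 0) {x : K} (h : derIdeal A D = Submodule.span A {x}) :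
    IsIntegrallyClosed A := by
  have : IsNoetherianRing A := Algebra.FiniteType.isNoetherianRing k A
  let B := integralClosure A K
  obtain ⟨hB, hfin⟩ := isDedekindDomain_and_finite_of_isIntegralClosure (K := K) htr B
  have : Algebra.IsAlgebraic A K := IsLocalization.isAlgebraic _ (nonZeroDivisors A)
  have : IsFractionRing B K := integralClosure.isFractionRing_of_algebraic fun x hx ↦
    (map_eq_zero_iff _ (IsFractionRing.injective A K)).mp hx
  have : Algebra.FiniteType k B := Algebra.FiniteType.trans (S := A) inferInstance inferInstance
  have hx0 : x ≠ 0 := by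
    rintro rfl
    exact derIdeal_ne_bot (A := A) D (by rw [h, Submodule.span_zero_singleton])
  -- Rescaling D by the generator makes the ideal of multipliers equal to A.
  have hxD : x • D ≠ 0 := smul_ne_zero hx0 hD
  have hI : ∀ f ∈ derIdeal A (x • D), f ∈ (algebraMap A K).range := by
    intro f hf
    have h1 : f * x ∈ derIdeal A D := fun a ↦ by
      rw [mul_assoc]
      exact hf a
    rw [h, Submodule.mem_span_singleton] at h1
    obtain ⟨a, ha⟩ := h1
    refine ⟨a, mul_right_cancel₀ hx0 ?_⟩
    rw [← ha, Algebra.smul_def]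
  have hx : x ∈ derIdeal A D := h ▸ Submodule.mem_span_singleton_self x
  rw [isIntegrallyClosed_iff K]
  intro y hy
  exact mem_range_of_derIdeal_eq_one (trdeg_eq_of_isFractionRing k A K ▸ htr) hxD
    (conductorIn_ne_bot A B K) hI hx (⟨y, hy⟩ : B)

end DerivationBlowup

namespace DerivationBlowup

/-! ### Integral schemes with a generic K-valued point -/

section Model

variable {K : Type u} [Field K] {X Y : Scheme.{u}}

/-- Evaluation of the sections over `U` at a `K`-valued point of `U`. -/
noncomputable def evalAt (j : Spec (.of K) ⟶ X) (U : X.Opens) (h : ⊤ ≤ j ⁻¹ᵁ U) : Γ(X, U) →+* K :=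
  (j.appLE U ⊤ h ≫ (Scheme.ΓSpecIso (.of K)).hom).hom

theorem evalAt_map (j : Spec (.of K) ⟶ X) {U V : X.Opens} (i : V ⟶ U) (hV : ⊤ ≤ j ⁻¹ᵁ V) (a : Γ(X, U)) :
    evalAt j V hV (X.presheaf.map i.op a) = evalAt j U (hV.trans (j.preimage_mono i.le)) a := by
  simp only [evalAt, ← Scheme.Hom.map_appLE j hV i.op, CommRingCat.hom_comp, RingHom.comp_apply]

theorem evalAt_comp {j' : Spec (.of K) ⟶ Y} {j : Spec (.of K) ⟶ X} {f : Y ⟶ X} (e : j' ≫ f = j)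
    {U : X.Opens} (h : ⊤ ≤ j' ⁻¹ᵁ f ⁻¹ᵁ U) (h' : ⊤ ≤ j ⁻¹ᵁ U) (a : Γ(X, U)) :
    evalAt j' (f ⁻¹ᵁ U) h (f.app U a) = evalAt j U h' a := by
  subst e
  have : (j' ≫ f).appLE U ⊤ h' = f.app U ≫ j'.appLE (f ⁻¹ᵁ U) ⊤ h := by
    rw [Scheme.Hom.comp_appLE]
  simp only [evalAt, this]
  rfl

theorem specMap_evalAt_fromSpec (j : Spec (.of K) ⟶ X) {U : X.Opens} (hU : IsAffineOpen U)
    (h : ⊤ ≤ j ⁻¹ᵁ U) : Spec.map (CommRingCat.ofHom (evalAt j U h)) ≫ hU.fromSpec = j := by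
  have h1 := hU.SpecMap_appLE_fromSpec j (isAffineOpen_top (Spec (.of K))) h
  have h2 : Spec.map (CommRingCat.ofHom (evalAt j U h)) =
      Spec.map (Scheme.ΓSpecIso (.of K)).hom ≫ Spec.map (j.appLE U ⊤ h) := by
    rw [← Spec.map_comp]; rfl
  rw [h2, Category.assoc, h1]
  rw [IsAffineOpen.fromSpec_top, ← Category.assoc, ← Scheme.isoSpec_Spec_hom]
  simp

theorem le_preimage_basicOpen_iff (j : Spec (.of K) ⟶ X) {U : X.Opens} (h : ⊤ ≤ j ⁻¹ᵁ U) (g : Γ(X, U)) :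
    ⊤ ≤ j ⁻¹ᵁ (X.basicOpen g) ↔ evalAt j U h g ≠ 0 := by
  have h1 : (Spec (.of K)).basicOpen (j.appLE U ⊤ h g) = j ⁻¹ᵁ (X.basicOpen g) := by
    rw [Scheme.basicOpen_appLE, top_inf_eq]
  rw [← h1]
  have hu : IsUnit (evalAt j U h g) ↔ IsUnit (j.appLE U ⊤ h g) :=
    isUnit_map_iff (Scheme.ΓSpecIso (.of K)).commRingCatIsoToRingEquiv (j.appLE U ⊤ h g)
  rw [← isUnit_iff_ne_zero, hu]
  refine ⟨fun h2 ↦ ?_, fun h2 ↦ (Scheme.basicOpen_of_isUnit _ h2).ge⟩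
  rw [← hu, isUnit_iff_ne_zero]
  intro h3
  have h4 : j.appLE U ⊤ h g = 0 := by
    apply (ConcreteCategory.bijective_of_isIso (Scheme.ΓSpecIso (.of K)).hom).1
    rw [map_zero]
    exact h3
  rw [h4, Scheme.basicOpen_zero, top_le_iff] at h2
  exact bot_ne_top h2

/-- An integral scheme with a `K`-valued point that identifies `K` with the function field. -/
structure IsModel (j : Spec (.of K) ⟶ X) : Prop where
  isIntegral : IsIntegral X
  le_preimage : ∀ U : X.Opens, (U : Set X).Nonempty → ⊤ ≤ j ⁻¹ᵁ U
  injective : ∀ (U : X.Opens) (h : ⊤ ≤ j ⁻¹ᵁ U), Function.Injective (evalAt j U h)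
  exists_mul_eq : ∀ (U : X.Opens) (h : ⊤ ≤ j ⁻¹ᵁ U), IsAffineOpen U → ∀ x : K,
    ∃ a b, evalAt j U h b ≠ 0 ∧ x * evalAt j U h b = evalAt j U h a

end Model

/-! ### Quasi-coherent algebras from subrings of K -/

section RelativeSpec
open Scheme Limits AffineZariskiSite

variable {K : Type u} [Field K] {X Y : Scheme.{u}} (j : Spec (.of K) ⟶ X)
  (T : X.AffineZariskiSite → Subring K)

/-- The quasi-coherent algebra given by a compatible family of subrings of `K`. -/
noncomputable def subringDiagram 
    (hT : ∀ U V : X.AffineZariskiSite, U ≤ V → ⊤ ≤ j ⁻¹ᵁ U.toOpens → T V ≤ T U) : X.AffineZariskiSiteᵒᵖ ⥤ CommRingCat.{u} where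
  -- Functions on the proofs that U contains the K-valued point: this is T U if it does and the zero
  -- ring if it does not, as is needed for the empty open set.
  obj U := .of (PLift (⊤ ≤ j ⁻¹ᵁ U.unop.toOpens) → T U.unop)
  map {V U} i := CommRingCat.ofHom
    { toFun φ h := Subring.inclusion (hT U.unop V.unop i.unop.le h.down) (φ ⟨h.down.trans (j.preimage_mono (toOpens_mono i.unop.le))⟩)
      map_one' := rfl
      map_mul' _ _ := rfl
      map_zero' := rfl
      map_add' _ _ := rfl }
  map_id _ := rfl
  map_comp _ _ := rfl

noncomputable def subringDiagramMap 
    (hT : ∀ U V : X.AffineZariskiSite, U ≤ V → ⊤ ≤ j ⁻¹ᵁ U.toOpens → T V ≤ T U)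
    (h0 : ∀ (U : X.AffineZariskiSite) (h : ⊤ ≤ j ⁻¹ᵁ U.toOpens) a, evalAt j U.toOpens h a ∈ T U) :
    (toOpensFunctor X).op ⋙ X.presheaf ⟶ subringDiagram j T hT where
  app U := CommRingCat.ofHom (S := PLift (⊤ ≤ j ⁻¹ᵁ U.unop.toOpens) → T U.unop)
    (RingHom.pi fun h ↦ (evalAt j U.unop.toOpens h.down).codRestrict (T U.unop) (h0 _ h.down))
  naturality {V U} i := by
    ext a
    funext h
    exact Subtype.ext (evalAt_map j (homOfLE (toOpens_mono i.unop.le)) h.down a)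

/-- This is the quasi-coherence condition for gluing: the ring over D(g) is the localization at g of
the ring over U. -/
theorem coequifibered_subringDiagramMap 
    (hT : ∀ U V : X.AffineZariskiSite, U ≤ V → ⊤ ≤ j ⁻¹ᵁ U.toOpens → T V ≤ T U)
    (h0 : ∀ (U : X.AffineZariskiSite) (h : ⊤ ≤ j ⁻¹ᵁ U.toOpens) a, evalAt j U.toOpens h a ∈ T U)
    (hloc : ∀ (U : X.AffineZariskiSite) (h : ⊤ ≤ j ⁻¹ᵁ U.toOpens) (g : Γ(X, U.toOpens)), evalAt j U.toOpens h g ≠ 0 →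
      ∀ x ∈ T (U.basicOpen g), ∃ m : ℕ, evalAt j U.toOpens h g ^ m * x ∈ T U) :
    (subringDiagramMap j T hT h0).Coequifibered := by
  refine coequifibered_iff_forall_isLocalizationAway.mpr fun U g ↦ ?_
  let R : Type u := PLift (⊤ ≤ j ⁻¹ᵁ U.toOpens) → T U
  let S : Type u := PLift (⊤ ≤ j ⁻¹ᵁ X.basicOpen g) → T (U.basicOpen g)
  let : Algebra R S := ((subringDiagram j T hT).map (homOfLE (U.basicOpen_le g)).op).hom.toAlgebra
  let γ : R := (subringDiagramMap j T hT h0).app (.op U) g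
  change IsLocalization.Away γ S
  have hle : X.basicOpen g ≤ U.toOpens := X.basicOpen_le g
  have hval (φ : R) (h) : ((algebraMap R S φ h : T (U.basicOpen g)) : K) =
    φ ⟨h.down.trans (j.preimage_mono hle)⟩ := rfl
  have hγ (h) : (γ h : K) = evalAt j U.toOpens h.down g := rfl
  by_cases hg : ⊤ ≤ j ⁻¹ᵁ X.basicOpen g
  · have hU : ⊤ ≤ j ⁻¹ᵁ U.toOpens := hg.trans (j.preimage_mono hle)
    have hg0 := (le_preimage_basicOpen_iff j hU g).mp hg
    have hγn (n : ℕ) : ((γ ^ n) ⟨hU⟩ : K) = evalAt j U.toOpens hU g ^ n := rfl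
    have hinv : (evalAt j U.toOpens hU g)⁻¹ ∈ T (U.basicOpen g) := by
      have hu : IsUnit (X.presheaf.map (homOfLE hle).op g) :=
        RingedSpace.isUnit_res_basicOpen _ g
      obtain ⟨u, hu⟩ := hu
      have h1 := h0 (U.basicOpen g) hg ((u⁻¹ : Γ(X, X.basicOpen g)ˣ) : Γ(X, X.basicOpen g))
      convert h1 using 1
      rw [← evalAt_map j (homOfLE hle) hg g, ← hu]
      symm
      refine eq_inv_of_mul_eq_one_right ?_
      change evalAt j (X.basicOpen g) hg _ * evalAt j (X.basicOpen g) hg _ = 1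
      rw [← map_mul, Units.mul_inv, map_one]
    refine ⟨?_, ?_, ?_⟩
    · rintro ⟨_, n, rfl⟩
      refine IsUnit.of_mul_eq_one (fun _ ↦ ⟨(evalAt j U.toOpens hU g)⁻¹ ^ n, pow_mem hinv n⟩) ?_
      funext h
      apply Subtype.ext
      change ((γ ^ n) ⟨hU⟩ : K) * (evalAt j U.toOpens hU g)⁻¹ ^ n = 1
      rw [hγn, ← mul_pow, mul_inv_cancel₀ hg0, one_pow]
    · intro φ
      obtain ⟨m, hm⟩ := hloc U hU g hg0 (φ ⟨hg⟩) (φ ⟨hg⟩).2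
      refine ⟨(fun _ ↦ ⟨_, hm⟩, ⟨γ ^ m, m, rfl⟩), ?_⟩
      funext h
      apply Subtype.ext
      exact mul_comm _ _
    · intro φ ψ h
      have h1 : (φ ⟨hU⟩ : K) = ψ ⟨hU⟩ := by
        rw [← hval φ ⟨hg⟩, ← hval ψ ⟨hg⟩, h]
      refine ⟨1, ?_⟩
      rw [Subtype.ext_iff.mpr h1 |> fun h2 ↦ (funext fun _ ↦ h2 : φ = ψ)]
  -- If D(g) misses the K-valued point, g evaluates to zero, so both rings are zero.
  · have : IsEmpty (PLift (⊤ ≤ j ⁻¹ᵁ X.basicOpen g)) := ⟨fun h ↦ hg h.down⟩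
    have : Subsingleton S := inferInstanceAs (Subsingleton (PLift (⊤ ≤ j ⁻¹ᵁ X.basicOpen g) → _))
    have hγ0 : γ = 0 := by
      funext h
      apply Subtype.ext
      rw [hγ]
      by_contra h1
      exact hg ((le_preimage_basicOpen_iff j h.down g).mpr h1)
    refine ⟨fun _ ↦ isUnit_of_subsingleton _, fun φ ↦ ⟨(0, 1), Subsingleton.elim _ _⟩, fun {φ ψ} _ ↦ ?_⟩
    exact ⟨⟨γ, 1, pow_one _⟩, by simp [hγ0]⟩

end RelativeSpec

end DerivationBlowup

namespace DerivationBlowup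

/-! ### Recognizing models locally -/

section OfCover

variable {K : Type u} [Field K] {X Y : Scheme.{u}}

theorem nonempty_of_top_le_preimage (j : Spec (.of K) ⟶ Y) {U : Y.Opens} (h : ⊤ ≤ j ⁻¹ᵁ U) :
    (U : Set Y).Nonempty := by
  obtain ⟨x⟩ : Nonempty (Spec (.of K)) := inferInstance
  exact ⟨j x, h (Set.mem_univ x)⟩

/-- Every nonempty open set contains the image of the same K-valued point, which makes Y
irreducible. Reducedness and the fraction property are inherited from the affine members of the
cover. -/
theorem IsModel.of_cover (j : Spec (.of K) ⟶ Y)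
    (H : ∀ y : Y, ∃ (W : Y.Opens) (h : ⊤ ≤ j ⁻¹ᵁ W), y ∈ W ∧ IsAffineOpen W ∧
      Function.Injective (evalAt j W h) ∧
      ∀ x : K, ∃ a b, evalAt j W h b ≠ 0 ∧ x * evalAt j W h b = evalAt j W h a) : IsModel j := by
  have hle (V : Y.Opens) (hV : (V : Set Y).Nonempty) : ⊤ ≤ j ⁻¹ᵁ V := by
    obtain ⟨y, hy⟩ := hV
    obtain ⟨W, h, hyW, hW, hinj, -⟩ := H y
    obtain ⟨g, hgV, hyg⟩ := hW.exists_basicOpen_le ⟨y, hy⟩ hyW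
    refine ((le_preimage_basicOpen_iff j h g).mpr fun h0 ↦ ?_).trans (j.preimage_mono hgV)
    rw [← map_zero (evalAt j W h)] at h0
    rw [hinj h0, Scheme.basicOpen_zero] at hyg
    exact hyg
  have hirr : IrreducibleSpace Y := by
    obtain ⟨x⟩ : Nonempty (Spec (.of K)) := inferInstance
    have : Nonempty Y := ⟨j x⟩
    have : PreirreducibleSpace Y := ⟨by
      intro U V hU hV hU' hV'
      rw [Set.univ_inter] at hU' hV' ⊢
      exact ⟨j x, hle ⟨U, hU⟩ hU' (Set.mem_univ x), hle ⟨V, hV⟩ hV' (Set.mem_univ x)⟩⟩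
    exact { toNonempty := ‹_› }
  have hred : IsReduced Y := by
    choose W h hyW hW hinj _ using H
    let 𝒰 : Y.OpenCover := Y.openCoverOfIsOpenCover W (eq_top_iff.mpr fun y _ ↦ Opens.mem_iSup.mpr ⟨y, hyW y⟩)
    have (y : 𝒰.I₀) : IsReduced (𝒰.X y) := by
      have : IsAffine (𝒰.X y) := hW y
      have h1 : IsDomain Γ(Y, W y) := (hinj y).isDomain _
      have : _root_.IsReduced Γ(𝒰.X y, ⊤) := by
        refine isReduced_of_injective (W y).topIso.commRingCatIsoToRingEquiv ?_
        exact RingEquiv.injective _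
      exact isReduced_of_isAffine_isReduced _
    exact IsReduced.of_openCover Y 𝒰
  have hint : IsIntegral Y := isIntegral_of_irreducibleSpace_of_isReduced Y
  refine ⟨hint, hle, fun U h ↦ ?_, fun U h hU x ↦ ?_⟩
  · rw [injective_iff_map_eq_zero]
    intro a ha
    rw [← basicOpen_eq_bot_iff, ← Opens.not_nonempty_iff_eq_bot]
    intro hne
    exact (le_preimage_basicOpen_iff j h a).mp (hle _ hne) ha
  · obtain ⟨y, hy⟩ := nonempty_of_top_le_preimage j h
    obtain ⟨W, hW, hyW, hWa, hinj, hfrac⟩ := H y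
    obtain ⟨g, g', e, hg⟩ := exists_basicOpen_le_affine_inter hU hWa y ⟨hy, hyW⟩
    have hj : ⊤ ≤ j ⁻¹ᵁ (Y.basicOpen g) := hle _ ⟨y, hg⟩
    have hloc := hU.isLocalization_basicOpen g
    have hg0 := (le_preimage_basicOpen_iff j h g).mp hj
    have key (c : Γ(Y, W)) : ∃ (n : ℕ) (a : Γ(Y, U)), evalAt j W hW c * evalAt j U h g ^ n = evalAt j U h a := by
      let c' : Γ(Y, Y.basicOpen g) := Y.presheaf.map (homOfLE (e.le.trans (Y.basicOpen_le g'))).op c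
      obtain ⟨n, a, ha⟩ := IsLocalization.Away.surj g c'
      refine ⟨n, a, ?_⟩
      have := congr_arg (evalAt j _ hj) ha
      rw [map_mul, map_pow] at this
      erw [evalAt_map, evalAt_map, evalAt_map] at this
      exact this
    obtain ⟨a, b, hb, hab⟩ := hfrac x
    obtain ⟨n, a', ha'⟩ := key a
    obtain ⟨m, b', hb'⟩ := key b
    refine ⟨a' * g ^ m, b' * g ^ n, ?_, ?_⟩
    · rw [map_mul, map_pow, ← hb']
      positivity
    · rw [map_mul, map_mul, map_pow, map_pow, ← hb', ← ha', ← hab]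
      ring

end OfCover

/-! ### The relative spectrum as a model -/

section RelativeSpec
open Scheme Limits AffineZariskiSite

variable {K : Type u} [Field K] {X : Scheme.{u}} 

theorem exists_glued {F : X.AffineZariskiSiteᵒᵖ ⥤ CommRingCat.{u}}
    {α : (AffineZariskiSite.toOpensFunctor X).op ⋙ X.presheaf ⟶ F} (H : α.Coequifibered) :
    ∃ (Y : Scheme.{u}) (f : Y ⟶ X) (c : ∀ U : X.AffineZariskiSite, Spec (F.obj (.op U)) ⟶ Y),
      (∀ U, IsOpenImmersion (c U)) ∧ (∀ U, c U ≫ f = Spec.map (α.app (.op U)) ≫ U.2.fromSpec) ∧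
      (∀ U, ((f ⁻¹ᵁ U.toOpens : Y.Opens) : Set Y) = Set.range (c U)) ∧
      ∀ (U V : X.AffineZariskiSite) (i : U ⟶ V), Spec.map (F.map i.op) ≫ c V = c U := by
  let d := relativeGluingData H
  have : (d.functor ⋙ forget).IsLocallyDirected :=
    Cover.RelativeGluingData.instIsLocallyDirectedI₀CompFunctorForgetOfIsThin ..
  refine ⟨d.glued, d.toBase, fun U ↦ d.cover.f U, fun U ↦ d.cover.map_prop U, fun U ↦ ?_, fun U ↦ ?_, fun U V i ↦ ?_⟩
  · exact colimit.ι_desc _ _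
  · have h1 := d.preimage_toBase_eq_range_ι U
    have h2 : Set.range ((directedCover X).f U) = U.toOpens := Opens.range_ι _
    rw [h2] at h1
    exact h1
  · exact colimit.w d.functor i

theorem exists_glued_subring {j : Spec (.of K) ⟶ X} (T : X.AffineZariskiSite → Subring K)
    (hT : ∀ U V : X.AffineZariskiSite, U ≤ V → ⊤ ≤ j ⁻¹ᵁ U.toOpens → T V ≤ T U)
    (h0 : ∀ (U : X.AffineZariskiSite) (h : ⊤ ≤ j ⁻¹ᵁ U.toOpens) a, evalAt j U.toOpens h a ∈ T U)
    (hloc : ∀ (U : X.AffineZariskiSite) (h : ⊤ ≤ j ⁻¹ᵁ U.toOpens) (g : Γ(X, U.toOpens)),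
      evalAt j U.toOpens h g ≠ 0 →
        ∀ x ∈ T (U.basicOpen g), ∃ m : ℕ, evalAt j U.toOpens h g ^ m * x ∈ T U) :
    ∃ (Y : Scheme.{u}) (f : Y ⟶ X)
      (c : ∀ U : X.AffineZariskiSite, Spec (.of (PLift (⊤ ≤ j ⁻¹ᵁ U.toOpens) → T U)) ⟶ Y)
      (p : ∀ U : X.AffineZariskiSite, ⊤ ≤ j ⁻¹ᵁ U.toOpens → (Spec (.of K) ⟶ Y)),
      (∀ U, IsOpenImmersion (c U)) ∧
      (∀ U, ((f ⁻¹ᵁ U.toOpens : Y.Opens) : Set Y) = Set.range (c U)) ∧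
      (∀ U h, p U h = Spec.map (CommRingCat.ofHom
        ((T U).subtype.comp (Pi.evalRingHom _ ⟨h⟩))) ≫ c U) ∧
      (∀ U h, p U h ≫ f = j) ∧ ∀ U V hU hV, U ≤ V → p U hU = p V hV := by
  obtain ⟨Y, f, c, hc, hcf, hrange, hcomp⟩ :=
    exists_glued (coequifibered_subringDiagramMap j T hT h0 hloc)
  let ev (U : X.AffineZariskiSite) (h : ⊤ ≤ j ⁻¹ᵁ U.toOpens) :
      (subringDiagram j T hT).obj (.op U) ⟶ .of K :=
    CommRingCat.ofHom (R := PLift (⊤ ≤ j ⁻¹ᵁ U.toOpens) → T U)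
      ((T U).subtype.comp (Pi.evalRingHom _ ⟨h⟩))
  have h1 (U : X.AffineZariskiSite) (h : ⊤ ≤ j ⁻¹ᵁ U.toOpens) : (Spec.map (ev U h) ≫ c U) ≫ f = j := by
    refine (Category.assoc _ _ _).trans ((congr_arg (_ ≫ ·) (hcf U)).trans ?_)
    refine (Category.assoc _ _ _).symm.trans ?_
    refine Eq.trans (congr_arg (· ≫ _) (Spec.map_comp _ _).symm) ?_
    exact specMap_evalAt_fromSpec j U.2 h
  have h2 (U V : X.AffineZariskiSite) (hU : ⊤ ≤ j ⁻¹ᵁ U.toOpens) (hV : ⊤ ≤ j ⁻¹ᵁ V.toOpens)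
      (hUV : U ≤ V) : Spec.map (ev U hU) ≫ c U = Spec.map (ev V hV) ≫ c V := by
    rw [← hcomp U V (homOfLE hUV)]
    refine (Category.assoc _ _ _).symm.trans ?_
    exact congr_arg (· ≫ c V) (Spec.map_comp _ _).symm
  exact ⟨Y, f, c, fun U h ↦ Spec.map (ev U h) ≫ c U, hc, hrange, fun U h ↦ rfl, h1, h2⟩

theorem appLE_isIso_of_range_eq {Z Y : Scheme.{u}} (c : Z ⟶ Y) [IsOpenImmersion c] {U : Y.Opens}
    (h : ⊤ ≤ c ⁻¹ᵁ U) (hU : (U : Set Y) = Set.range c) : IsIso (c.appLE U ⊤ h) := by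
  have h1 : U = c.opensRange := Opens.ext hU
  have := c.isIso_app U h1.le
  rw [Scheme.Hom.appLE]
  have : (homOfLE h) = eqToHom (top_le_iff.mp h).symm := rfl
  rw [this]
  infer_instance

/-- Each chart Spec (T U) has a K-valued point from T U ⊆ K. Points of different charts agree,
because two affine open sets meeting in X share a common basic open set. -/
theorem exists_relativeSpec {j : Spec (.of K) ⟶ X} (hj : IsModel j) (T : X.AffineZariskiSite → Subring K)
    (hT : ∀ U V : X.AffineZariskiSite, U ≤ V → ⊤ ≤ j ⁻¹ᵁ U.toOpens → T V ≤ T U)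
    (h0 : ∀ (U : X.AffineZariskiSite) (h : ⊤ ≤ j ⁻¹ᵁ U.toOpens) a, evalAt j U.toOpens h a ∈ T U)
    (hloc : ∀ (U : X.AffineZariskiSite) (h : ⊤ ≤ j ⁻¹ᵁ U.toOpens) (g : Γ(X, U.toOpens)),
      evalAt j U.toOpens h g ≠ 0 →
        ∀ x ∈ T (U.basicOpen g), ∃ m : ℕ, evalAt j U.toOpens h g ^ m * x ∈ T U) :
    ∃ (Y : Scheme.{u}) (f : Y ⟶ X) (j' : Spec (.of K) ⟶ Y), IsAffineHom f ∧ j' ≫ f = j ∧ IsModel j' ∧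
      ∀ (U : X.AffineZariskiSite) (h : ⊤ ≤ j' ⁻¹ᵁ f ⁻¹ᵁ U.toOpens),
        (evalAt j' (f ⁻¹ᵁ U.toOpens) h).range = T U := by
  obtain ⟨Y, f, c, p, hc, hrange, hpc, hpf, hp_le⟩ := exists_glued_subring T hT h0 hloc
  have : IsAffineHom f := ⟨fun U hU ↦ by
    have := hc ⟨U, hU⟩
    have : f ⁻¹ᵁ U = (c ⟨U, hU⟩).opensRange := Opens.ext (hrange ⟨U, hU⟩)
    rw [this]
    exact isAffineOpen_opensRange _⟩
  have hp (U V : X.AffineZariskiSite) (hU hV) : p U hU = p V hV := by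
    have hUV : ⊤ ≤ j ⁻¹ᵁ (U.toOpens ⊓ V.toOpens) := le_inf hU hV
    obtain ⟨x, hx⟩ := nonempty_of_top_le_preimage j hUV
    obtain ⟨g, g', e, hg⟩ := exists_basicOpen_le_affine_inter U.2 V.2 x hx
    have h1 : ⊤ ≤ j ⁻¹ᵁ (U.basicOpen g).toOpens := hj.le_preimage _ ⟨x, hg⟩
    have h2 : U.basicOpen g = V.basicOpen g' := Subtype.ext e
    rw [← hp_le _ U h1 hU (U.basicOpen_le g), ← hp_le _ V h1 hV (h2.le.trans (V.basicOpen_le g'))]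
  obtain ⟨U₀, hU₀⟩ : ∃ U₀ : X.AffineZariskiSite, ⊤ ≤ j ⁻¹ᵁ U₀.toOpens := by
    obtain ⟨x⟩ : Nonempty (Spec (.of K)) := inferInstance
    obtain ⟨_, ⟨U, hU, rfl⟩, hxU, -⟩ := X.isBasis_affineOpens.exists_subset_of_mem_open (Set.mem_univ (j x)) isOpen_univ
    exact ⟨⟨U, hU⟩, hj.le_preimage U ⟨_, hxU⟩⟩
  let j' := p U₀ hU₀
  have hj' : j' ≫ f = j := hpf _ _
  have hdom (U : X.AffineZariskiSite) (h : ⊤ ≤ j' ⁻¹ᵁ f ⁻¹ᵁ U.toOpens) : ⊤ ≤ j ⁻¹ᵁ U.toOpens := by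
    rw [← hj']; exact h
  have key (U : X.AffineZariskiSite) (h : ⊤ ≤ j' ⁻¹ᵁ f ⁻¹ᵁ U.toOpens) :
      ∃ e : Γ(Y, f ⁻¹ᵁ U.toOpens) ≃+* T U, ∀ a, evalAt j' (f ⁻¹ᵁ U.toOpens) h a = e a := by
    have hU := hdom U h
    let R := PLift (⊤ ≤ j ⁻¹ᵁ U.toOpens) → T U
    let ev : R →+* K := (T U).subtype.comp (Pi.evalRingHom _ ⟨hU⟩)
    let eR : R ≃+* T U :=
      { toFun φ := φ ⟨hU⟩
        invFun x _ := x
        left_inv _ := rfl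
        right_inv _ := rfl
        map_mul' _ _ := rfl
        map_add' _ _ := rfl }
    have hjp : j' = Spec.map (CommRingCat.ofHom ev) ≫ c U := (hp U₀ U hU₀ hU).trans (hpc U hU)
    have hle : ⊤ ≤ (c U) ⁻¹ᵁ f ⁻¹ᵁ U.toOpens := by
      intro x _
      change c U x ∈ ((f ⁻¹ᵁ U.toOpens : Y.Opens) : Set Y)
      rw [hrange]
      exact ⟨x, rfl⟩
    have := hc U
    have hiso : IsIso ((c U).appLE (f ⁻¹ᵁ U.toOpens) ⊤ hle) := appLE_isIso_of_range_eq _ _ (hrange U)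
    let e : Γ(Y, f ⁻¹ᵁ U.toOpens) ≅ .of R :=
      (asIso ((c U).appLE (f ⁻¹ᵁ U.toOpens) ⊤ hle)) ≪≫ Scheme.ΓSpecIso (.of R)
    refine ⟨e.commRingCatIsoToRingEquiv.trans eR, fun a ↦ ?_⟩
    have h1 : j'.appLE (f ⁻¹ᵁ U.toOpens) ⊤ h ≫ (Scheme.ΓSpecIso (.of K)).hom =
        e.hom ≫ CommRingCat.ofHom ev := by
      have : j'.appLE (f ⁻¹ᵁ U.toOpens) ⊤ h = (c U).appLE (f ⁻¹ᵁ U.toOpens) ⊤ hle ≫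
          (Spec.map (CommRingCat.ofHom ev)).appTop := by
        simp only [hjp]
        have h2 := Scheme.Hom.appLE_comp_appLE (Spec.map (CommRingCat.ofHom ev)) (c U)
          (f ⁻¹ᵁ U.toOpens) ⊤ ⊤ hle le_rfl
        rw [← h2]
        exact congr_arg (_ ≫ ·) (Scheme.Hom.appLE_eq_app _)
      rw [this, Category.assoc, Scheme.ΓSpecIso_naturality]
      simp [e]
    exact congr($h1 a)
  refine ⟨Y, f, j', inferInstance, hj', .of_cover j' fun y ↦ ?_, fun U h ↦ ?_⟩
  · obtain ⟨_, ⟨U, hU, rfl⟩, hyU, -⟩ := X.isBasis_affineOpens.exists_subset_of_mem_open (Set.mem_univ (f y)) isOpen_univ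
    have hjU : ⊤ ≤ j ⁻¹ᵁ U := hj.le_preimage U ⟨_, hyU⟩
    have h : ⊤ ≤ j' ⁻¹ᵁ f ⁻¹ᵁ U := by rw [← hj'] at hjU; exact hjU
    obtain ⟨e, he⟩ := key ⟨U, hU⟩ h
    refine ⟨f ⁻¹ᵁ U, h, hyU, hU.preimage f, ?_, fun x ↦ ?_⟩
    · intro a b hab
      rw [he, he] at hab
      exact e.injective (Subtype.ext hab)
    · obtain ⟨a, b, hb, hab⟩ := hj.exists_mul_eq U hjU hU x
      have hev (a) : evalAt j' (f ⁻¹ᵁ U) h (f.app U a) = evalAt j U hjU a := evalAt_comp hj' h hjU a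
      exact ⟨f.app U a, f.app U b, by rwa [hev], by rwa [hev, hev]⟩
  · obtain ⟨e, he⟩ := key U h
    ext x
    constructor
    · rintro ⟨a, rfl⟩
      rw [he]
      exact (e a).2
    · intro hx
      exact ⟨e.symm ⟨x, hx⟩, by rw [he, e.apply_symm_apply]⟩

end RelativeSpec

end DerivationBlowup

namespace DerivationBlowup

/-! ### Blow-ups of affine curves -/

section AffineBlowup

variable {k A K : Type u} [Field k] [CharZero k] [CommRing A] [IsDomain A] [Field K]
  [Algebra k A] [Algebra k K] [Algebra A K] [IsScalarTower k A K] [IsFractionRing A K]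
  [Algebra.FiniteType k A]

/-- Inverting g turns the local generator x into a generator of the extended ideal over the
normalization of A[1/g]. Quantifying over all models A' of that localization allows the ring of
sections over a basic open set to be inserted directly. -/
theorem exists_generator_localization [IsAlgClosed k] (htr : Algebra.trdeg k K = 1)
    {D : Derivation k K K} (hD : D ≠ 0) (m : Ideal A) [m.IsPrime] :
    ∃ g ∉ m, ∃ x : K, x ≠ 0 ∧ ∀ (A' : Type u) [CommRing A'] [IsDomain A'] [Algebra A A'] [Algebra A' K]
      [IsScalarTower A A' K] [IsLocalization.Away g A'] [IsFractionRing A' K] [Algebra k A']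
      [IsScalarTower k A' K] [Algebra.FiniteType k A'],
      x ∈ derIdeal A' D ∧ ∀ f ∈ derIdeal A' D, f / x ∈ blowupAlgebra (derIdeal A' D) := by
  have : IsNoetherianRing A := Algebra.FiniteType.isNoetherianRing k A
  have : Infinite k := IsAlgClosed.instInfinite
  let B := integralClosure A K
  have htrA : Algebra.trdeg k A = 1 := (trdeg_eq_of_isFractionRing k A K).trans htr
  obtain ⟨hB, hfin⟩ := isDedekindDomain_and_finite_of_isIntegralClosure (K := K) htrA B
  have : Algebra.IsAlgebraic A K := IsLocalization.isAlgebraic _ (nonZeroDivisors A)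
  have : IsFractionRing B K := integralClosure.isFractionRing_of_algebraic fun x hx ↦
    (map_eq_zero_iff _ (IsFractionRing.injective A K)).mp hx
  obtain ⟨x, hx, hx0, g, hg, hgx⟩ := exists_local_generator (k := k) (B := B) (derIdeal_fg (A := A) hD)
    (derIdeal_ne_bot D) m
  have hg0 : algebraMap A K g ≠ 0 := by
    intro h
    rw [map_eq_zero_iff _ (IsFractionRing.injective A K)] at h
    exact hg (h ▸ m.zero_mem)
  refine ⟨g, hg, x, hx0, fun A' _ _ _ _ _ _ _ _ _ _ ↦ ?_⟩
  have : IsNoetherianRing A' := Algebra.FiniteType.isNoetherianRing k A'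
  have hI := derIdeal_localization (A' := A') g hg0 D
  let B' := integralClosure A' K
  obtain ⟨-, hfin'⟩ := isDedekindDomain_and_finite_of_isIntegralClosure (K := K)
    ((trdeg_eq_of_isFractionRing k A' K).trans htr) B'
  have hxI : x ∈ derIdeal A' D := hI ▸ Submodule.subset_span hx
  refine ⟨hxI, fun f hf ↦ div_mem_blowupAlgebra (B := B') hxI hx0 (fun f hf ↦ ?_) hf⟩
  rw [hI] at hf
  induction hf using Submodule.span_induction with
  | mem f hf =>
    obtain ⟨b, hb⟩ := hgx f hf
    have h1 : (b : K) ∈ B' := (IsIntegral.tower_top (A := A') b.2 :)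
    obtain ⟨u, hu⟩ := IsLocalization.Away.algebraMap_isUnit (S := A') g
    have h2 : algebraMap A' K (u⁻¹ : A'ˣ) * algebraMap A K g = 1 := by
      rw [IsScalarTower.algebraMap_apply A A' K, ← hu, ← map_mul, Units.inv_mul, map_one]
    refine ⟨algebraMap A' B' (u⁻¹ : A'ˣ) * ⟨b, h1⟩, ?_⟩
    change algebraMap A' K (u⁻¹ : A'ˣ) * (b : K) * x = f
    rw [mul_assoc]
    change algebraMap A' K (u⁻¹ : A'ˣ) * (algebraMap B K b * x) = f
    rw [hb, ← mul_assoc, h2, one_mul]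
  | zero => exact ⟨0, by simp⟩
  | add f f' _ _ h h' =>
    obtain ⟨b, rfl⟩ := h
    obtain ⟨b', rfl⟩ := h'
    exact ⟨b + b', by rw [map_add, add_mul]⟩
  | smul a f _ h =>
    obtain ⟨b, rfl⟩ := h
    refine ⟨a • b, ?_⟩
    rw [Algebra.smul_def, map_mul, ← IsScalarTower.algebraMap_apply, mul_assoc, Algebra.smul_def]

theorem finite_blowupAlgebra_derIdeal (htr : Algebra.trdeg k K = 1) {D : Derivation k K K} (hD : D ≠ 0) :
    Module.Finite A (blowupAlgebra (derIdeal A D)) := by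
  have : IsNoetherianRing A := Algebra.FiniteType.isNoetherianRing k A
  obtain ⟨-, hfin⟩ := isDedekindDomain_and_finite_of_isIntegralClosure (K := K)
    ((trdeg_eq_of_isFractionRing k A K).trans htr) (integralClosure A K)
  have hle : blowupAlgebra (derIdeal A D) ≤ integralClosure A K := fun b hb ↦
    isIntegral_of_mem_blowupAlgebra (derIdeal_fg hD) (derIdeal_ne_bot D) hb
  exact Module.Finite.of_injective (Subalgebra.inclusion hle).toLinearMap
    (Subalgebra.inclusion_injective hle)

/-- The blow-up algebra is integral over A, so a normal curve is unchanged. -/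
theorem blowupAlgebra_derIdeal_eq_bot [IsIntegrallyClosed A] {D : Derivation k K K} (hD : D ≠ 0) :
    blowupAlgebra (derIdeal A D) = ⊥ := by
  have : IsNoetherianRing A := Algebra.FiniteType.isNoetherianRing k A
  refine eq_bot_iff.mpr fun b hb ↦ ?_
  rw [Algebra.mem_bot]
  exact IsIntegrallyClosed.isIntegral_iff.mp
    (isIntegral_of_mem_blowupAlgebra (derIdeal_fg hD) (derIdeal_ne_bot D) hb)

end AffineBlowup

/-! ### Gluing lifts of morphisms -/

section Glue
open Limits

theorem exists_glue_opens {Z Y : Scheme.{u}} {ι : Type u} (W : ι → Z.Opens) (hW : ⨆ i, W i = ⊤)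
    (β : ∀ i, (W i).toScheme ⟶ Y)
    (H : ∀ i j, ∀ x ∈ W i ⊓ W j, ∃ (W' : Z.Opens) (hi : W' ≤ W i) (hj : W' ≤ W j), x ∈ W' ∧
      Z.homOfLE hi ≫ β i = Z.homOfLE hj ≫ β j) :
    ∃ γ : Z ⟶ Y, ∀ i, (W i).ι ≫ γ = β i := by
  have key (i j : ι) : pullback.fst (W i).ι (W j).ι ≫ β i = pullback.snd (W i).ι (W j).ι ≫ β j := by
    refine Scheme.hom_ext_of_forall _ _ fun p ↦ ?_
    let q : pullback (W i).ι (W j).ι ⟶ Z := pullback.fst (W i).ι (W j).ι ≫ (W i).ι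
    have hq : q = pullback.snd (W i).ι (W j).ι ≫ (W j).ι := pullback.condition
    have hpi : q p ∈ W i := (pullback.fst (W i).ι (W j).ι p).2
    have hpj : q p ∈ W j := by
      rw [hq]
      exact (pullback.snd (W i).ι (W j).ι p).2
    obtain ⟨W', hi, hj, hxW', h⟩ := H i j (q p) ⟨hpi, hpj⟩
    let V := q ⁻¹ᵁ W'
    let l : V.toScheme ⟶ W'.toScheme := IsOpenImmersion.lift W'.ι (V.ι ≫ q) (by
      rw [Scheme.Opens.range_ι]
      rintro _ ⟨x, rfl⟩
      exact x.2)
    have hl : l ≫ W'.ι = V.ι ≫ q := IsOpenImmersion.lift_fac _ _ _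
    have h1 : V.ι ≫ pullback.fst (W i).ι (W j).ι = l ≫ Z.homOfLE hi := by
      rw [← cancel_mono (W i).ι, Category.assoc, Category.assoc, Scheme.homOfLE_ι, hl]
    have h2 : V.ι ≫ pullback.snd (W i).ι (W j).ι = l ≫ Z.homOfLE hj := by
      rw [← cancel_mono (W j).ι, Category.assoc, Category.assoc, Scheme.homOfLE_ι, hl, hq]
    refine ⟨V, hxW', ?_⟩
    rw [← Category.assoc, h1, ← Category.assoc, h2, Category.assoc, Category.assoc, h]
  let 𝒰 : Z.OpenCover := Z.openCoverOfIsOpenCover W hW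
  exact ⟨𝒰.glueMorphisms β key, fun i ↦ 𝒰.ι_glueMorphisms β _ i⟩

/-- Uniqueness on small open sets makes the local lifts agree on overlaps, so they glue; it also
gives uniqueness of the global lift. -/
theorem existsUnique_lift_of_basis {X Y Z : Scheme.{u}} (f : Y ⟶ X) (σ : Z ⟶ X) (P : Z.Opens → Prop)
    (hP : ∀ (W : Z.Opens), ∀ z ∈ W, ∃ W', P W' ∧ z ∈ W' ∧ W' ≤ W)
    (hu : ∀ W, P W → ∃! β : W.toScheme ⟶ Y, β ≫ f = W.ι ≫ σ) : ∃! β : Z ⟶ Y, β ≫ f = σ := by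
  have huniq (β β' : Z ⟶ Y) (h : β ≫ f = σ) (h' : β' ≫ f = σ) : β = β' := by
    refine Scheme.hom_ext_of_forall _ _ fun z ↦ ?_
    obtain ⟨W, hW, hz, -⟩ := hP ⊤ z trivial
    refine ⟨W, hz, (hu W hW).unique ?_ ?_⟩
    · rw [Category.assoc, h]
    · rw [Category.assoc, h']
  choose W hW hzW _ using fun z : Z ↦ hP ⊤ z trivial
  choose β hβ hβu using fun z ↦ hu (W z) (hW z)
  obtain ⟨γ, hγ⟩ := exists_glue_opens W (eq_top_iff.mpr fun z _ ↦ Opens.mem_iSup.mpr ⟨z, hzW z⟩) β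
    fun i j x hx ↦ by
      obtain ⟨W', hPW', hxW', hle⟩ := hP _ x hx
      refine ⟨W', hle.trans inf_le_left, hle.trans inf_le_right, hxW', (hu W' hPW').unique ?_ ?_⟩
      · rw [Category.assoc, hβ, Scheme.homOfLE_ι_assoc]
      · rw [Category.assoc, hβ, Scheme.homOfLE_ι_assoc]
  refine ⟨γ, ?_, fun γ' hγ' ↦ huniq _ _ hγ' ?_⟩ <;>
  · refine Scheme.hom_ext_of_forall _ _ fun z ↦ ⟨W z, hzW z, ?_⟩
    rw [← hβ z, ← hγ z, Category.assoc]

theorem existsUnique_lift_of_isAffine {X Y W : Scheme.{u}} [IsAffine W] (f : Y ⟶ X) [IsAffineHom f]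
    (τ : W ⟶ X) {U : X.Opens} (hU : IsAffineOpen U) (h : ⊤ ≤ τ ⁻¹ᵁ U)
    (hψ : ∃! ψ : Γ(Y, f ⁻¹ᵁ U) ⟶ Γ(W, ⊤), f.app U ≫ ψ = τ.appLE U ⊤ h) :
    ∃! β : W ⟶ Y, β ≫ f = τ := by
  have hfU := hU.preimage f
  have htop := isAffineOpen_top W
  have hf : Spec.map (f.app U) ≫ hU.fromSpec = hfU.fromSpec ≫ f := by
    rw [Scheme.Hom.app_eq_appLE]
    exact hU.SpecMap_appLE_fromSpec f hfU le_rfl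
  have hiso : IsIso htop.fromSpec := by rw [IsAffineOpen.fromSpec_top]; infer_instance
  obtain ⟨ψ, h1, h2⟩ := hψ
  dsimp only at h1 h2
  refine ⟨inv htop.fromSpec ≫ Spec.map ψ ≫ hfU.fromSpec, ?_, fun β hβ ↦ ?_⟩
  · dsimp only
    rw [Category.assoc, Category.assoc, ← hf, ← Spec.map_comp_assoc, h1,
      hU.SpecMap_appLE_fromSpec τ htop h, IsIso.inv_hom_id_assoc]
  · subst hβ
    have h' : ⊤ ≤ β ⁻¹ᵁ f ⁻¹ᵁ U := h
    have h3 : β.appLE (f ⁻¹ᵁ U) ⊤ h' = ψ := h2 _ (Scheme.Hom.comp_appLE _ _ _ _ _).symm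
    rw [← h3, hfU.SpecMap_appLE_fromSpec β htop, IsIso.inv_hom_id_assoc]

end Glue
end DerivationBlowup

namespace DerivationBlowup

/-! ### The blow-up algebra as a subring of K -/

section Algebra

/-- The ring `blowupAlgebra (derIdeal A D)` for a ring homomorphism `A → K`. -/
def blowupSubring {k A K : Type*} [Field k] [CommRing A] [Field K] [Algebra k K] (D : Derivation k K K)
    (φ : A →+* K) : Subring K :=
  letI := φ.toAlgebra
  (blowupAlgebra (derIdeal A D)).toSubring

theorem existsUnique_ringHom {A B K R : Type*} [CommRing A] [CommRing B] [Algebra A B] [Field K]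
    [Algebra A K] [CommRing R] [Algebra A R] [Algebra R K] [IsScalarTower A R K]
    (hinj : Function.Injective (algebraMap A K)) {I : Submodule A K} (hI : I.FG) (hI0 : I ≠ ⊥)
    (hR : Function.Injective (algebraMap R K)) (hR' : ∀ x, x ∈ (algebraMap R K).range ↔ x ∈ blowupAlgebra I)
    (h : IsLiftable A B I) : ∃! ψ : R →+* B, ψ.comp (algebraMap A R) = algebraMap A B := by
  obtain ⟨hu⟩ := nonempty_unique_blowupAlgebra_algHom hinj hI hI0 h
  let e₀ : R →ₐ[A] blowupAlgebra I := (IsScalarTower.toAlgHom A R K).codRestrict _ fun r ↦ (hR' _).mp ⟨r, rfl⟩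
  have he₀ : Function.Bijective e₀ := by
    refine ⟨fun a b hab ↦ hR (congr_arg Subtype.val hab), fun b ↦ ?_⟩
    obtain ⟨r, hr⟩ := (hR' b).mpr b.2
    exact ⟨r, Subtype.ext hr⟩
  let e := AlgEquiv.ofBijective e₀ he₀
  refine ⟨((hu.default).comp e.toAlgHom).toRingHom, ?_, fun ψ hψ ↦ ?_⟩
  · exact AlgHom.comp_algebraMap ((hu.default).comp e.toAlgHom)
  · let ψ' : R →ₐ[A] B := { ψ with commutes' a := congr($hψ a) }
    have h1 : ψ'.comp e.symm.toAlgHom = hu.default := hu.uniq _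
    ext r
    have := congr($h1 (e r))
    simp only [AlgHom.comp_apply] at this
    change _ = (hu.default) (e r)
    rw [← this]
    change ψ r = ψ (e.symm (e r))
    rw [e.symm_apply_apply]

end Algebra

/-! ### Construction of the blow-up scheme -/

section CurveModel

variable {k K : Type u} [Field k] [Field K] [Algebra k K] {X : Scheme.{u}}

/-- `X` is an integral `k`-scheme locally of finite type with function field `K`. -/
structure IsModelOver (s : X ⟶ Spec (.of k)) (j : Spec (.of K) ⟶ X) : Prop extends IsModel j where
  locallyOfFiniteType : LocallyOfFiniteType s
  comp_eq : j ≫ s = Spec.map (CommRingCat.ofHom (algebraMap k K))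

variable {s : X ⟶ Spec (.of k)} {j : Spec (.of K) ⟶ X}

theorem IsModelOver.isScalarTower (hj : IsModelOver s j) {U : X.Opens} (h : ⊤ ≤ j ⁻¹ᵁ U) :
    letI := sectionsAlgebra s U
    letI := (evalAt j U h).toAlgebra
    IsScalarTower k Γ(X, U) K := by
  let := sectionsAlgebra s U
  let := (evalAt j U h).toAlgebra
  refine .of_algebraMap_eq fun c ↦ ?_
  have hle : U ≤ s ⁻¹ᵁ ⊤ := le_top
  have h1 : s.appLE ⊤ U hle ≫ j.appLE U ⊤ h = (Spec.map (CommRingCat.ofHom (algebraMap k K))).appTop := by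
    rw [Scheme.Hom.appLE_comp_appLE]
    simp only [hj.comp_eq]
    exact Scheme.Hom.appLE_eq_app _
  have h2 : (Scheme.ΓSpecIso (.of k)).inv ≫ s.appLE ⊤ U hle ≫ j.appLE U ⊤ h ≫
      (Scheme.ΓSpecIso (.of K)).hom = CommRingCat.ofHom (algebraMap k K) := by
    rw [reassoc_of% h1, Scheme.ΓSpecIso_naturality, Iso.inv_hom_id_assoc]
  exact congr($h2.symm c)

theorem finiteType_sections (s : X ⟶ Spec (.of k)) [LocallyOfFiniteType s] {U : X.Opens}
    (hU : IsAffineOpen U) :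
    letI := sectionsAlgebra s U
    Algebra.FiniteType k Γ(X, U) := by
  have h1 := s.finiteType_appLE (isAffineOpen_top _) hU le_top
  have h2 : ((Scheme.ΓSpecIso (.of k)).inv ≫ s.appLE ⊤ U le_top).hom.FiniteType := by
    refine RingHom.FiniteType.comp h1 (RingHom.FiniteType.of_surjective _ ?_)
    exact (ConcreteCategory.bijective_of_isIso (Scheme.ΓSpecIso (.of k)).inv).2
  exact h2

theorem IsModel.isFractionRing (hj : IsModel j) {U : X.Opens} (h : ⊤ ≤ j ⁻¹ᵁ U) (hU : IsAffineOpen U) :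
    letI := (evalAt j U h).toAlgebra
    IsFractionRing Γ(X, U) K := by
  let := (evalAt j U h).toAlgebra
  have : FaithfulSMul Γ(X, U) K := (faithfulSMul_iff_algebraMap_injective _ _).mpr (hj.injective U h)
  refine IsFractionRing.of_field _ _ fun x ↦ ?_
  obtain ⟨a, b, hb, hab⟩ := hj.exists_mul_eq U h hU x
  exact ⟨a, b, (eq_div_iff hb).mpr hab⟩

theorem IsModel.isDomain (hj : IsModel j) {U : X.Opens} (h : ⊤ ≤ j ⁻¹ᵁ U) : IsDomain Γ(X, U) :=
  (hj.injective U h).isDomain _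

theorem isScalarTower_basicOpen {U : X.Opens} (h : ⊤ ≤ j ⁻¹ᵁ U) (g : Γ(X, U)) 
    (hg : ⊤ ≤ j ⁻¹ᵁ X.basicOpen g) :
    letI := (evalAt j U h).toAlgebra
    letI := (evalAt j (X.basicOpen g) hg).toAlgebra
    IsScalarTower Γ(X, U) Γ(X, X.basicOpen g) K := by
  let := (evalAt j U h).toAlgebra
  let := (evalAt j (X.basicOpen g) hg).toAlgebra
  exact .of_algebraMap_eq fun a ↦ (evalAt_map j (homOfLE (X.basicOpen_le g)) hg a).symm

theorem mem_blowupSubring_basicOpen (hj : IsModelOver s j) {D : Derivation k K K} (hD : D ≠ 0) {U : X.Opens} (hU : IsAffineOpen U)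
    (h : ⊤ ≤ j ⁻¹ᵁ U) (g : Γ(X, U)) (hg : ⊤ ≤ j ⁻¹ᵁ X.basicOpen g) {x : K} :
    x ∈ blowupSubring D (evalAt j (X.basicOpen g) hg) ↔
      ∃ m : ℕ, evalAt j U h g ^ m * x ∈ blowupSubring D (evalAt j U h) := by
  let := sectionsAlgebra s U
  let := (evalAt j U h).toAlgebra
  let := (evalAt j (X.basicOpen g) hg).toAlgebra
  have := hj.isScalarTower h
  have := hj.locallyOfFiniteType
  have := finiteType_sections s hU
  have := hj.isFractionRing h hU
  have := hj.isDomain h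
  have := isScalarTower_basicOpen h g hg
  have := hU.isLocalization_basicOpen g
  have : IsNoetherianRing Γ(X, U) := Algebra.FiniteType.isNoetherianRing k _
  have h1 := derIdeal_localization (A' := Γ(X, X.basicOpen g)) g ((le_preimage_basicOpen_iff j h g).mp hg) D
  change x ∈ blowupAlgebra (derIdeal Γ(X, X.basicOpen g) D) ↔ _
  rw [h1]
  exact mem_blowupAlgebra_span_iff (A' := Γ(X, X.basicOpen g)) g (derIdeal_fg hD)

theorem evalAt_mem_blowupSubring (D : Derivation k K K) {A : Type*} [CommRing A] (φ : A →+* K) (a : A) :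
    φ a ∈ blowupSubring D φ :=
  letI := φ.toAlgebra
  (blowupAlgebra (derIdeal A D)).algebraMap_mem a

theorem exists_derBlowup_model (hj : IsModelOver s j) {D : Derivation k K K} (hD : D ≠ 0) :
    ∃ (Y : Scheme.{u}) (f : Y ⟶ X) (j' : Spec (.of K) ⟶ Y), IsAffineHom f ∧ j' ≫ f = j ∧ IsModel j' ∧
      ∀ (U : X.Opens) (_ : IsAffineOpen U) (h : ⊤ ≤ j ⁻¹ᵁ U) (h' : ⊤ ≤ j' ⁻¹ᵁ f ⁻¹ᵁ U),
        (evalAt j' (f ⁻¹ᵁ U) h').range = blowupSubring D (evalAt j U h) := by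
  -- The infimum over proofs gives a family on all affine open sets; it is the whole field K where
  -- there is no K-valued point.
  let T (U : X.AffineZariskiSite) : Subring K := ⨅ h : ⊤ ≤ j ⁻¹ᵁ U.toOpens, blowupSubring D (evalAt j U.toOpens h)
  have hTeq (U : X.AffineZariskiSite) (h : ⊤ ≤ j ⁻¹ᵁ U.toOpens) : T U = blowupSubring D (evalAt j U.toOpens h) :=
    iInf_pos h
  obtain ⟨Y, f, j', h1, h2, h3, h4⟩ := exists_relativeSpec hj.toIsModel T (by
      rintro U V ⟨g, hg⟩ hU
      obtain rfl : U = V.basicOpen g := Subtype.ext hg.symm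
      have hV : ⊤ ≤ j ⁻¹ᵁ V.toOpens := hU.trans (j.preimage_mono (X.basicOpen_le g))
      rw [hTeq _ hU, hTeq _ hV]
      intro x hx
      exact (mem_blowupSubring_basicOpen hj hD V.2 hV g hU).mpr ⟨0, by simpa using hx⟩)
    (by
      intro U h a
      rw [hTeq _ h]
      exact evalAt_mem_blowupSubring D _ a)
    (by
      intro U h g hg x hx
      have hgU : ⊤ ≤ j ⁻¹ᵁ X.basicOpen g := (le_preimage_basicOpen_iff j h g).mpr hg
      rw [hTeq _ hgU] at hx
      rw [hTeq _ h]
      exact (mem_blowupSubring_basicOpen hj hD U.2 h g hgU).mp hx)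
  refine ⟨Y, f, j', h1, h2, h3, fun U hU h h' ↦ ?_⟩
  rw [← hTeq ⟨U, hU⟩ h]
  exact h4 ⟨U, hU⟩ h'

end CurveModel

end DerivationBlowup

namespace DerivationBlowup

/-! ### The constructed scheme is the blow-up at the derivations -/

section BlowupModel

variable {k K : Type u} [Field k] [Field K] [Algebra k K] {X Y Z : Scheme.{u}}

/-- `f : Y ⟶ X` is the affine morphism given by the algebras `blowupAlgebra (derIdeal A D)`. -/
structure IsBlowupModel (j : Spec (.of K) ⟶ X) (D : Derivation k K K) (f : Y ⟶ X)
    (j' : Spec (.of K) ⟶ Y) : Prop where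
  isAffineHom : IsAffineHom f
  comp_eq : j' ≫ f = j
  isModel : IsModel j'
  range_evalAt : ∀ (U : X.Opens) (_ : IsAffineOpen U) (h : ⊤ ≤ j ⁻¹ᵁ U) (h' : ⊤ ≤ j' ⁻¹ᵁ f ⁻¹ᵁ U),
    (evalAt j' (f ⁻¹ᵁ U) h').range = blowupSubring D (evalAt j U h)

variable {s : X ⟶ Spec (.of k)} {j : Spec (.of K) ⟶ X} {D : Derivation k K K} {f : Y ⟶ X}
    {j' : Spec (.of K) ⟶ Y}

theorem IsBlowupModel.top_le (hf : IsBlowupModel j D f j') {U : X.Opens} (h : ⊤ ≤ j ⁻¹ᵁ U) :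
    ⊤ ≤ j' ⁻¹ᵁ f ⁻¹ᵁ U := by
  rw [← hf.comp_eq] at h
  exact h

variable [CharZero k]

theorem IsBlowupModel.isFinite (hj : IsModelOver s j) (htr : Algebra.trdeg k K = 1) (hD : D ≠ 0)
    (hf : IsBlowupModel j D f j') : IsFinite f := by
  have := hf.isAffineHom
  refine ⟨fun U hU ↦ ?_⟩
  rcases (U : Set X).eq_empty_or_nonempty with hU0 | hU0
  · obtain rfl : U = ⊥ := Opens.ext hU0
    have : Subsingleton Γ(Y, f ⁻¹ᵁ ⊥) := by
      change Subsingleton Γ(Y, ⊥)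
      infer_instance
    exact RingHom.Finite.of_surjective _ fun y ↦ ⟨0, Subsingleton.elim _ _⟩
  have h := hj.le_preimage U hU0
  have h' := hf.top_le h
  let := sectionsAlgebra s U
  let := (evalAt j U h).toAlgebra
  have := hj.isScalarTower h
  have := hj.locallyOfFiniteType
  have := finiteType_sections s hU
  have := hj.isFractionRing h hU
  have := hj.isDomain h
  have hfin := finite_blowupAlgebra_derIdeal (A := Γ(X, U)) htr hD
  let := (f.app U).hom.toAlgebra
  let φ : Γ(Y, f ⁻¹ᵁ U) →ₗ[Γ(X, U)] blowupAlgebra (derIdeal Γ(X, U) D) :=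
    { toFun y := ⟨evalAt j' (f ⁻¹ᵁ U) h' y, by
        have h1 : evalAt j' (f ⁻¹ᵁ U) h' y ∈ (evalAt j' (f ⁻¹ᵁ U) h').range := ⟨y, rfl⟩
        rw [hf.range_evalAt U hU h h'] at h1
        exact h1⟩
      map_add' a b := Subtype.ext (map_add _ a b)
      map_smul' a b := Subtype.ext (by
        change evalAt j' (f ⁻¹ᵁ U) h' (f.app U a * b) = evalAt j U h a * evalAt j' (f ⁻¹ᵁ U) h' b
        rw [map_mul, evalAt_comp hf.comp_eq h' h]) }
  have : IsNoetherianRing Γ(X, U) := Algebra.FiniteType.isNoetherianRing k _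
  change Module.Finite Γ(X, U) Γ(Y, f ⁻¹ᵁ U)
  exact Module.Finite.of_injective φ fun a b hab ↦
    hf.isModel.injective _ h' (congr_arg Subtype.val hab)

theorem IsBlowupModel.isModelOver (hj : IsModelOver s j) (htr : Algebra.trdeg k K = 1) (hD : D ≠ 0)
    (hf : IsBlowupModel j D f j') : IsModelOver (f ≫ s) j' := by
  have := hf.isFinite hj htr hD
  have := hj.locallyOfFiniteType
  exact { hf.isModel with
    locallyOfFiniteType := inferInstance
    comp_eq := by rw [← Category.assoc, hf.comp_eq, hj.comp_eq] }

theorem IsModelOver.exists_generator [IsAlgClosed k] (hj : IsModelOver s j) (htr : Algebra.trdeg k K = 1)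
    (hD : D ≠ 0) (x : X) {V : X.Opens} (hV : IsAffineOpen V) (hxV : x ∈ V) :
    ∃ (g : Γ(X, V)) (h : ⊤ ≤ j ⁻¹ᵁ X.basicOpen g), x ∈ X.basicOpen g ∧
      letI := (evalAt j (X.basicOpen g) h).toAlgebra
      ∃ t ∈ derIdeal Γ(X, X.basicOpen g) D, t ≠ 0 ∧
        ∀ f ∈ derIdeal Γ(X, X.basicOpen g) D, f / t ∈ blowupAlgebra (derIdeal Γ(X, X.basicOpen g) D) := by
  have h := hj.le_preimage V ⟨x, hxV⟩
  let := sectionsAlgebra s V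
  let := (evalAt j V h).toAlgebra
  have := hj.isScalarTower h
  have := hj.locallyOfFiniteType
  have := finiteType_sections s hV
  have := hj.isFractionRing h hV
  have := hj.isDomain h
  let m : Ideal Γ(X, V) := (IsLocalRing.maximalIdeal (X.presheaf.stalk x)).comap (X.presheaf.germ V x hxV).hom
  obtain ⟨g, hg, t, ht0, ht⟩ := exists_generator_localization (A := Γ(X, V)) htr hD m
  have hxg : x ∈ X.basicOpen g := by
    rw [Scheme.mem_basicOpen _ _ _ hxV]
    by_contra h1
    exact hg h1
  have hjg := hj.le_preimage (X.basicOpen g) ⟨x, hxg⟩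
  let := sectionsAlgebra s (X.basicOpen g)
  let := (evalAt j (X.basicOpen g) hjg).toAlgebra
  have := hj.isScalarTower hjg
  have := finiteType_sections s (hV.basicOpen g)
  have := hj.isFractionRing hjg (hV.basicOpen g)
  have := hj.isDomain hjg
  have := isScalarTower_basicOpen h g hjg
  have := hV.isLocalization_basicOpen g
  obtain ⟨h1, h2⟩ := ht Γ(X, X.basicOpen g)
  exact ⟨g, hjg, hxg, t, h1, ht0, h2⟩

theorem IsBlowupModel.locallyFree [IsAlgClosed k] (hj : IsModelOver s j) (htr : Algebra.trdeg k K = 1)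
    (hD : D ≠ 0) (hf : IsBlowupModel j D f j') : DerLocallyFreeModTorsion s f := by
  intro y
  have := hf.isAffineHom
  obtain ⟨_, ⟨V, hV, rfl⟩, hyV, -⟩ := X.isBasis_affineOpens.exists_subset_of_mem_open (Set.mem_univ (f y)) isOpen_univ
  obtain ⟨g, h, hyU, t, ht, ht0, htI⟩ := hj.exists_generator htr hD (f y) hV hyV
  let U := X.basicOpen g
  have hU : IsAffineOpen U := hV.basicOpen g
  have h' := hf.top_le h
  let := sectionsAlgebra s U
  let := (evalAt j U h).toAlgebra
  have := hj.isScalarTower h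
  have := hj.locallyOfFiniteType
  have := finiteType_sections s hU
  have := hj.isFractionRing h hU
  have := hj.isDomain h
  let := (f.appLE U (f ⁻¹ᵁ U) le_rfl).hom.toAlgebra
  let := (evalAt j' (f ⁻¹ᵁ U) h').toAlgebra
  have : IsScalarTower Γ(X, U) Γ(Y, f ⁻¹ᵁ U) K := .of_algebraMap_eq fun a ↦ by
    change evalAt j U h a = evalAt j' _ h' (f.appLE U (f ⁻¹ᵁ U) le_rfl a)
    rw [← Scheme.Hom.app_eq_appLE, evalAt_comp hf.comp_eq h' h]
  have htrA : Algebra.trdeg k Γ(X, U) = 1 := (trdeg_eq_of_isFractionRing k Γ(X, U) K).trans htr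
  obtain ⟨e⟩ := nonempty_derivation_equiv_derIdeal htrA hD
  refine ⟨⟨U, hU⟩, ⟨f ⁻¹ᵁ U, hU.preimage f⟩, le_rfl, hyU, ?_⟩
  refine freeModTorsion_of_generator (K := K) (finrank_derivation_eq_one htrA hD) e ht ht0
    (hf.isModel.injective _ h') fun x hx ↦ ?_
  have h1 : x / t ∈ blowupSubring D (evalAt j U h) := htI x hx
  rw [← hf.range_evalAt U hU h h'] at h1
  exact h1

theorem IsModelOver.isLiftable (hj : IsModelOver s j) (htr : Algebra.trdeg k K = 1) (hD : D ≠ 0) 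
    {U : X.Opens} (hU : IsAffineOpen U) (h : ⊤ ≤ j ⁻¹ᵁ U) {B : Type*} [CommRing B] [Algebra Γ(X, U) B]
    (hB : letI := sectionsAlgebra s U; FreeModTorsion Γ(X, U) B (Derivation k Γ(X, U) Γ(X, U))) :
    letI := (evalAt j U h).toAlgebra
    IsLiftable Γ(X, U) B (derIdeal Γ(X, U) D) := by
  let := sectionsAlgebra s U
  let := (evalAt j U h).toAlgebra
  have := hj.isScalarTower h
  have := hj.locallyOfFiniteType
  have := finiteType_sections s hU
  have := hj.isFractionRing h hU
  have := hj.isDomain h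
  have htrA : Algebra.trdeg k Γ(X, U) = 1 := (trdeg_eq_of_isFractionRing k Γ(X, U) K).trans htr
  obtain ⟨e⟩ := nonempty_derivation_equiv_derIdeal htrA hD
  exact (hB.isLiftable (finrank_derivation_eq_one htrA hD)).congr e

theorem IsBlowupModel.existsUnique_app_comp (hj : IsModelOver s j) (hD : D ≠ 0)
    (hf : IsBlowupModel j D f j') {U : X.Opens} (hU : IsAffineOpen U) (h : ⊤ ≤ j ⁻¹ᵁ U)
    {B : CommRingCat.{u}} (τ : Γ(X, U) ⟶ B)
    (hB : letI := (evalAt j U h).toAlgebra; letI := τ.hom.toAlgebra;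
      IsLiftable Γ(X, U) B (derIdeal Γ(X, U) D)) : ∃! ψ : Γ(Y, f ⁻¹ᵁ U) ⟶ B, f.app U ≫ ψ = τ := by
  have h' := hf.top_le h
  let := sectionsAlgebra s U
  let := (evalAt j U h).toAlgebra
  have := hj.isScalarTower h
  have := hj.locallyOfFiniteType
  have := finiteType_sections s hU
  have := hj.isFractionRing h hU
  have := hj.isDomain h
  have : IsNoetherianRing Γ(X, U) := Algebra.FiniteType.isNoetherianRing k _
  let := (f.app U).hom.toAlgebra
  let := (evalAt j' (f ⁻¹ᵁ U) h').toAlgebra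
  let := τ.hom.toAlgebra
  have : IsScalarTower Γ(X, U) Γ(Y, f ⁻¹ᵁ U) K := .of_algebraMap_eq fun a ↦
    (evalAt_comp hf.comp_eq h' h a).symm
  obtain ⟨ψ, h1, h2⟩ := existsUnique_ringHom (A := Γ(X, U)) (B := B) (R := Γ(Y, f ⁻¹ᵁ U))
    (hj.injective U h) (derIdeal_fg hD) (derIdeal_ne_bot D) (hf.isModel.injective _ h') (fun x ↦ by
      change x ∈ (evalAt j' (f ⁻¹ᵁ U) h').range ↔ _
      rw [hf.range_evalAt U hU h h']
      rfl) hB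
  refine ⟨CommRingCat.ofHom ψ, CommRingCat.hom_ext h1, fun ψ' hψ' ↦ CommRingCat.hom_ext (h2 _ ?_)⟩
  exact congr_arg CommRingCat.Hom.hom hψ'

theorem map_mem_nonZeroDivisors_basicOpen {V : Z.Opens} (hV : IsAffineOpen V) (g : Γ(Z, V)) {e} {c : Γ(Z, V)}
    (hc : c ∈ nonZeroDivisors Γ(Z, V)) :
    (Z.basicOpen g).ι.appLE V ⊤ e c ∈ nonZeroDivisors Γ(Z.basicOpen g, ⊤) := by
  have := hV.isLocalization_basicOpen g
  have h1 : algebraMap Γ(Z, V) Γ(Z, Z.basicOpen g) c ∈ nonZeroDivisors Γ(Z, Z.basicOpen g) :=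
    IsLocalization.map_nonZeroDivisors_le (Submonoid.powers g) _ ⟨c, hc, rfl⟩
  have h2 : (Z.basicOpen g).ι.appLE V ⊤ e =
      Z.presheaf.map (homOfLE (Z.basicOpen_le g)).op ≫ (Z.basicOpen g).topIso.inv := by
    rw [Scheme.Opens.ι_appLE, Scheme.Opens.topIso_inv]
    exact Functor.map_comp _ _ _
  rw [h2]
  have h3 := MulEquivClass.map_nonZeroDivisors (Z.basicOpen g).topIso.symm.commRingCatIsoToRingEquiv
  rw [← h3]
  exact ⟨_, h1, rfl⟩

/-- The basic open sets inside the trivializing affine sets V z form a basis. Localization preserves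
non-zero-divisors, so liftability passes to them, and on each one the affine universal property
yields exactly one lift. -/
theorem IsBlowupModel.existsUnique_lift (hj : IsModelOver s j) (htr : Algebra.trdeg k K = 1)
    (hD : D ≠ 0) (hf : IsBlowupModel j D f j') (σ : Z ⟶ X) (hσ : DerLocallyFreeModTorsion s σ) :
    ∃! β : Z ⟶ Y, β ≫ f = σ := by
  have := hf.isAffineHom
  choose U V e hzV hfree using hσ
  refine existsUnique_lift_of_basis f σ (fun W ↦ ∃ (z : Z) (g : Γ(Z, (V z).1)), W = Z.basicOpen g)
    (fun W z hz ↦ ?_) ?_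
  · obtain ⟨g, hgW, hzg⟩ := (V z).2.exists_basicOpen_le ⟨z, hz⟩ (hzV z)
    exact ⟨_, ⟨z, g, rfl⟩, hzg, hgW⟩
  · rintro _ ⟨z, g, rfl⟩
    have : IsAffine (Z.basicOpen g).toScheme := (V z).2.basicOpen g
    have h := hj.le_preimage (U z).1 ⟨σ z, e z (hzV z)⟩
    have hτ : ⊤ ≤ ((Z.basicOpen g).ι ≫ σ) ⁻¹ᵁ (U z).1 := fun x _ ↦ e z (Z.basicOpen_le g x.2)
    have hτ' : ⊤ ≤ (Z.basicOpen g).ι ⁻¹ᵁ (V z).1 := fun x _ ↦ Z.basicOpen_le g x.2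
    refine existsUnique_lift_of_isAffine f _ (U z).2 hτ
      (hf.existsUnique_app_comp hj hD (U z).2 h _ ?_)
    let := sectionsAlgebra s (U z).1
    let := (evalAt j (U z).1 h).toAlgebra
    let := (σ.appLE (U z).1 (V z).1 (e z)).hom.toAlgebra
    let := (((Z.basicOpen g).ι ≫ σ).appLE (U z).1 ⊤ hτ).hom.toAlgebra
    let F : Γ(Z, (V z).1) →ₐ[Γ(X, (U z).1)] Γ(Z.basicOpen g, ⊤) :=
      { ((Z.basicOpen g).ι.appLE (V z).1 ⊤ hτ').hom with
        commutes' a := by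
          have := Scheme.Hom.appLE_comp_appLE (Z.basicOpen g).ι σ (U z).1 (V z).1 ⊤ (e z) hτ'
          exact congr($this a) }
    exact (hj.isLiftable htr hD (U z).2 h (hfree z)).baseChange F fun c hc ↦
      map_mem_nonZeroDivisors_basicOpen (V z).2 g hc

theorem IsBlowupModel.isDerBlowup [IsAlgClosed k] (hj : IsModelOver s j) (htr : Algebra.trdeg k K = 1)
    (hD : D ≠ 0) (hf : IsBlowupModel j D f j') : IsDerBlowup s f :=
  ⟨hf.locallyFree hj htr hD, fun _ σ hσ ↦ hf.existsUnique_lift hj htr hD σ hσ⟩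

end BlowupModel

end DerivationBlowup

namespace DerivationBlowup

/-! ### Regularity and normality -/

section Regular

/-- Regularity and dimension at most one bound the cotangent space by dimension one, and a
Noetherian local domain with this property is Dedekind. -/
theorem isIntegrallyClosed_of_isRegularLocalRing (R : Type*) [CommRing R] [IsDomain R]
    [IsRegularLocalRing R] [Ring.DimensionLEOne R] : IsIntegrallyClosed R := by
  have h1 : Ring.KrullDimLE 1 R := Ring.krullDimLE_one_iff_of_isPrime_bot.mpr fun I hI hI' ↦ hI'.isMaximal hI
  have h2 : ringKrullDim R ≤ 1 := by exact_mod_cast Order.KrullDimLE.krullDim_le (n := 1)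
  have h3 := (IsRegularLocalRing.iff_finrank_cotangentSpace (R := R)).mp inferInstance
  have h4 : Module.finrank (IsLocalRing.ResidueField R) (IsLocalRing.CotangentSpace R) ≤ 1 := by
    rw [← h3] at h2
    exact_mod_cast h2
  have h5 : IsDedekindDomain R := ((tfae_of_isNoetherianRing_of_isLocalRing_of_isDomain R).out 5 2).mp h4
  infer_instance

theorem isIso_presheaf_map_eqToHom {X : Scheme.{u}} {U V : X.Opens} (h : U = V) :
    IsIso (X.presheaf.map (eqToHom h).op) := by
  subst h
  infer_instance

theorem isIso_of_isIso_app {X Y : Scheme.{u}} (φ : Y ⟶ X) [IsAffineHom φ]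
    (H : ∀ W : X.Opens, IsAffineOpen W → IsIso (φ.app W)) : IsIso φ := by
  refine IsZariskiLocalAtTarget.of_iSup_eq_top (P := MorphismProperty.isomorphisms Scheme.{u})
    (fun W : X.affineOpens ↦ W.1) (iSup_affineOpens_eq_top X) fun W ↦ ?_
  have hW := H W.1 W.2
  have : IsAffine W.1.toScheme := W.2
  have : IsAffine (φ ⁻¹ᵁ W.1).toScheme := W.2.preimage φ
  have h1 : IsIso (φ.app (W.1.ι ''ᵁ ⊤)) := by
    rw [Scheme.Opens.ι_image_top]
    exact hW
  have h2 : IsIso (φ ∣_ W.1).appTop := by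
    rw [morphismRestrict_appTop]
    exact IsIso.comp_isIso' h1 (isIso_presheaf_map_eqToHom _)
  have h3 : φ ∣_ W.1 = (φ ⁻¹ᵁ W.1).toScheme.isoSpec.hom ≫ Spec.map (φ ∣_ W.1).appTop ≫ W.1.toScheme.isoSpec.inv := by
    rw [← Category.assoc, Iso.eq_comp_inv]
    exact (Scheme.isoSpec_hom_naturality _).symm
  change IsIso (φ ∣_ W.1)
  rw [h3]
  infer_instance

theorem isAffineHom_morphismRestrict {X Y : Scheme.{u}} (f : Y ⟶ X) [IsAffineHom f] (U : X.Opens) :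
    IsAffineHom (f ∣_ U) := by
  refine ⟨fun W hW ↦ ?_⟩
  rw [← Scheme.Hom.isAffineOpen_iff_of_isOpenImmersion (f ⁻¹ᵁ U).ι, image_morphismRestrict_preimage]
  exact (hW.image_of_isOpenImmersion U.ι).preimage f

variable {k K : Type u} [Field k] [Field K] [Algebra k K] {X Y Z : Scheme.{u}}
  {s : X ⟶ Spec (.of k)} {j : Spec (.of K) ⟶ X} {D : Derivation k K K} {f : Y ⟶ X}
  {j' : Spec (.of K) ⟶ Y} [CharZero k]

theorem IsModelOver.isIntegrallyClosed (hj : IsModelOver s j) (htr : Algebra.trdeg k K = 1)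
    {U : X.Opens} (hU : IsAffineOpen U) (h : ⊤ ≤ j ⁻¹ᵁ U) (hns : ∀ x ∈ U, NonsingularAt X x) :
    IsIntegrallyClosed Γ(X, U) := by
  let := sectionsAlgebra s U
  let := (evalAt j U h).toAlgebra
  have := hj.isScalarTower h
  have := hj.locallyOfFiniteType
  have := finiteType_sections s hU
  have := hj.isFractionRing h hU
  have := hj.isDomain h
  have htrA : Algebra.trdeg k Γ(X, U) = 1 := (trdeg_eq_of_isFractionRing k Γ(X, U) K).trans htr
  have := dimensionLEOne_of_trdeg_eq_one k htrA
  refine IsIntegrallyClosed.of_localization_maximal fun p _ hp ↦ ?_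
  have hmem : hU.fromSpec ⟨p, hp.isPrime⟩ ∈ U := by
    have : hU.fromSpec ⟨p, hp.isPrime⟩ ∈ Set.range hU.fromSpec := ⟨_, rfl⟩
    rw [hU.range_fromSpec] at this
    exact this
  let := TopCat.Presheaf.algebra_section_stalk X.presheaf ⟨_, hmem⟩
  have h1 : IsLocalization.AtPrime (X.presheaf.stalk (hU.fromSpec ⟨p, hp.isPrime⟩)) p :=
    hU.isLocalization_stalk' ⟨p, hp.isPrime⟩ hmem
  have h2 : IsRegularLocalRing (X.presheaf.stalk (hU.fromSpec ⟨p, hp.isPrime⟩)) := hns _ hmem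
  have h3 : IsRegularLocalRing (Localization.AtPrime p) :=
    h2.of_ringEquiv (IsLocalization.algEquiv p.primeCompl _ _).toRingEquiv
  have h4 : Ring.DimensionLEOne (Localization.AtPrime p) :=
    .localization (R := Γ(X, U)) _ p.primeCompl_le_nonZeroDivisors
  exact isIntegrallyClosed_of_isRegularLocalRing _

theorem IsModelOver.nonsingularAt (hj : IsModelOver s j) (htr : Algebra.trdeg k K = 1)
    {U : X.Opens} (hU : IsAffineOpen U) (h : ⊤ ≤ j ⁻¹ᵁ U) [IsIntegrallyClosed Γ(X, U)] {x : X} (hx : x ∈ U) :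
    NonsingularAt X x := by
  let := sectionsAlgebra s U
  let := (evalAt j U h).toAlgebra
  have := hj.isScalarTower h
  have := hj.locallyOfFiniteType
  have := finiteType_sections s hU
  have := hj.isFractionRing h hU
  have := hj.isDomain h
  have htrA : Algebra.trdeg k Γ(X, U) = 1 := (trdeg_eq_of_isFractionRing k Γ(X, U) K).trans htr
  have := isDedekindDomain_of_isIntegrallyClosed (k := k) htrA
  let := TopCat.Presheaf.algebra_section_stalk X.presheaf ⟨x, hx⟩
  have h1 := hU.isLocalization_stalk ⟨x, hx⟩
  let p := (hU.primeIdealOf ⟨x, hx⟩).asIdeal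
  have h2 : IsRegularLocalRing (Localization.AtPrime p) := inferInstance
  exact h2.of_ringEquiv (IsLocalization.algEquiv p.primeCompl _ _).toRingEquiv

theorem IsBlowupModel.isIso_app (hj : IsModelOver s j) (htr : Algebra.trdeg k K = 1) (hD : D ≠ 0)
    (hf : IsBlowupModel j D f j') {U : X.Opens} (hU : IsAffineOpen U) (hns : ∀ x ∈ U, NonsingularAt X x) :
    IsIso (f.app U) := by
  rcases (U : Set X).eq_empty_or_nonempty with hU0 | hU0
  · obtain rfl : U = ⊥ := Opens.ext hU0
    have : Subsingleton Γ(Y, f ⁻¹ᵁ ⊥) := inferInstanceAs (Subsingleton Γ(Y, ⊥))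
    exact (ConcreteCategory.isIso_iff_bijective (f.app ⊥)).mpr
      ⟨fun _ _ _ ↦ Subsingleton.elim _ _, fun y ↦ ⟨0, Subsingleton.elim _ _⟩⟩
  have h := hj.le_preimage U hU0
  have h' := hf.top_le h
  have := hj.isIntegrallyClosed htr hU h hns
  let := sectionsAlgebra s U
  let := (evalAt j U h).toAlgebra
  have := hj.isScalarTower h
  have := hj.locallyOfFiniteType
  have := finiteType_sections s hU
  have := hj.isFractionRing h hU
  have := hj.isDomain h
  have hbot := blowupAlgebra_derIdeal_eq_bot (A := Γ(X, U)) hD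
  have hbij : Function.Bijective (f.app U) := by
    refine ⟨fun a b hab ↦ hj.injective U h ?_, fun y ↦ ?_⟩
    · rw [← evalAt_comp hf.comp_eq h' h, ← evalAt_comp hf.comp_eq h' h, hab]
    · have h1 : evalAt j' (f ⁻¹ᵁ U) h' y ∈ (evalAt j' (f ⁻¹ᵁ U) h').range := ⟨y, rfl⟩
      rw [hf.range_evalAt U hU h h'] at h1
      change _ ∈ blowupAlgebra (derIdeal Γ(X, U) D) at h1
      rw [hbot, Algebra.mem_bot] at h1
      obtain ⟨a, ha⟩ := h1
      refine ⟨a, hf.isModel.injective _ h' ?_⟩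
      rw [evalAt_comp hf.comp_eq h' h]
      exact ha
  exact (ConcreteCategory.isIso_iff_bijective (f.app U)).mpr hbij

theorem IsBlowupModel.isIso_morphismRestrict (hj : IsModelOver s j) (htr : Algebra.trdeg k K = 1) (hD : D ≠ 0)
    (hf : IsBlowupModel j D f j') (U : X.Opens) (hns : ∀ x ∈ U, NonsingularAt X x) :
    IsIso (f ∣_ U) := by
  have := hf.isAffineHom
  have := isAffineHom_morphismRestrict f U
  refine isIso_of_isIso_app _ fun W hW ↦ ?_
  have := hf.isIso_app hj htr hD (hW.image_of_isOpenImmersion U.ι) fun x hx ↦ hns x (by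
    obtain ⟨y, -, rfl⟩ := hx
    exact y.2)
  rw [morphismRestrict_app]
  exact IsIso.comp_isIso' this (isIso_presheaf_map_eqToHom _)

/-- Where a blow-up changes nothing, the quotients f/t by a local generator t already lie in the
ring of a small neighbourhood of x. The derivations are then free there, and Lipman's theorem
applies. -/
theorem IsModelOver.nonsingularAt_of_blowupSubring_le [IsAlgClosed k] (hj : IsModelOver s j) (htr : Algebra.trdeg k K = 1)
    (hD : D ≠ 0) {U : X.Opens} (hU : IsAffineOpen U) (h : ⊤ ≤ j ⁻¹ᵁ U)
    (hle : blowupSubring D (evalAt j U h) ≤ (evalAt j U h).range) {x : X} (hx : x ∈ U) :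
    NonsingularAt X x := by
  obtain ⟨g, hg, hxg, t, ht, ht0, htI⟩ := hj.exists_generator htr hD x hU hx
  let := sectionsAlgebra s (X.basicOpen g)
  let := (evalAt j (X.basicOpen g) hg).toAlgebra
  have := hj.isScalarTower hg
  have := hj.locallyOfFiniteType
  have := finiteType_sections s (hU.basicOpen g)
  have := hj.isFractionRing hg (hU.basicOpen g)
  have := hj.isDomain hg
  have htrA : Algebra.trdeg k Γ(X, X.basicOpen g) = 1 :=
    (trdeg_eq_of_isFractionRing k Γ(X, X.basicOpen g) K).trans htr
  have hloc := hU.isLocalization_basicOpen g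
  have hbot : blowupAlgebra (derIdeal Γ(X, X.basicOpen g) D) = ⊥ := by
    refine blowupAlgebra_eq_bot_iff.mpr fun b hb ↦ ?_
    obtain ⟨m, hm⟩ := (mem_blowupSubring_basicOpen hj hD hU h g hg).mp hb
    obtain ⟨a, ha⟩ := hle hm
    refine ⟨IsLocalization.mk' _ a (⟨g ^ m, m, rfl⟩ : Submonoid.powers g), ?_⟩
    have h1 := IsLocalization.mk'_spec Γ(X, X.basicOpen g) a (⟨g ^ m, m, rfl⟩ : Submonoid.powers g)
    have h2 := congr_arg (evalAt j _ hg) h1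
    rw [map_mul] at h2
    have h3 (c : Γ(X, U)) : evalAt j _ hg (algebraMap Γ(X, U) Γ(X, X.basicOpen g) c) = evalAt j U h c :=
      evalAt_map j (homOfLE (X.basicOpen_le g)) hg c
    rw [h3, h3, ha, map_pow, mul_comm] at h2
    exact mul_left_cancel₀ (pow_ne_zero m ((le_preimage_basicOpen_iff j h g).mp hg)) h2
  have := isIntegrallyClosed_of_derIdeal_eq_span htrA hD (eq_span_singleton_of_blowupAlgebra_eq_bot ht ht0 htI hbot)
  exact hj.nonsingularAt htr (hU.basicOpen g) hg hxg

/-- A nonzero element g of the conductor works: multiplying by g sends integral elements into A, so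
they lie in A[1/g]. This gives the dense nonsingular open set needed for birationality. -/
theorem exists_isIntegrallyClosed_away {k A K : Type u} [Field k] [CharZero k] [CommRing A] [IsDomain A] [Field K]
    [Algebra k A] [Algebra k K] [Algebra A K] [IsScalarTower k A K] [IsFractionRing A K] [Algebra.FiniteType k A] (htr : Algebra.trdeg k A = 1) :
    ∃ g : A, g ≠ 0 ∧ ∀ (A' : Type u) [CommRing A'] [Algebra A A'] [Algebra A' K]
      [IsScalarTower A A' K] [IsLocalization.Away g A'] [IsFractionRing A' K], IsIntegrallyClosed A' := by
  let B := integralClosure A K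
  obtain ⟨hB, hfin⟩ := isDedekindDomain_and_finite_of_isIntegralClosure (k := k) (K := K) htr B
  have : IsNoetherianRing A := Algebra.FiniteType.isNoetherianRing k A
  have : Algebra.IsAlgebraic A K := IsLocalization.isAlgebraic _ (nonZeroDivisors A)
  have : IsFractionRing B K := integralClosure.isFractionRing_of_algebraic fun x hx ↦
    (map_eq_zero_iff _ (IsFractionRing.injective A K)).mp hx
  obtain ⟨c, hc, hc0⟩ := Submodule.exists_mem_ne_zero_of_ne_bot (conductorIn_ne_bot A B K)
  obtain ⟨g, rfl⟩ := mem_range_of_mem_conductorIn hc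
  refine ⟨g, fun h ↦ hc0 (by rw [h, map_zero]), fun A' _ _ _ _ _ _ ↦ ?_⟩
  rw [isIntegrallyClosed_iff K]
  intro x hx
  obtain ⟨⟨_, m, rfl⟩, hm⟩ := IsIntegral.exists_multiple_integral_of_isLocalization (Submonoid.powers g) x hx
  obtain ⟨a, ha⟩ := hc ⟨_, hm⟩
  have h1 : algebraMap A K a = algebraMap A K (g ^ (m + 1)) * x := by
    rw [ha, pow_succ', map_mul, mul_assoc]
    congr 1
    exact Algebra.smul_def _ _
  refine ⟨IsLocalization.mk' _ a (⟨g ^ (m + 1), m + 1, rfl⟩ : Submonoid.powers g), ?_⟩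
  have h2 := congr_arg (algebraMap A' K)
    (IsLocalization.mk'_spec A' a (⟨g ^ (m + 1), m + 1, rfl⟩ : Submonoid.powers g))
  rw [map_mul, ← IsScalarTower.algebraMap_apply, ← IsScalarTower.algebraMap_apply, h1, mul_comm] at h2
  refine mul_left_cancel₀ ?_ h2
  rw [map_pow]
  exact pow_ne_zero _ hc0

theorem IsModelOver.exists_nonsingular (hj : IsModelOver s j) (htr : Algebra.trdeg k K = 1) :
    ∃ U : X.Opens, (U : Set X).Nonempty ∧ ∀ x ∈ U, NonsingularAt X x := by
  obtain ⟨x⟩ : Nonempty (Spec (.of K)) := inferInstance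
  obtain ⟨_, ⟨V, hV, rfl⟩, hxV, -⟩ := X.isBasis_affineOpens.exists_subset_of_mem_open (Set.mem_univ (j x)) isOpen_univ
  have h := hj.le_preimage V ⟨_, hxV⟩
  let := sectionsAlgebra s V
  let := (evalAt j V h).toAlgebra
  have := hj.isScalarTower h
  have := hj.locallyOfFiniteType
  have := finiteType_sections s hV
  have := hj.isFractionRing h hV
  have := hj.isDomain h
  have htrA : Algebra.trdeg k Γ(X, V) = 1 := (trdeg_eq_of_isFractionRing k Γ(X, V) K).trans htr
  obtain ⟨g, hg0, H⟩ := exists_isIntegrallyClosed_away (K := K) htrA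
  have hjg : ⊤ ≤ j ⁻¹ᵁ X.basicOpen g := by
    rw [le_preimage_basicOpen_iff j h]
    rw [← map_zero (evalAt j V h)]
    exact (hj.injective V h).ne hg0
  let := (evalAt j (X.basicOpen g) hjg).toAlgebra
  have := isScalarTower_basicOpen h g hjg
  have := hV.isLocalization_basicOpen g
  have := hj.isFractionRing hjg (hV.basicOpen g)
  have := H Γ(X, X.basicOpen g)
  exact ⟨X.basicOpen g, nonempty_of_top_le_preimage j hjg, fun y hy ↦ hj.nonsingularAt htr (hV.basicOpen g) hjg hy⟩

end Regular

end DerivationBlowup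

namespace DerivationBlowup

/-! ### The function field and the dimension of the curve -/

section FunctionField

variable {k : Type u} [Field k] {X : Scheme.{u}}

theorem evalAt_fromSpecStalk {K : Type u} [Field K] {x : X} (e : X.presheaf.stalk x ⟶ .of K) {U : X.Opens}
    (hx : x ∈ U) (h : ⊤ ≤ (Spec.map e ≫ X.fromSpecStalk x) ⁻¹ᵁ U) (a : Γ(X, U)) :
    evalAt (Spec.map e ≫ X.fromSpecStalk x) U h a = e (X.presheaf.germ U x hx a) := by
  have h0 : (⊤ : (Spec (X.presheaf.stalk x)).Opens) ≤ X.fromSpecStalk x ⁻¹ᵁ U := by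
    intro y _
    have h1 : X.fromSpecStalk x y ∈ Set.range (X.fromSpecStalk x) := ⟨y, rfl⟩
    rw [Scheme.range_fromSpecStalk] at h1
    have h2 : X.fromSpecStalk x y ∈ U := Specializes.mem_open h1 U.2 hx
    exact h2
  have h2 : (X.fromSpecStalk x).appLE U ⊤ h0 = X.presheaf.germ U x hx ≫ (Scheme.ΓSpecIso _).inv := by
    rw [Scheme.Hom.appLE, Scheme.fromSpecStalk_app hx]
    simp only [Category.assoc, ← Functor.map_comp]
    have : (homOfLE le_top).op ≫ (homOfLE h0).op = 𝟙 (Opposite.op (⊤ : (Spec (X.presheaf.stalk x)).Opens)) :=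
      Subsingleton.elim _ _
    rw [this]
    simp
  have h3 : (Spec.map e ≫ X.fromSpecStalk x).appLE U ⊤ h ≫ (Scheme.ΓSpecIso (.of K)).hom =
      X.presheaf.germ U x hx ≫ e := by
    have h4 := Scheme.Hom.appLE_comp_appLE (Spec.map e) (X.fromSpecStalk x) U ⊤ ⊤ h0 le_rfl
    have h5 : (Spec.map e).appLE ⊤ ⊤ le_rfl = (Spec.map e).appTop := Scheme.Hom.appLE_eq_app _
    rw [← h4, h2, h5, Category.assoc, Category.assoc, Scheme.ΓSpecIso_naturality, Iso.inv_hom_id_assoc]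
  exact congr($h3 a)

theorem exists_isModel (X : Scheme.{u}) [IsIntegral X] :
    ∃ (K : Type u) (_ : Field K) (j : Spec (.of K) ⟶ X), IsModel j := by
  let K : Type u := X.functionField
  let e : X.functionField ⟶ .of K := CommRingCat.ofHom (RingHom.id K)
  refine ⟨K, inferInstance, Spec.map e ≫ X.fromSpecStalk (genericPoint X), .of_cover _ fun y ↦ ?_⟩
  obtain ⟨_, ⟨W, hW, rfl⟩, hyW, -⟩ := X.isBasis_affineOpens.exists_subset_of_mem_open (Set.mem_univ y) isOpen_univ
  have hη : genericPoint X ∈ W := ((genericPoint_spec X).mem_open_set_iff W.2).mpr ⟨y, trivial, hyW⟩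
  have h : ⊤ ≤ (Spec.map e ≫ X.fromSpecStalk (genericPoint X)) ⁻¹ᵁ W := by
    intro z _
    have h1 : X.fromSpecStalk (genericPoint X) (Spec.map e z) ∈ Set.range (X.fromSpecStalk (genericPoint X)) := ⟨_, rfl⟩
    rw [Scheme.range_fromSpecStalk] at h1
    have h2 : X.fromSpecStalk (genericPoint X) (Spec.map e z) ∈ W := Specializes.mem_open h1 W.2 hη
    exact h2
  have hW0 : Nonempty W := ⟨⟨y, hyW⟩⟩
  have hev (a : Γ(X, W)) : evalAt _ W h a = algebraMap Γ(X, W) X.functionField a :=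
    evalAt_fromSpecStalk e hη h a
  have hfr := functionField_isFractionRing_of_isAffineOpen X W hW
  refine ⟨W, h, hyW, hW, fun a b hab ↦ ?_, fun x ↦ ?_⟩
  · rw [hev, hev] at hab
    exact IsFractionRing.injective Γ(X, W) X.functionField hab
  · obtain ⟨a, b, hb, hab⟩ := IsFractionRing.div_surjective (A := Γ(X, W)) (x : X.functionField)
    have : Nontrivial Γ(X, W) := inferInstance
    have hb0 : algebraMap Γ(X, W) X.functionField b ≠ 0 := IsFractionRing.to_map_ne_zero_of_mem_nonZeroDivisors hb
    refine ⟨a, b, ?_, ?_⟩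
    · rw [hev]; exact hb0
    · rw [hev, hev]
      exact (eq_div_iff hb0).mp hab.symm

theorem exists_isModelOver [IsIntegral X] (s : X ⟶ Spec (.of k)) [LocallyOfFiniteType s] :
    ∃ (K : Type u) (_ : Field K) (_ : Algebra k K) (j : Spec (.of K) ⟶ X), IsModelOver s j := by
  obtain ⟨K, _, j, hj⟩ := exists_isModel X
  let : Algebra k K := (Spec.preimage (j ≫ s)).hom.toAlgebra
  exact ⟨K, _, this, j, { hj with
    locallyOfFiniteType := inferInstance
    comp_eq := (Spec.map_preimage (j ≫ s)).symm }⟩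

theorem krullDimLE_one_of_isIntegral (R A : Type*) [CommRing R] [IsDomain R] [CommRing A] [IsDomain A] [Algebra R A]
    [FaithfulSMul R A] [Algebra.IsIntegral R A] [Ring.KrullDimLE 1 A] : Ring.KrullDimLE 1 R := by
  refine Ring.krullDimLE_one_iff_of_isPrime_bot.mpr fun p hp hp' ↦ ?_
  obtain ⟨P, hP, rfl⟩ := Ideal.exists_ideal_over_prime_of_isIntegral_of_isDomain (S := A) p (by
    rw [(RingHom.injective_iff_ker_eq_bot _).mp (FaithfulSMul.algebraMap_injective R A)]
    exact bot_le)
  have : P.IsMaximal := Ring.krullDimLE_one_iff_of_isPrime_bot.mp ‹_› P (by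
    rintro rfl
    refine hp ?_
    rw [← RingHom.ker, (RingHom.injective_iff_ker_eq_bot _).mp (FaithfulSMul.algebraMap_injective R A)]) hP
  exact Ideal.isMaximal_comap_of_isIntegral_of_isMaximal P

/-- By Noether normalization A is finite over a polynomial ring in as many variables as the
transcendence degree, and integrality carries the bound on the dimension down to that ring. -/
theorem trdeg_eq_one_or_eq_zero (k A : Type u) [Field k] [CommRing A] [IsDomain A] [Algebra k A]
    [Algebra.FiniteType k A] (h : ringKrullDim A ≤ 1) : Algebra.trdeg k A = 1 ∨ Algebra.trdeg k A = 0 := by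
  obtain ⟨n, g, hg, hfin⟩ := exists_finite_inj_algHom_of_fg k A
  let : Algebra (MvPolynomial (Fin n) k) A := g.toRingHom.toAlgebra
  have : IsScalarTower k (MvPolynomial (Fin n) k) A := .of_algebraMap_eq' g.comp_algebraMap.symm
  have : FaithfulSMul (MvPolynomial (Fin n) k) A := (faithfulSMul_iff_algebraMap_injective _ _).mpr hg
  have : Module.Finite (MvPolynomial (Fin n) k) A := hfin
  have htr : Algebra.trdeg k A = n := by
    have h1 := lift_trdeg_add_eq k (MvPolynomial (Fin n) k) A
    rw [MvPolynomial.trdeg_of_isDomain, trdeg_eq_zero (R := MvPolynomial (Fin n) k)] at h1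
    simpa using h1.symm
  have : Ring.KrullDimLE 1 A := ⟨by exact_mod_cast h⟩
  have := krullDimLE_one_of_isIntegral (MvPolynomial (Fin n) k) A
  have h2 : ringKrullDim (MvPolynomial (Fin n) k) ≤ 1 := by exact_mod_cast Order.KrullDimLE.krullDim_le (n := 1)
  have h3 := ringKrullDim_add_natCard_le_ringKrullDim_mvPolynomial (R := k) (Fin n)
  rw [ringKrullDim_eq_zero_of_field, zero_add, Nat.card_eq_fintype_card, Fintype.card_fin] at h3
  have h4 : n ≤ 1 := by exact_mod_cast h3.trans h2
  rw [htr]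
  interval_cases n <;> simp

variable {K : Type u} [Field K] [Algebra k K] {s : X ⟶ Spec (.of k)} {j : Spec (.of K) ⟶ X}

/-- If the degree were zero, all rings of affine open sets would be fields. Then every point would
be the generic point, and X would have dimension zero. -/
theorem IsModelOver.trdeg_eq_one (hj : IsModelOver s j) (hdim : topologicalKrullDim X = 1) :
    Algebra.trdeg k K = 1 := by
  have hA (U : X.Opens) (hU : IsAffineOpen U) (h : ⊤ ≤ j ⁻¹ᵁ U) :
      Algebra.trdeg k K = 1 ∨ (Algebra.trdeg k K = 0 ∧ IsField Γ(X, U)) := by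
    let := sectionsAlgebra s U
    let := (evalAt j U h).toAlgebra
    have := hj.isScalarTower h
    have := hj.locallyOfFiniteType
    have := finiteType_sections s hU
    have := hj.isFractionRing h hU
    have := hj.isDomain h
    have h1 : ringKrullDim Γ(X, U) ≤ 1 := by
      rw [← PrimeSpectrum.topologicalKrullDim_eq_ringKrullDim, ← hdim]
      exact hU.fromSpec.isOpenEmbedding.isInducing.topologicalKrullDim_le
    rw [← trdeg_eq_of_isFractionRing k Γ(X, U) K]
    refine (trdeg_eq_one_or_eq_zero k Γ(X, U) h1).imp_right fun h2 ↦ ⟨h2, ?_⟩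
    have := trdeg_eq_zero_iff.mp h2
    exact isField_of_isIntegral_of_isField' (Field.toIsField k)
  by_contra hne
  have hsub : Subsingleton X := by
    have := hj.isIntegral
    have key (x : X) : x = genericPoint X := by
      obtain ⟨_, ⟨W, hW, rfl⟩, hxW, -⟩ := X.isBasis_affineOpens.exists_subset_of_mem_open (Set.mem_univ x) isOpen_univ
      have hη : genericPoint X ∈ W := ((genericPoint_spec X).mem_open_set_iff W.2).mpr ⟨x, trivial, hxW⟩
      obtain ⟨-, hf⟩ := (hA W hW (hj.le_preimage W ⟨x, hxW⟩)).resolve_left hne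
      let := hf.toField
      have : Subsingleton (PrimeSpectrum Γ(X, W)) := inferInstance
      have h1 : x ∈ Set.range hW.fromSpec := by rw [hW.range_fromSpec]; exact hxW
      have h2 : genericPoint X ∈ Set.range hW.fromSpec := by rw [hW.range_fromSpec]; exact hη
      obtain ⟨y, rfl⟩ := h1
      obtain ⟨z, hz⟩ := h2
      rw [← hz]
      congr 1
      exact Subsingleton.elim (α := PrimeSpectrum Γ(X, W)) _ _
    exact ⟨fun x y ↦ (key x).trans (key y).symm⟩
  have := topologicalKrullDim_zero_of_discreteTopology X
  rw [hdim] at this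
  exact absurd this (by decide)

end FunctionField

/-! ### The ascending chain condition for integral subrings -/

section Chain

/-- The rings between the image of `A` in `K` and its integral closure. -/
def IntegralSubring {A K : Type*} [CommRing A] [Field K] (φ : A →+* K) : Type _ :=
  {R : Subring K // φ.range ≤ R ∧ ∀ x ∈ R, φ.IsIntegralElem x}

instance {A K : Type*} [CommRing A] [Field K] (φ : A →+* K) : PartialOrder (IntegralSubring φ) :=
  inferInstanceAs (PartialOrder {R : Subring K // φ.range ≤ R ∧ ∀ x ∈ R, φ.IsIntegralElem x})

/-- Such rings are submodules of the integral closure, a Noetherian A-module. -/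
theorem wellFoundedGT_integralSubring {A K : Type*} [CommRing A] [Field K] [Algebra A K] [IsNoetherianRing A]
    [Module.Finite A (integralClosure A K)] : WellFoundedGT (IntegralSubring (algebraMap A K)) := by
  let F (R : IntegralSubring (algebraMap A K)) : Submodule A (integralClosure A K) :=
    { carrier := {x | (x : K) ∈ R.1}
      add_mem' := fun hx hy ↦ add_mem (S := Subring K) hx hy
      zero_mem' := zero_mem R.1
      smul_mem' := fun a x hx ↦ by
        change (a • x : K) ∈ R.1
        rw [Algebra.smul_def]
        exact mul_mem (R.2.1 ⟨a, rfl⟩) hx }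
  have hF (R R') : F R ≤ F R' ↔ R ≤ R' :=
    ⟨fun h x hx ↦ @h ⟨x, R.2.2 x hx⟩ hx, fun h x hx ↦ h hx⟩
  exact StrictMono.wellFoundedGT (f := F) fun R R' h ↦
    lt_of_le_not_ge ((hF _ _).mpr h.le) fun h' ↦ h.not_ge ((hF _ _).mp h')

end Chain

end DerivationBlowup

namespace DerivationBlowup

/-! ### Towers of blow-ups and their termination -/

section Tower

variable {k K : Type u} [Field k] [Field K] [Algebra k K] {X Y Y' : Scheme.{u}}
  {s : X ⟶ Spec (.of k)} {j : Spec (.of K) ⟶ X} {D : Derivation k K K} {n : ℕ} {π : Y ⟶ X}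
  {j' : Spec (.of K) ⟶ Y}

theorem nonsingularAt_of_isIso_morphismRestrict {π : Y ⟶ X} {U : X.Opens} (h : IsIso (π ∣_ U)) {y : Y}
    (hy : π y ∈ U) (hns : NonsingularAt X (π y)) : NonsingularAt Y y := by
  let e := morphismRestrictStalkMap π U ⟨y, hy⟩
  have h1 : IsIso (π.stalkMap y) := by
    have h2 (z : (π ⁻¹ᵁ U).toScheme) : IsIso ((π ∣_ U).stalkMap z) := inferInstance
    exact ((MorphismProperty.isomorphisms CommRingCat).arrow_mk_iso_iff e).mp (h2 _)
  have h3 : IsRegularLocalRing (X.presheaf.stalk (π y)) := hns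
  exact h3.of_ringEquiv (asIso (π.stalkMap y)).commRingCatIsoToRingEquiv

/-- An iterated blow-up `π : Y ⟶ X` at the derivations, with the properties needed to go on. -/
structure IsTower (s : X ⟶ Spec (.of k)) (j : Spec (.of K) ⟶ X) (n : ℕ) (π : Y ⟶ X)
    (j' : Spec (.of K) ⟶ Y) : Prop where
  iterated : IsIteratedDerBlowup s n π
  isModelOver : IsModelOver (π ≫ s) j'
  comp_eq : j' ≫ π = j
  isFinite : IsFinite π
  isIso : ∀ U : X.Opens, (∀ x ∈ U, NonsingularAt X x) → IsIso (π ∣_ U)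

theorem IsTower.refl (hj : IsModelOver s j) : IsTower s j 0 (𝟙 X) j where
  iterated := .zero
  isModelOver := by rwa [Category.id_comp]
  comp_eq := Category.comp_id j
  isFinite := inferInstance
  isIso U _ := by
    rw [morphismRestrict_id]
    exact inferInstanceAs (IsIso (𝟙 U.toScheme))

theorem IsTower.succ [IsAlgClosed k] [CharZero k] (htr : Algebra.trdeg k K = 1) (hD : D ≠ 0)
    (h : IsTower s j n π j') {f : Y' ⟶ Y} {j'' : Spec (.of K) ⟶ Y'} (hf : IsBlowupModel j' D f j'') :
    IsTower s j (n + 1) (f ≫ π) j'' where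
  iterated := .succ π f h.iterated (hf.isDerBlowup h.isModelOver htr hD)
  isModelOver := by
    rw [Category.assoc]
    exact hf.isModelOver h.isModelOver htr hD
  comp_eq := by rw [← Category.assoc, hf.comp_eq, h.comp_eq]
  isFinite := by
    have := h.isFinite
    have := hf.isFinite h.isModelOver htr hD
    infer_instance
  isIso U hU := by
    have h1 := h.isIso U hU
    -- Over U the earlier composite is an isomorphism, so the preimage of U is again nonsingular and
    -- the next blow-up leaves it unchanged.
    have h2 := hf.isIso_morphismRestrict h.isModelOver htr hD (π ⁻¹ᵁ U) fun y hy ↦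
      nonsingularAt_of_isIso_morphismRestrict h1 hy (hU _ hy)
    rw [morphismRestrict_comp]
    exact IsIso.comp_isIso' h2 h1

theorem IsTower.top_le (h : IsTower s j n π j') {U : X.Opens} (hU : ⊤ ≤ j ⁻¹ᵁ U) : ⊤ ≤ j' ⁻¹ᵁ π ⁻¹ᵁ U := by
  rw [← h.comp_eq] at hU
  exact hU

/-- The sections over the preimage of an affine open set, as a ring integral over the sections below. -/
noncomputable def IsTower.integralSubring (h : IsTower s j n π j') {U : X.Opens} (hU : IsAffineOpen U) (hjU : ⊤ ≤ j ⁻¹ᵁ U) :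
    IntegralSubring (evalAt j U hjU) :=
  ⟨(evalAt j' (π ⁻¹ᵁ U) (h.top_le hjU)).range, by
    rintro _ ⟨a, rfl⟩
    exact ⟨π.app U a, evalAt_comp h.comp_eq _ hjU a⟩, by
    rintro _ ⟨y, rfl⟩
    have := h.isFinite
    obtain ⟨p, hp, hpy⟩ := (π.finite_app U hU).to_isIntegral y
    refine ⟨p, hp, ?_⟩
    have h1 : evalAt j U hjU = (evalAt j' (π ⁻¹ᵁ U) (h.top_le hjU)).comp (π.app U).hom :=
      RingHom.ext fun a ↦ (evalAt_comp h.comp_eq _ hjU a).symm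
    rw [h1, ← Polynomial.hom_eval₂, hpy, map_zero]⟩

theorem IsTower.integralSubring_le [IsAlgClosed k] [CharZero k] (htr : Algebra.trdeg k K = 1) (hD : D ≠ 0)
    (h : IsTower s j n π j') {f : Y' ⟶ Y} {j'' : Spec (.of K) ⟶ Y'} (hf : IsBlowupModel j' D f j'') 
    {U : X.Opens} (hU : IsAffineOpen U) (hjU : ⊤ ≤ j ⁻¹ᵁ U) :
    h.integralSubring hU hjU ≤ (h.succ htr hD hf).integralSubring hU hjU := by
  rintro _ ⟨a, rfl⟩
  exact ⟨f.app (π ⁻¹ᵁ U) a, evalAt_comp hf.comp_eq _ _ a⟩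

theorem IsTower.nonsingularAt_of_integralSubring_eq [IsAlgClosed k] [CharZero k] (htr : Algebra.trdeg k K = 1) (hD : D ≠ 0)
    (h : IsTower s j n π j') {f : Y' ⟶ Y} {j'' : Spec (.of K) ⟶ Y'} (hf : IsBlowupModel j' D f j'') 
    {U : X.Opens} (hU : IsAffineOpen U) (hjU : ⊤ ≤ j ⁻¹ᵁ U)
    (he : (h.succ htr hD hf).integralSubring hU hjU ≤ h.integralSubring hU hjU) {y : Y} (hy : π y ∈ U) :
    NonsingularAt Y y := by
  have := h.isFinite
  refine h.isModelOver.nonsingularAt_of_blowupSubring_le htr hD (hU.preimage π) (h.top_le hjU) ?_ hy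
  rw [← hf.range_evalAt (π ⁻¹ᵁ U) (hU.preimage π) (h.top_le hjU) (hf.top_le (h.top_le hjU))]
  exact he

theorem IsModelOver.wellFoundedGT_integralSubring [CharZero k] (hj : IsModelOver s j) (htr : Algebra.trdeg k K = 1)
    {U : X.Opens} (hU : IsAffineOpen U) (h : ⊤ ≤ j ⁻¹ᵁ U) : WellFoundedGT (IntegralSubring (evalAt j U h)) := by
  let := sectionsAlgebra s U
  let := (evalAt j U h).toAlgebra
  have := hj.isScalarTower h
  have := hj.locallyOfFiniteType
  have := finiteType_sections s hU
  have := hj.isFractionRing h hU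
  have := hj.isDomain h
  have htrA : Algebra.trdeg k Γ(X, U) = 1 := (trdeg_eq_of_isFractionRing k Γ(X, U) K).trans htr
  have : IsNoetherianRing Γ(X, U) := Algebra.FiniteType.isNoetherianRing k _
  have := (isDedekindDomain_and_finite_of_isIntegralClosure (k := k) (K := K) htrA
    (integralClosure Γ(X, U) K)).2
  exact DerivationBlowup.wellFoundedGT_integralSubring (A := Γ(X, U)) (K := K)

/-- Well-founded induction on the tuple of rings over the finite affine cover. A further blow-up can
only enlarge them; if one grows strictly, continue, and if none does, the present stage is
nonsingular. -/
theorem IsTower.exists_nonsingular [IsAlgClosed k] [CharZero k] (htr : Algebra.trdeg k K = 1) (hD : D ≠ 0)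
    (hj : IsModelOver s j) {ι : Type u} [Finite ι] (U : ι → X.Opens) (hU : ∀ i, IsAffineOpen (U i))
    (hjU : ∀ i, ⊤ ≤ j ⁻¹ᵁ U i) (hcover : ∀ x, ∃ i, x ∈ U i) :
    ∃ (n : ℕ) (Y : Scheme.{u}) (π : Y ⟶ X) (j' : Spec (.of K) ⟶ Y),
      IsTower s j n π j' ∧ ∀ y, NonsingularAt Y y := by
  have (i : ι) := hj.wellFoundedGT_integralSubring htr (hU i) (hjU i)
  -- The order is reversed so that growing rings become a descending sequence.
  let M := ∀ i, (IntegralSubring (evalAt j (U i) (hjU i)))ᵒᵈ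
  let m {n : ℕ} {Y : Scheme.{u}} {π : Y ⟶ X} {j' : Spec (.of K) ⟶ Y} (h : IsTower s j n π j') : M :=
    fun i ↦ OrderDual.toDual (h.integralSubring (hU i) (hjU i))
  have key (a : M) : ∀ {n : ℕ} {Y : Scheme.{u}} {π : Y ⟶ X} {j' : Spec (.of K) ⟶ Y}
      (h : IsTower s j n π j'), m h = a → ∃ (n : ℕ) (Y : Scheme.{u}) (π : Y ⟶ X) (j' : Spec (.of K) ⟶ Y),
        IsTower s j n π j' ∧ ∀ y, NonsingularAt Y y := by
    induction a using WellFoundedLT.induction with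
    | ind a ih =>
      rintro n Y π j' h rfl
      obtain ⟨Y', f, j'', h1, h2, h3, h4⟩ := exists_derBlowup_model h.isModelOver hD
      have hf : IsBlowupModel j' D f j'' := ⟨h1, h2, h3, h4⟩
      have hle : m (h.succ htr hD hf) ≤ m h := fun i ↦ h.integralSubring_le htr hD hf (hU i) (hjU i)
      rcases hle.lt_or_eq with hlt | heq
      · exact ih _ hlt (h.succ htr hD hf) rfl
      -- The answer is Y itself; the last blow-up only served to test stability.
      · refine ⟨n, Y, π, j', h, fun y ↦ ?_⟩
        obtain ⟨i, hi⟩ := hcover (π y)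
        exact h.nonsingularAt_of_integralSubring_eq htr hD hf (hU i) (hjU i) (heq.ge i) hi
  exact key _ (IsTower.refl hj) rfl

theorem IsTower.isResolutionOfSingularities [CharZero k] (htr : Algebra.trdeg k K = 1) (hj : IsModelOver s j)
    (h : IsTower s j n π j') (hns : ∀ y, NonsingularAt Y y) : IsResolutionOfSingularities π where
  integral := h.isModelOver.isIntegral
  nonsingular := hns
  proper := by
    have := h.isFinite
    infer_instance
  birational := by
    have := hj.isIntegral
    have := h.isModelOver.isIntegral
    obtain ⟨U, hU, hU'⟩ := hj.exists_nonsingular htr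
    exact ⟨U, U.2.dense hU, (π ⁻¹ᵁ U).2.dense (nonempty_of_top_le_preimage j' (h.top_le (hj.le_preimage U hU))),
      h.isIso U hU'⟩
  isIso_over_nonsingular := h.isIso

theorem IsModelOver.exists_derivation_ne_zero [CharZero k] (hj : IsModelOver s j) (htr : Algebra.trdeg k K = 1) :
    ∃ D : Derivation k K K, D ≠ 0 := by
  obtain ⟨x⟩ : Nonempty (Spec (.of K)) := inferInstance
  obtain ⟨_, ⟨U, hU, rfl⟩, hxU, -⟩ := X.isBasis_affineOpens.exists_subset_of_mem_open (Set.mem_univ (j x)) isOpen_univ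
  have h := hj.le_preimage U ⟨_, hxU⟩
  let := sectionsAlgebra s U
  let := (evalAt j U h).toAlgebra
  have := hj.isScalarTower h
  have := hj.locallyOfFiniteType
  have := finiteType_sections s hU
  have := hj.isFractionRing h hU
  have := hj.isDomain h
  exact DerivationBlowup.exists_derivation_ne_zero
    ((trdeg_eq_of_isFractionRing k Γ(X, U) K).trans htr)

end Tower

end DerivationBlowup

theorem mainTheorem6 {k : Type u} [Field k] [IsAlgClosed k] [CharZero k]
    (C : Scheme.{u}) (s : C ⟶ Spec (.of k)) [IsIntegral C] [IsSeparated s]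
    [LocallyOfFiniteType s] [QuasiCompact s] (hdim : topologicalKrullDim C = 1) :
    ∃ (n : ℕ) (C' : Scheme.{u}) (π : C' ⟶ C),
      DerivationBlowup.IsIteratedDerBlowup s n π ∧
      DerivationBlowup.IsResolutionOfSingularities π := by
  obtain ⟨K, _, _, j, hj⟩ := DerivationBlowup.exists_isModelOver s
  have htr := hj.trdeg_eq_one hdim
  obtain ⟨D, hD⟩ := hj.exists_derivation_ne_zero htr
  -- Finiteness of the affine cover is essential: the product of the chain conditions is
  -- well-founded only for finitely many factors.
  have hC : CompactSpace C := by
    have := QuasiCompact.isCompact_preimage (f := s) ⊤ isOpen_univ isCompact_univ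
    exact ⟨this⟩
  choose U hU hxU using fun x : C ↦ (show ∃ U : C.Opens, IsAffineOpen U ∧ x ∈ U by
    obtain ⟨_, ⟨U, hU, rfl⟩, hxU, -⟩ :=
      C.isBasis_affineOpens.exists_subset_of_mem_open (Set.mem_univ x) isOpen_univ
    exact ⟨U, hU, hxU⟩)
  obtain ⟨t, ht⟩ := isCompact_univ.elim_finite_subcover (fun x ↦ (U x : Set C)) (fun x ↦ (U x).2)
    fun x _ ↦ Set.mem_iUnion.mpr ⟨x, hxU x⟩
  obtain ⟨n, C', π, j', h, hns⟩ := DerivationBlowup.IsTower.exists_nonsingular htr hD hj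
    (fun i : t ↦ U i) (fun i ↦ hU i) (fun i ↦ hj.le_preimage _ ⟨i, hxU i⟩) fun x ↦ by
      obtain ⟨i, hi, hx⟩ := Set.mem_iUnion₂.mp (ht (Set.mem_univ x))
      exact ⟨⟨i, hi⟩, hx⟩
  exact ⟨n, C', π, h.iterated, h.isResolutionOfSingularities htr hj hns⟩
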